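/- **Theorem (Efficiency of change propagation).** Let $A$ be a deterministic fork–join (nested-parallel) program built from unit-cost local steps, allocation of modifiables (shared references), writes, $k$-ary reads $\mathrm{read}(m_1,\dots,m_k;f)$ (which call the reader function $f$ on the current values of $m_1,\dots,m_k$ and return nothing), and binary forks. An execution of $A$ is valid if every modifiable, input modifiables included, is written at most once, is not read before it is written, is accessed only within the dynamic scope of the computation that allocated it, and forked computations do not see each other's writes. Let $I\neq I'$ be two input states (partial assignments of values to statically allocated modifiables, all of which are read in the respective execution) such that $A(I)$ and $A(I')$ are valid, and let every read have at most $K$ arguments. Let $T,T'$ be the RSP trees of $A(I)$ and $A(I')$: binary trees of scopes, where a read (resp. a fork) executed in a scope creates as left child an R node, the scope of the reader function (resp. a P node whose two children are S nodes, the scopes of the two branches), and as right child an S node, the scope of the continuation. R nodes of $T$ and $T'$ are *cognates* if the paths to them are the same and carry the same labels; a pair of cognates is *affected* if they read different values and are not in the subtrees of another such pair. Let * $R_\Delta$ be the number of affected pairs of reads; * $W_\Delta=\delta(T,T')$ be the computation distance, i.e. $\delta(T,T')=w(T)+w(T')$ if the roots are R nodes that read different values, where $w$ is the work of the reader function at the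 root (reads and writes taking constant time), and otherwise the sum of the distances of the corresponding subtrees of the roots; * $s$ be the larger of the spans of $A(I)$ and $A(I')$, and $h$ the larger of the heights of $T$ and $T'$; * $n$ be the total number of nodes of $T$ and $T'$ and of modifiables in $I$ and in $I'$. Change propagation on $T$ with the update $(I,I')$ writes the changed inputs, where each write that changes a value flags all readers of the modifiable as affected and marks them and their ancestors; it then traverses the marked nodes of the tree (in order below S and R nodes, in parallel below P nodes), and at each R node flagged as affected destroys the old subtree and re-executes the reader function, whose writes may mark further nodes. The set of readers of each modifiable is kept in a hash table with chaining, whose hash function is uniformly random with independent values, and which after the run of $A(I)$ has as many buckets as entries (at least one); deletions are performed when a subtree is destroyed, insertions and resizing in one parallel batch at the end. Then there is a constant $C>0$ that depends only on $K$ such that change propagation on $T$ with the update $(I,I')$ performs at most $C\,(W_\Delta+R_\Delta\cdot h)$ work in expectation and, for every real $c\ge 1$, has span at most $C\cdot c\cdot s\cdot h$ with probability at least $1-1/n^{c}$. -/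

import Mathlib

namespace SelfAdjusting

/-! ### Programs

A program is a fork-join computation over modifiables.  All local computation (arithmetic, branching,
closures) happens in the ambient functions; every unit of local work is recorded by a `step`. -/

/-- A position in a binary tree, *deepest branch first*: `[]` is the root, `false :: p` is the left
child and `true :: p` the right child of `p`. -/
abbrev Path := List Bool

/-- A modifiable: either allocated before the computation is run, or the `i`-th modifiable that was
allocated by the computation whose scope is the tree node at `p`. -/
inductive Modifiable (ι : Type*) where
  | static (i : ι)
  | dyn (p : Path) (i : ℕ)
  deriving DecidableEq

/-- Programs.  The last argument of each constructor is the continuation. The reader function of a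
`read` receives the list of the values of the modifiables that are read; since readers and forked
computations return nothing, continuations do not depend on the values that are read. -/
inductive Prog (ι V : Type*) where
  | done
  | step (k : Prog ι V)
  | alloc (k : Modifiable ι → Prog ι V)
  | write (m : Modifiable ι) (v : V) (k : Prog ι V)
  | read (ms : List (Modifiable ι)) (f : List V → Prog ι V) (k : Prog ι V)
  | par (a b k : Prog ι V)

/-! ### RSP trees -/

/-- Node labels. An `R` node carries the modifiables it reads, its reader function, and the values
that were read. -/
inductive Label (ι V : Type*) where
  | S
  | P
  | R (ms : List (Modifiable ι)) (f : List V → Prog ι V) (vals : List V)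

inductive Kind where
  | S
  | P
  | R

/-- RSP trees. `nil` is the absent child. Every node records the number `strand` of unit-cost
operations which are performed in its scope outside of the scopes of its children, and the number
`allocs` of modifiables allocated in its scope. -/
inductive Tree (ι V : Type*) where
  | nil
  | node (lab : Label ι V) (strand allocs : ℕ) (l r : Tree ι V)

variable {ι V : Type*}

def Label.kind : Label ι V → Kind
  | .S => .S
  | .P => .P
  | .R _ _ _ => .R

/-- The modifiables read by a node (none, unless it is an `R` node). -/
def Label.mods : Label ι V → List (Modifiable ι)
  | .R ms _ _ => ms
  | _ => []

/-- The values read by a node (none, unless it is an `R` node). -/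
def Label.vals : Label ι V → List V
  | .R _ _ vs => vs
  | _ => []

namespace Tree

/-- Number of nodes. -/
def nodes : Tree ι V → ℕ
  | nil => 0
  | node _ _ _ l r => 1 + l.nodes + r.nodes

/-- Height: the number of nodes on a longest path from the root to a leaf. -/
def height : Tree ι V → ℕ
  | nil => 0
  | node _ _ _ l r => 1 + max l.height r.height

/-- Work of the computation that a tree represents, where every primitive takes constant time. -/
def work : Tree ι V → ℕ
  | nil => 0
  | node _ s _ l r => s + l.work + r.work

/-- Span of the computation that a tree represents, where every primitive takes constant time: the
children of a `P` node are composed in parallel, those of the other nodes sequentially. -/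
def span : Tree ι V → ℕ
  | nil => 0
  | node .P s _ l r => s + max l.span r.span
  | node .S s _ l r => s + (l.span + r.span)
  | node (.R _ _ _) s _ l r => s + (l.span + r.span)

/-- Every read node reads at most `K` modifiables. -/
def ArityLe (K : ℕ) : Tree ι V → Prop
  | nil => True
  | node lab _ _ l r => lab.mods.length ≤ K ∧ l.ArityLe K ∧ r.ArityLe K

/-- Some node of the tree reads `m`. -/
def Reads (m : Modifiable ι) : Tree ι V → Prop
  | nil => False
  | node lab _ _ l r => m ∈ lab.mods ∨ l.Reads m ∨ r.Reads m

/-- The subtree that is reached from the root by the branches `q`, listed *from the root on*. -/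
def sub : Tree ι V → List Bool → Tree ι V
  | t, [] => t
  | nil, _ :: _ => nil
  | node _ _ _ l r, d :: q => if d then r.sub q else l.sub q

def kind : Tree ι V → Option Kind
  | nil => none
  | node lab _ _ _ _ => some lab.kind

def vals : Tree ι V → List V
  | nil => []
  | node lab _ _ _ _ => lab.vals

/-- The read nodes at position `q` of the two trees are cognates: the paths to them carry the same
labels in both trees. -/
def Cognate (T T' : Tree ι V) (q : List Bool) : Prop :=
  (∀ q₀, q₀ <+: q → (T.sub q₀).kind = (T'.sub q₀).kind) ∧ (T.sub q).kind = some .R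

/-- The read nodes at position `q` are cognates and read different values. -/
def Differ (T T' : Tree ι V) (q : List Bool) : Prop :=
  Cognate T T' q ∧ (T.sub q).vals ≠ (T'.sub q).vals

/-- An affected pair of cognate read nodes: the values that are read differ, and the pair is not
subsumed by another such pair. -/
def Affected (T T' : Tree ι V) (q : List Bool) : Prop :=
  Differ T T' q ∧ ∀ q₀, q₀ <+: q → q₀ ≠ q → ¬ Differ T T' q₀

/-- The number of affected reads. -/
noncomputable def numAffected (T T' : Tree ι V) : ℕ :=
  {q | Affected T T' q}.ncard

/-- The computation distance. (Trees of two runs of one program are only ever compared at positions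
where both have a node or neither has.) -/
def dist [DecidableEq V] : Tree ι V → Tree ι V → ℕ
  | node (.R ms f vs) s a l r, node (.R ms' f' vs') s' a' l' r' =>
      if vs ≠ vs' then
        (node (.R ms f vs) s a l r).work + (node (.R ms' f' vs') s' a' l' r').work
      else dist l l' + dist r r'
  | node _ _ _ l r, node _ _ _ l' r' => dist l l' + dist r r'
  | _, _ => 0

end Tree

/-! ### From-scratch execution -/

/-- What the execution of a program in the scope of a node contributes to this node. -/
structure Body (ι V : Type*) where
  strand : ℕ
  allocs : ℕ
  l : Tree ι V
  r : Tree ι V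

def Body.node (lab : Label ι V) (b : Body ι V) : Tree ι V := .node lab b.strand b.allocs b.l b.r

/-- One more unit of work in the strand. -/
def Body.tick (b : Body ι V) : Body ι V := { b with strand := b.strand + 1 }

/-- The scope of a read followed by a continuation. -/
def Body.read (i : ℕ) (ms : List (Modifiable ι)) (f : List V → Prog ι V) (vs : List V)
    (b k : Body ι V) : Body ι V :=
  ⟨1, i, b.node (.R ms f vs), k.node .S⟩

/-- The scope of a fork followed by a continuation. -/
def Body.par (i : ℕ) (a b k : Body ι V) : Body ι V :=
  ⟨1, i, .node .P 0 0 (a.node .S) (b.node .S), k.node .S⟩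

/-- The store after the given writes. -/
def writes [DecidableEq ι] (σ : Modifiable ι → Option V) : List (Modifiable ι × V) → Modifiable ι → Option V
  | [] => σ
  | (m, v) :: τ => writes (Function.update σ m (some v)) τ

/-- `Eval E σ p i A b τ`: in the scope of the node `p`, which has allocated `i` modifiables before,
with `E` the modifiables in whose dynamic scope it lies and `σ` the values written before, the program
`A` validly runs to its end, performs the writes `τ` and produces `b`.  Validity means that
modifiables are written at most once, are not read before they are written, and are accessed in the
dynamic scope of the computation which allocated them only.  Forked computations do not see each
other's writes. -/
inductive Eval [DecidableEq ι] : Set (Modifiable ι) → (Modifiable ι → Option V) → Path → ℕ → Prog ι V →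
    Body ι V → List (Modifiable ι × V) → Prop where
  | done {E σ p i} : Eval E σ p i .done ⟨0, i, .nil, .nil⟩ []
  | step {E σ p i k b τ} : Eval E σ p i k b τ → Eval E σ p i (.step k) b.tick τ
  | alloc {E σ p i k b τ} :
      Eval (insert (.dyn p i) E) σ p (i + 1) (k (.dyn p i)) b τ →
      Eval E σ p i (.alloc k) b.tick τ
  | write {E σ p i m v k b τ} : m ∈ E → σ m = none →
      Eval E (Function.update σ m (some v)) p i k b τ →
      Eval E σ p i (.write m v k) b.tick ((m, v) :: τ)
  | read {E σ p i ms f k vs b₁ τ₁ b₂ τ₂} : (∀ m ∈ ms, m ∈ E) → ms.map σ = vs.map some →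
      Eval E σ (false :: p) 0 (f vs) b₁ τ₁ →
      Eval E (writes σ τ₁) (true :: p) 0 k b₂ τ₂ →
      Eval E σ p i (.read ms f k) (.read i ms f vs b₁ b₂) (τ₁ ++ τ₂)
  | par {E σ p i a b k ba τa bb τb bk τk} :
      Eval E σ (false :: false :: p) 0 a ba τa →
      Eval E σ (true :: false :: p) 0 b bb τb →
      (∀ x ∈ τa, ∀ y ∈ τb, x.1 ≠ y.1) →
      Eval E (writes σ (τa ++ τb)) (true :: p) 0 k bk τk →
      Eval E σ p i (.par a b k) (.par i ba bb bk) (τa ++ τb ++ τk)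

/-- The store given by an input state. -/
def inputStore (I : ι → Option V) : Modifiable ι → Option V
  | .static i => I i
  | .dyn _ _ => none

/-- `Runs A I τ T`: executing `A` on the input state `I` is valid and results in the writes `τ` and the
RSP tree `T`; the modifiables of `I` are modifiables that `A` reads. -/
def Runs [DecidableEq ι] (A : Prog ι V) (I : ι → Option V) (τ : List (Modifiable ι × V)) (T : Tree ι V) :
    Prop :=
  (∃ b : Body ι V, Eval (Set.range Modifiable.static) (inputStore I) [] 0 A b τ ∧ T = b.node .S) ∧
    ∀ i, I i ≠ none → T.Reads (.static i)

/-! ### Costs -/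

/-- Hash functions: `h B x` is the bucket of the key `x` in a table with `B` buckets. -/
abbrev Hash := ℕ → Path → ℕ

/-- Work and span of a piece of the run of the algorithm, as functions of the hash functions. -/
structure Cost where
  work : Hash → ℕ
  span : Hash → ℕ

namespace Cost

def maxOf (l : List ℕ) : ℕ := l.foldr max 0

/-- `n` sequential unit-cost instructions. -/
def tick (n : ℕ) : Cost := ⟨fun _ => n, fun _ => n⟩

/-- Sequential composition. -/
def seq (c d : Cost) : Cost := ⟨fun h => c.work h + d.work h, fun h => c.span h + d.span h⟩

instance : Add Cost := ⟨seq⟩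

/-- Binary fork. -/
def par (c d : Cost) : Cost :=
  ⟨fun h => 1 + c.work h + d.work h, fun h => 1 + max (c.span h) (d.span h)⟩

/-- Parallel loop, with the iterations forked by a balanced binary tree. -/
def parFor (l : List Cost) : Cost :=
  ⟨fun h => 1 + l.length + (l.map fun c => c.work h).sum,
   fun h => 1 + Nat.clog 2 l.length + maxOf (l.map fun c => c.span h)⟩

/-- An operation on the key `p` in a hash table with chaining that has `B` buckets and the contents
`es`: it walks through the chain of `p`. -/
def probe (B : ℕ) (es : List Path) (p : Path) : Cost :=
  ⟨fun h => 1 + (es.filter fun q => h B q = h B p).length,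
   fun h => 1 + (es.filter fun q => h B q = h B p).length⟩

/-- Processing the chain of bucket `b`, for a table whose contents are the first components of `xs`;
the processing of a key, whose cost is the second component, is forked off when it is met. -/
def chain (B : ℕ) (xs : List (Path × ℕ)) (b : ℕ) : Cost :=
  ⟨fun h => ((xs.filter fun x => h B x.1 = b).map fun x => 1 + x.2).sum,
   fun h => (xs.filter fun x => h B x.1 = b).length +
     maxOf ((xs.filter fun x => h B x.1 = b).map Prod.snd)⟩

/-- Parallel loop over all keys of a hash table with `B` buckets. -/
def scan (B : ℕ) (xs : List (Path × ℕ)) : Cost := parFor ((List.range B).map (chain B xs))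

end Cost

/-! ### Reader sets -/

/-- A hash table with chaining: the number of buckets, and the keys. -/
structure Table where
  size : ℕ
  elems : List Path

/-- A newly built table. -/
def Table.fresh (es : List Path) : Table := ⟨max 1 es.length, es⟩

/-- Batch insertion in parallel; the table is rebuilt with a new number of buckets if it has become too
full or too sparse. -/
def Table.insertAll (t : Table) (new : List Path) : Table × Cost :=
  let es := t.elems ++ new
  if es.length ≤ 2 * t.size ∧ t.size ≤ 4 * es.length + 1 then
    (⟨t.size, es⟩, Cost.tick 1 + Cost.parFor (new.map (Cost.probe t.size es)))
  else
    (Table.fresh es,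
      Cost.tick 1 + Cost.scan t.size (t.elems.map fun q => (q, 0)) +
        Cost.parFor (List.replicate (max 1 es.length) (Cost.tick 1)) +
        Cost.parFor (es.map (Cost.probe (max 1 es.length) es)))

/-! ### The state of change propagation -/

/-- The state: the values and the reader sets of the modifiables, the marked nodes, the affected read
nodes, the insertions into reader sets that are still to be made, and the modifiables from whose
reader set something was deleted. -/
structure State (ι V : Type*) where
  val : Modifiable ι → Option V
  tab : Modifiable ι → Table
  marked : Finset Path
  affected : Finset Path
  pend : List (Modifiable ι × Path)
  dels : List (Modifiable ι)

/-- `mark`: the marked nodes afterwards, and the number of nodes visited. -/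
def mark : Path → Finset Path → Finset Path × ℕ
  | [], s => (insert [] s, 1)
  | d :: p, s =>
    if p ∈ s then (insert (d :: p) s, 1)
    else
      let x := mark p (insert (d :: p) s)
      (x.1, x.2 + 1)

namespace State

/-- Flag each of the readers as affected and mark it. Also returns the cost for each reader. -/
def notify (σ : State ι V) : List Path → State ι V × List (Path × ℕ)
  | [] => (σ, [])
  | p :: ps =>
    let k := mark p σ.marked
    let x := notify { σ with marked := k.1, affected := insert p σ.affected } ps
    (x.1, (p, k.2 + 1) :: x.2)

/-- `write`. -/
def write [DecidableEq ι] [DecidableEq V] (σ : State ι V) (m : Modifiable ι) (v : V) :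
    State ι V × Cost :=
  if σ.val m ≠ some v then
    let x := notify { σ with val := Function.update σ.val m (some v) } (σ.tab m).elems
    (x.1, Cost.tick 1 + Cost.scan (σ.tab m).size x.2)
  else (σ, Cost.tick 1)

/-- `m` becomes a newly allocated modifiable. -/
def alloc [DecidableEq ι] (σ : State ι V) (m : Modifiable ι) : State ι V :=
  { σ with
    val := Function.update σ.val m none
    tab := Function.update σ.tab m (Table.fresh []) }

/-- The first `a` modifiables allocated in the scope of the node `p` are deallocated. -/
def dealloc (σ : State ι V) (p : Path) (a : ℕ) : State ι V :=
  let own : Modifiable ι → Bool := fun m =>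
    match m with
    | .dyn q i => decide (q = p ∧ i < a)
    | .static _ => false
  { σ with
    val := fun m => if own m then none else σ.val m
    tab := fun m => if own m then Table.fresh [] else σ.tab m }

/-- The values of the given modifiables. (No modifiable is ever read before it is written; the default
value only serves to make this function total.) -/
def vals [Inhabited V] (σ : State ι V) (ms : List (Modifiable ι)) : List V :=
  ms.map fun m => (σ.val m).getD default

/-- The read node `p` is to be inserted into the reader sets of the modifiables `ms`. -/
def register [DecidableEq ι] (σ : State ι V) (ms : List (Modifiable ι)) (p : Path) : State ι V :=
  { σ with pend := (ms.dedup.map fun m => (m, p)) ++ σ.pend }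

/-- The read node `p` is deleted from the reader sets of the modifiables `ms`. -/
def unregister [DecidableEq ι] (σ : State ι V) (p : Path) : List (Modifiable ι) → State ι V × Cost
  | [] => (σ, Cost.tick 0)
  | m :: ms =>
    let t := σ.tab m
    let x := unregister
      { σ with
        tab := Function.update σ.tab m ⟨t.size, t.elems.erase p⟩
        dels := m :: σ.dels } p ms
    (x.1, Cost.probe t.size t.elems p + x.2)

/-- Remove the mark and the flag of a node. -/
def clear (σ : State ι V) (p : Path) : State ι V :=
  { σ with marked := σ.marked.erase p, affected := σ.affected.erase p }

/-- After the traversal, the insertions into the reader sets are performed in one batch. -/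
def flush [DecidableEq ι] (σ : State ι V) : State ι V × Cost :=
  let touched := (σ.pend.map Prod.fst ++ σ.dels).dedup
  let new : Modifiable ι → List Path := fun m => (σ.pend.filter fun x => x.1 = m).map Prod.snd
  ({ σ with
      tab := fun m => if m ∈ touched then ((σ.tab m).insertAll (new m)).1 else σ.tab m
      pend := []
      dels := [] },
    Cost.parFor (touched.map fun m => ((σ.tab m).insertAll (new m)).2))

end State

/-! ### Change propagation -/

/-- The result of executing a program within change propagation. -/
structure Out (ι V : Type*) where
  body : Body ι V
  state : State ι V
  cost : Cost

/-- Instrumented execution of a program in the scope of the node `p`, which has allocated `i`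
modifiables before. -/
def exec [DecidableEq ι] [DecidableEq V] [Inhabited V] :
    Prog ι V → Path → ℕ → State ι V → Out ι V
  | .done, _, i, σ => ⟨⟨0, i, .nil, .nil⟩, σ, Cost.tick 0⟩
  | .step k, p, i, σ =>
    let o := exec k p i σ
    ⟨o.body.tick, o.state, Cost.tick 1 + o.cost⟩
  | .alloc k, p, i, σ =>
    let o := exec (k (.dyn p i)) p (i + 1) (σ.alloc (.dyn p i))
    ⟨o.body.tick, o.state, Cost.tick 1 + o.cost⟩
  | .write m v k, p, i, σ =>
    let w := σ.write m v
    let o := exec k p i w.1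
    ⟨o.body.tick, o.state, w.2 + o.cost⟩
  | .read ms f k, p, i, σ =>
    let vs := σ.vals ms
    let o₁ := exec (f vs) (false :: p) 0 (σ.register ms (false :: p))
    let o₂ := exec k (true :: p) 0 o₁.state
    ⟨.read i ms f vs o₁.body o₂.body, o₂.state,
      Cost.tick (2 + 2 * ms.length) + o₁.cost + o₂.cost⟩
  | .par a b k, p, i, σ =>
    let oa := exec a (false :: false :: p) 0 σ
    let ob := exec b (true :: false :: p) 0 oa.state
    let ok := exec k (true :: p) 0 ob.state
    ⟨.par i oa.body ob.body ok.body, ok.state,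
      Cost.tick 4 + Cost.par oa.cost ob.cost + ok.cost⟩

namespace Tree

/-- Destruction of the subtree at `p`, the two children being destroyed in parallel. -/
def destroy [DecidableEq ι] : Tree ι V → Path → State ι V → State ι V × Cost
  | nil, _, σ => (σ, Cost.tick 0)
  | node lab _ a l r, p, σ =>
    let u := σ.unregister p lab.mods
    let x := l.destroy (false :: p) ((u.1.dealloc p a).clear p)
    let y := r.destroy (true :: p) x.1
    (y.1, Cost.tick (1 + a) + u.2 + Cost.par x.2 y.2)

/-- `propagate` on the subtree at `p`. -/
def propagate [DecidableEq ι] [DecidableEq V] [Inhabited V] :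
    Tree ι V → Path → State ι V → Tree ι V × State ι V × Cost
  | nil, _, σ => (nil, σ, Cost.tick 0)
  | node .P s a l r, p, σ =>
    if false :: p ∈ σ.marked ∧ true :: p ∈ σ.marked then
      let x := l.propagate (false :: p) σ
      let y := r.propagate (true :: p) x.2.1
      (node .P s a x.1 y.1, y.2.1.clear p, Cost.tick 1 + Cost.par x.2.2 y.2.2)
    else if false :: p ∈ σ.marked then
      let x := l.propagate (false :: p) σ
      (node .P s a x.1 r, x.2.1.clear p, Cost.tick 1 + x.2.2)
    else
      let y := r.propagate (true :: p) σ
      (node .P s a l y.1, y.2.1.clear p, Cost.tick 1 + y.2.2)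
  | node .S s a l r, p, σ =>
    let x := if false :: p ∈ σ.marked then l.propagate (false :: p) σ else (l, σ, Cost.tick 0)
    let y := if true :: p ∈ x.2.1.marked then r.propagate (true :: p) x.2.1
      else (r, x.2.1, Cost.tick 0)
    (node .S s a x.1 y.1, y.2.1.clear p, Cost.tick 1 + x.2.2 + y.2.2)
  | node (.R ms f vs) s a l r, p, σ =>
    if p ∈ σ.affected then
      let x := l.destroy (false :: p) (σ.dealloc p a)
      let y := r.destroy (true :: p) x.1
      let o := exec (f (y.1.vals ms)) p 0 y.1
      (o.body.node (.R ms f (y.1.vals ms)), o.state.clear p,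
        Cost.tick (1 + a + ms.length) + Cost.par x.2 y.2 + o.cost)
    else
      let x := if false :: p ∈ σ.marked then l.propagate (false :: p) σ else (l, σ, Cost.tick 0)
      let y := if true :: p ∈ x.2.1.marked then r.propagate (true :: p) x.2.1
        else (r, x.2.1, Cost.tick 0)
      (node (.R ms f vs) s a x.1 y.1, y.2.1.clear p, Cost.tick 1 + x.2.2 + y.2.2)

/-- The read nodes that read `m`, for a subtree at `p`. -/
def readers [DecidableEq ι] (m : Modifiable ι) : Tree ι V → Path → List Path
  | nil, _ => []
  | node lab _ _ l r, p =>
    (if m ∈ lab.mods then [p] else []) ++ l.readers m (false :: p) ++ r.readers m (true :: p)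

end Tree

/-- The state of the framework after a run with input state `I`, writes `τ` and RSP tree `T`: the values
of the modifiables, the hash tables of their readers, and no marks. -/
def afterRun [DecidableEq ι] (I : ι → Option V) (τ : List (Modifiable ι × V)) (T : Tree ι V) :
    State ι V where
  val := writes (inputStore I) τ
  tab m := Table.fresh (T.readers m [])
  marked := ∅
  affected := ∅
  pend := []
  dels := []

/-- `U` lists the changes by which one gets from the input state `I` to `I'`: the new values of the
modifiables which are changed or added. -/
def IsUpdate (I I' : ι → Option V) (U : List (ι × V)) : Prop :=
  U.Nodup ∧ ∀ i v, (i, v) ∈ U ↔ I' i = some v ∧ I i ≠ some v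

/-- Writing the changed inputs. -/
def applyUpdate [DecidableEq ι] [DecidableEq V] (σ : State ι V) :
    List (ι × V) → State ι V × List Cost
  | [] => (σ, [])
  | (i, v) :: U =>
    let w := σ.write (.static i) v
    let x := applyUpdate w.1 U
    (x.1, w.2 :: x.2)

/-- Change propagation on the tree `T` in the state `σ` with the changes `U`: write the changed inputs in
parallel, propagate from the root, and update the reader sets. -/
def changePropagation [DecidableEq ι] [DecidableEq V] [Inhabited V] (T : Tree ι V) (σ : State ι V)
    (U : List (ι × V)) : Tree ι V × State ι V × Cost :=
  let u := applyUpdate σ U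
  let x := if [] ∈ u.1.marked then T.propagate [] u.1 else (T, u.1, Cost.tick 0)
  let y := x.2.1.flush
  (x.1, y.1, Cost.parFor u.2 + Cost.tick 1 + x.2.2 + y.2)

/-! ### Random hash functions -/

/-- `H` is a random family of hash functions: for every number `B` of buckets, the hash values of the
keys are independent and uniformly distributed on `{0, …, B - 1}`. -/
structure UniformHashing {Ω : Type*} [MeasurableSpace Ω] (μ : MeasureTheory.Measure Ω)
    (H : Ω → Hash) : Prop where
  measurable : ∀ B p, Measurable fun ω => H ω B p
  uniform : ∀ B p b, b < B → μ {ω | H ω B p = b} = (B : ENNReal)⁻¹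
  indep : ∀ B, ProbabilityTheory.iIndepFun (fun p ω => H ω B p) μ

end SelfAdjusting

/-! The hash functions enter the costs only. The trees, the states and the contents of the tables
are fixed by the old run and the update, so the tables that change propagation uses form a family
chosen before any randomness. This splits the proof into a probabilistic and a deterministic half,
and `Cost.Bounded` carries both: expected work, and span under the assumption that chains are short.

Probability. Nothing is inserted during the traversal, so a table that is probed has at most two
keys per bucket, and an operation walks through O(1) keys in expectation (`probe_bounded`). A
Chernoff bound (`load_tail`) and a union bound over the O(n²) buckets (`forall_load_le`) give chains
of length at most L = O(c log n) outside an event of probability n^(-c), and log n = O(h).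

Correctness. Let F be the final store of the old run. The invariant `Inv` says that the flagged
nodes are exactly the readers, outside the visited set D, of modifiables whose current value differs
from F, and that the marked nodes are the ancestors of flagged nodes together with the path A on
which the traversal stands. Writing once and never reading before writing keep it true: a surviving
modifiable holds its old value until the new run writes it, and no node visited earlier can still be
a reader of it. So when a read node is reached, its arguments hold what the from-scratch run on I'
reads, and the node is flagged exactly if this differs from the old values. Induction on the old
run, with inversion of the new run of the same program, shows that propagation produces the new tree
(`body_spec`, resting on `read_node_spec`, `par_node_spec`, `exec_spec` and `Tree.destroy_spec`).

Work. The number of marked nodes is a potential. Climbing to mark ancestors is paid by the marks it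
creates; each removal of a mark is charged to a node above or at an affected read, or to a destroyed
node. As there are no marks at either end, the work is O(K) times the distance, the size of the
affected subtrees and the spine (the nodes at or above affected reads), plus the numbers of readers
of changed modifiables. `Eval.compare` reduces these numbers and the subtree sizes to distance and
spine, and `Tree.spine_le` bounds the spine by R·h. Since I ≠ I', some read is affected
(`Runs.spine_pos`), which absorbs the additive constants.

Span. A write has span O(h + L), and subtrees are destroyed in parallel with span O(KL) per level
beyond the allocations. Each unit of span of either run is therefore charged `spanRate` = O(h + (K +
1)(L + 1)), and with L = O(c·h) the total is O(c·s·h). -/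

namespace SelfAdjusting

open MeasureTheory ProbabilityTheory

set_option linter.unusedSectionVars false
set_option linter.unusedVariables false

section

/-! ### Expected work and span of costs -/

/-- The expected work of `c` is at most `w`, and its span is at most `s` for the hash functions
in `G`. -/
structure Cost.Bounded {Ω : Type*} [MeasurableSpace Ω] (μ : Measure Ω) (H : Ω → Hash)
    (G : Hash → Prop) (c : Cost) (w s : ℕ) : Prop where
  meas : Measurable fun ω => c.work (H ω)
  work : ∫⁻ ω, (c.work (H ω) : ENNReal) ∂μ ≤ w
  span : ∀ g, G g → c.span g ≤ s

theorem Cost.add_work (c d : Cost) (g : Hash) : (c + d).work g = c.work g + d.work g := rfl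

theorem Cost.add_span (c d : Cost) (g : Hash) : (c + d).span g = c.span g + d.span g := rfl

theorem Cost.maxOf_le {l : List ℕ} {s : ℕ} (h : ∀ x ∈ l, x ≤ s) : Cost.maxOf l ≤ s := by
  induction l with
  | nil => simp [Cost.maxOf]
  | cons a l ih =>
    have := ih fun x hx => h x (List.mem_cons_of_mem _ hx)
    have h2 := h a List.mem_cons_self
    simp only [Cost.maxOf, List.foldr_cons] at *
    exact max_le h2 this

/-- The length of the chain of bucket `b`. -/
def load (B : ℕ) (es : List Path) (b : ℕ) (g : Hash) : ℕ := (es.filter fun q => g B q = b).length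

/-- Deletions only shorten chains, so a bound on the chains of the initial tables stays valid
throughout the traversal. -/
theorem load_sublist {B b : ℕ} {es es' : List Path} (h : es.Sublist es') (g : Hash) :
    load B es b g ≤ load B es' b g := (h.filter _).length_le

namespace Cost.Bounded

variable {Ω : Type*} [MeasurableSpace Ω] {μ : Measure Ω} {H : Ω → Hash} {G : Hash → Prop}

theorem meas_cast {c : Cost} {w s : ℕ} (h : c.Bounded μ H G w s) :
    Measurable fun ω => (c.work (H ω) : ENNReal) :=
  (measurable_from_nat (f := fun n : ℕ => (n : ENNReal))).comp h.meas

theorem mono {c : Cost} {w w' s s' : ℕ} (h : c.Bounded μ H G w s) (hw : w ≤ w') (hs : s ≤ s') :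
    c.Bounded μ H G w' s' :=
  ⟨h.meas, h.work.trans (by exact_mod_cast hw), fun g hg => (h.span g hg).trans hs⟩

theorem mono_good {G' : Hash → Prop} {c : Cost} {w s : ℕ} (h : c.Bounded μ H G w s)
    (hG : ∀ g, G' g → G g) : c.Bounded μ H G' w s :=
  ⟨h.meas, h.work, fun g hg => h.span g (hG g hg)⟩

theorem of_le [IsProbabilityMeasure μ] {c : Cost} {w s : ℕ}
    (hm : Measurable fun ω => c.work (H ω)) (hw : ∀ g, c.work g ≤ w)
    (hs : ∀ g, G g → c.span g ≤ s) : c.Bounded μ H G w s := by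
  refine ⟨hm, ?_, hs⟩
  calc ∫⁻ ω, (c.work (H ω) : ENNReal) ∂μ ≤ ∫⁻ _, (w : ENNReal) ∂μ :=
        lintegral_mono fun ω => Nat.cast_le.2 (hw (H ω))
    _ = w := by simp

theorem tick [IsProbabilityMeasure μ] (n : ℕ) : (Cost.tick n).Bounded μ H G n n :=
  of_le measurable_const (fun _ => le_rfl) (fun _ _ => le_rfl)

theorem add {c d : Cost} {w w' s s' : ℕ} (h : c.Bounded μ H G w s) (h' : d.Bounded μ H G w' s') :
    (c + d).Bounded μ H G (w + w') (s + s') := by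
  refine ⟨h.meas.add h'.meas, ?_, fun g hg => ?_⟩
  · simp only [Cost.add_work, Nat.cast_add]
    rw [lintegral_add_left h.meas_cast]
    exact add_le_add h.work h'.work
  · rw [Cost.add_span]
    exact add_le_add (h.span g hg) (h'.span g hg)

theorem par [IsProbabilityMeasure μ] {c d : Cost} {w w' s s' : ℕ} (h : c.Bounded μ H G w s)
    (h' : d.Bounded μ H G w' s') :
    (Cost.par c d).Bounded μ H G (1 + w + w') (1 + max s s') := by
  have := ((tick (μ := μ) (H := H) (G := G) 1).add h).add h'
  refine ⟨this.meas, this.work, fun g hg => ?_⟩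
  have h1 := h.span g hg
  have h2 := h'.span g hg
  simp only [Cost.par]
  omega

theorem sum_work [IsProbabilityMeasure μ] {l : List Cost} {ws : List ℕ} {s : ℕ}
    (h : List.Forall₂ (fun c w => Cost.Bounded μ H G c w s) l ws) :
    (Measurable fun ω => (l.map fun c => c.work (H ω)).sum) ∧
      ∫⁻ ω, ((l.map fun c => c.work (H ω)).sum : ENNReal) ∂μ ≤ (ws.sum : ℕ) := by
  induction h with
  | nil => simp
  | @cons c w l ws hc _ ih =>
    refine ⟨?_, ?_⟩
    · simp only [List.map_cons, List.sum_cons]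
      exact hc.meas.add ih.1
    · simp only [List.map_cons, List.sum_cons, Nat.cast_add]
      rw [lintegral_add_left hc.meas_cast]
      exact add_le_add hc.work ih.2

theorem parFor [IsProbabilityMeasure μ] {l : List Cost} {ws : List ℕ} {s : ℕ}
    (h : List.Forall₂ (fun c w => Cost.Bounded μ H G c w s) l ws) :
    (Cost.parFor l).Bounded μ H G (1 + l.length + ws.sum) (1 + Nat.clog 2 l.length + s) := by
  have hs := sum_work h
  refine ⟨measurable_const.add hs.1, ?_, fun g hg => ?_⟩
  · have h1 : ∀ ω, ((Cost.parFor l).work (H ω) : ENNReal) =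
        (1 + l.length : ENNReal) + (l.map fun c => (c.work (H ω) : ENNReal)).sum := by
      intro ω
      simp [Cost.parFor, Function.comp_def]
    simp only [h1]
    rw [lintegral_add_left measurable_const]
    simp only [Nat.cast_add]
    exact add_le_add (by simp) hs.2
  · simp only [Cost.parFor]
    have : Cost.maxOf (l.map fun c => c.span g) ≤ s := by
      refine Cost.maxOf_le fun x hx => ?_
      obtain ⟨c, hc, rfl⟩ := List.mem_map.1 hx
      obtain ⟨n, hn, rfl⟩ := List.getElem_of_mem hc
      have h2 := (List.forall₂_iff_get.1 h).2 n hn ((List.forall₂_iff_get.1 h).1 ▸ hn)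
      exact h2.span g hg
    omega

theorem parFor_map [IsProbabilityMeasure μ] {α : Type*} {l : List α} {f : α → Cost} {w : α → ℕ}
    {s : ℕ} (h : ∀ a ∈ l, (f a).Bounded μ H G (w a) s) :
    (Cost.parFor (l.map f)).Bounded μ H G (1 + l.length + (l.map w).sum)
      (1 + Nat.clog 2 l.length + s) := by
  have : List.Forall₂ (fun c w => Cost.Bounded μ H G c w s) (l.map f) (l.map w) := by
    induction l with
    | nil => exact .nil
    | cons a l ih =>
      exact .cons (h a List.mem_cons_self) (ih fun a ha => h a (List.mem_cons_of_mem _ ha))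
  simpa using parFor this

end Cost.Bounded

/-! ### Hash tables -/

section Hashing

variable {Ω : Type*} [MeasurableSpace Ω] {μ : Measure Ω} {H : Ω → Hash} {G : Hash → Prop}

theorem UniformHashing.measurable_chain (hH : UniformHashing μ H) (B : ℕ) (xs : List (Path × ℕ))
    (b : ℕ) : Measurable fun ω => (Cost.chain B xs b).work (H ω) := by
  simp only [Cost.chain]
  induction xs with
  | nil => simp
  | cons x xs ih =>
    have : (fun ω => (((x :: xs).filter fun x => H ω B x.1 = b).map fun x => 1 + x.2).sum) =
        fun ω => (if H ω B x.1 = b then 1 + x.2 else 0) +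
          ((xs.filter fun x => H ω B x.1 = b).map fun x => 1 + x.2).sum := by
      funext ω
      by_cases h : H ω B x.1 = b <;> simp [h]
    rw [this]
    exact (Measurable.ite (measurableSet_eq_fun (hH.measurable B x.1) measurable_const)
      measurable_const measurable_const).add ih

/-- A key lies in at most one chain. There is only an inequality because an arbitrary hash function
may send a key outside of the range of the buckets, where the loop does not see it. -/
theorem chain_work_sum_le (B : ℕ) (xs : List (Path × ℕ)) (g : Hash) :
    ((List.range B).map fun b => (Cost.chain B xs b).work g).sum ≤
      (xs.map fun x => 1 + x.2).sum := by
  simp only [Cost.chain]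
  induction xs with
  | nil => simp
  | cons x xs ih =>
    have : ∀ b, (((x :: xs).filter fun x => g B x.1 = b).map fun x => 1 + x.2).sum =
        (if g B x.1 = b then 1 + x.2 else 0) +
          ((xs.filter fun x => g B x.1 = b).map fun x => 1 + x.2).sum := by
      intro b
      by_cases h : g B x.1 = b <;> simp [h]
    simp only [this, List.map_cons, List.sum_cons]
    rw [List.sum_map_add]
    refine add_le_add ?_ ih
    have h2 : ∀ l : List ℕ, l.Nodup →
        (l.map fun b => if g B x.1 = b then 1 + x.2 else 0).sum ≤ 1 + x.2 := by
      intro l hl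
      induction l with
      | nil => simp
      | cons a l ihl =>
        rw [List.nodup_cons] at hl
        simp only [List.map_cons, List.sum_cons]
        split_ifs with h
        · have : (l.map fun b => if g B x.1 = b then 1 + x.2 else 0).sum = 0 := by
            rw [List.sum_eq_zero_iff]
            intro y hy
            obtain ⟨b, hb, rfl⟩ := List.mem_map.1 hy
            rw [if_neg]
            rintro rfl
            exact hl.1 (h ▸ hb)
          omega
        · simpa using ihl hl.2
    exact h2 _ List.nodup_range

/-- A scan meets every key at most once whatever the hash function is, so its work is bounded
surely; only its span depends on the lengths of the chains. -/
theorem UniformHashing.scan_bounded [IsProbabilityMeasure μ] (hH : UniformHashing μ H) {B : ℕ}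
    {xs : List (Path × ℕ)} {L M : ℕ}
    (hL : ∀ g, G g → ∀ b, load B (xs.map Prod.fst) b g ≤ L) (hM : ∀ x ∈ xs, x.2 ≤ M) :
    (Cost.scan B xs).Bounded μ H G (1 + B + (xs.map fun x => 1 + x.2).sum)
      (1 + Nat.clog 2 B + (L + M)) := by
  refine Cost.Bounded.of_le ?_ (fun g => ?_) (fun g hg => ?_)
  · simp only [Cost.scan, Cost.parFor, List.map_map, List.length_map]
    refine measurable_const.add ?_
    induction List.range B with
    | nil => simp
    | cons a l ih =>
      simp only [List.map_cons, List.sum_cons]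
      exact (hH.measurable_chain B xs a).add ih
  · simp only [Cost.scan, Cost.parFor, List.map_map, List.length_map, List.length_range]
    have := chain_work_sum_le B xs g
    simp only [Function.comp_def]
    omega
  · simp only [Cost.scan, Cost.parFor, List.map_map, List.length_map, List.length_range]
    have : Cost.maxOf ((List.range B).map ((fun c : Cost => c.span g) ∘ Cost.chain B xs)) ≤ L + M := by
      refine Cost.maxOf_le fun y hy => ?_
      obtain ⟨b, -, rfl⟩ := List.mem_map.1 hy
      simp only [Function.comp_def, Cost.chain]
      refine add_le_add ?_ (Cost.maxOf_le fun z hz => ?_)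
      · have := hL g hg b
        simpa [load, List.filter_map, Function.comp_def] using this
      · obtain ⟨x, hx, rfl⟩ := List.mem_map.1 hz
        exact hM x (List.mem_of_mem_filter hx)
    omega

/-- The B buckets have probability 1/B each, which leaves nothing for values outside of the range.
-/
theorem UniformHashing.ae_lt [IsProbabilityMeasure μ] (hH : UniformHashing μ H) {B : ℕ} (hB : 1 ≤ B)
    (p : Path) : ∀ᵐ ω ∂μ, H ω B p < B := by
  have h1 : μ {ω | H ω B p < B} = 1 := by
    have : {ω | H ω B p < B} = ⋃ b ∈ Finset.range B, {ω | H ω B p = b} := by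
      ext ω; simp
    rw [this, measure_biUnion_finset]
    · rw [Finset.sum_congr rfl fun b hb => hH.uniform B p b (Finset.mem_range.1 hb)]
      simp only [Finset.sum_const, Finset.card_range, nsmul_eq_mul]
      exact ENNReal.mul_inv_cancel (by exact_mod_cast (by omega : B ≠ 0)) (by simp)
    · intro b _ b' _ hbb
      refine Set.disjoint_left.2 fun ω h h' => hbb ?_
      simp only [Set.mem_ofPred_eq] at h h'
      omega
    · intro b _
      exact measurableSet_eq_fun (hH.measurable B p) measurable_const
  rw [ae_iff]
  have h2 := prob_compl_eq_zero_iff (μ := μ) (s := {ω | H ω B p < B})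
    (measurableSet_lt (hH.measurable B p) measurable_const)
  exact h2.2 h1

/-- Pairwise independence: both keys fall into a given bucket with probability B⁻², and there are B
buckets. -/
theorem UniformHashing.collision [IsProbabilityMeasure μ] (hH : UniformHashing μ H) {B : ℕ}
    (hB : 1 ≤ B) {p q : Path} (hpq : q ≠ p) : μ {ω | H ω B q = H ω B p} ≤ (B : ENNReal)⁻¹ := by
  have h1 : μ {ω | H ω B q = H ω B p} ≤
      μ (⋃ b ∈ Finset.range B, ({ω | H ω B q = b} ∩ {ω | H ω B p = b})) := by
    refine measure_mono_ae ?_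
    filter_upwards [hH.ae_lt hB p] with ω hω hq
    have hq' : H ω B q = H ω B p := hq
    show ω ∈ (⋃ b ∈ Finset.range B, ({ω | H ω B q = b} ∩ {ω | H ω B p = b}))
    simp only [Set.mem_iUnion, Finset.mem_range]
    exact ⟨_, hω, hq', rfl⟩
  refine h1.trans ((measure_biUnion_finset_le _ _).trans ?_)
  have hB0 : (B : ENNReal) ≠ 0 := by exact_mod_cast (by omega : B ≠ 0)
  have h2 : ∀ b ∈ Finset.range B, μ ({ω | H ω B q = b} ∩ {ω | H ω B p = b}) =
      (B : ENNReal)⁻¹ * (B : ENNReal)⁻¹ := by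
    intro b hb
    have hi := (hH.indep B).indepFun hpq
    have := hi.measure_inter_preimage_eq_mul {b} {b} (measurableSet_singleton b)
      (measurableSet_singleton b)
    rw [← hH.uniform B q b (Finset.mem_range.1 hb)]
    nth_rewrite 2 [hH.uniform B q b (Finset.mem_range.1 hb)]
    rw [← hH.uniform B p b (Finset.mem_range.1 hb)]
    exact this
  rw [Finset.sum_congr rfl h2]
  simp only [Finset.sum_const, Finset.card_range, nsmul_eq_mul]
  rw [← mul_assoc, ENNReal.mul_inv_cancel hB0 (by simp), one_mul]

/-- Occurrences of the key itself always lie in its chain; every other key joins it with probability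
at most 1/B. -/
theorem UniformHashing.lintegral_chain_le [IsProbabilityMeasure μ] (hH : UniformHashing μ H) {B : ℕ}
    (hB : 1 ≤ B) (es : List Path) (p : Path) :
    (Measurable fun ω => (es.filter fun q => H ω B q = H ω B p).length) ∧
    ∫⁻ ω, ((es.filter fun q => H ω B q = H ω B p).length : ENNReal) ∂μ ≤
      es.count p + es.length * (B : ENNReal)⁻¹ := by
  induction es with
  | nil => simp
  | cons q es ih =>
    have hms : MeasurableSet {ω | H ω B q = H ω B p} :=
      measurableSet_eq_fun (hH.measurable B q) (hH.measurable B p)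
    have h1 : (fun ω => ((q :: es).filter fun q => H ω B q = H ω B p).length) =
        fun ω => ({ω | H ω B q = H ω B p}.indicator 1 ω) +
          (es.filter fun q => H ω B q = H ω B p).length := by
      funext ω
      by_cases h : H ω B q = H ω B p <;> simp [h, add_comm]
    have hm1 : Measurable ({ω | H ω B q = H ω B p}.indicator (1 : Ω → ℕ)) :=
      measurable_one.indicator hms
    refine ⟨h1 ▸ hm1.add ih.1, ?_⟩
    have h2 : ∀ ω, (((q :: es).filter fun q => H ω B q = H ω B p).length : ENNReal) =
        ({ω | H ω B q = H ω B p}.indicator 1 ω : ENNReal) +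
          ((es.filter fun q => H ω B q = H ω B p).length : ENNReal) := by
      intro ω
      by_cases h : H ω B q = H ω B p <;> simp [h, add_comm]
    simp only [h2]
    rw [lintegral_add_left (measurable_one.indicator hms), lintegral_indicator_one hms]
    have h3 : μ {ω | H ω B q = H ω B p} ≤ (if q = p then 1 else 0) + (B : ENNReal)⁻¹ := by
      split_ifs with hqp
      · exact prob_le_one.trans le_self_add
      · rw [zero_add]; exact hH.collision hB hqp
    refine (add_le_add h3 ih.2).trans (le_of_eq ?_)
    rw [List.count_cons, List.length_cons]
    push_cast
    by_cases hqp : q = p <;> simp [hqp] <;> ring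

/-- The 4 is one unit for the operation, one for the key itself, and two for the expected number of
colliding keys at two keys per bucket. -/
theorem UniformHashing.probe_bounded [IsProbabilityMeasure μ] (hH : UniformHashing μ H) {B : ℕ}
    (hB : 1 ≤ B) {es : List Path} (hes : es.Nodup) (hle : es.length ≤ 2 * B) (p : Path) {L : ℕ}
    (hL : ∀ g, G g → ∀ b, load B es b g ≤ L) :
    (Cost.probe B es p).Bounded μ H G 4 (1 + L) := by
  have hc := hH.lintegral_chain_le hB es p
  refine ⟨measurable_const.add hc.1, ?_, fun g hg => ?_⟩
  · simp only [Cost.probe, Nat.cast_add]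
    rw [lintegral_add_left measurable_const]
    have h1 : (es.count p : ENNReal) ≤ 1 := by exact_mod_cast List.nodup_iff_count_le_one.1 hes p
    have hB0 : (B : ENNReal) ≠ 0 := by exact_mod_cast (by omega : B ≠ 0)
    have h2 : (es.length : ENNReal) * (B : ENNReal)⁻¹ ≤ 2 := by
      calc (es.length : ENNReal) * (B : ENNReal)⁻¹ ≤ (2 * B) * (B : ENNReal)⁻¹ := by
            gcongr; exact_mod_cast hle
        _ = 2 := by rw [mul_assoc, ENNReal.mul_inv_cancel hB0 (by simp), mul_one]
    calc ∫⁻ _, ((1 : ℕ) : ENNReal) ∂μ + _ ≤ 1 + (1 + 2) := by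
          refine add_le_add (by simp) (hc.2.trans (add_le_add h1 h2))
      _ = ((4 : ℕ) : ENNReal) := by norm_num
  · have := hL g hg (g B p)
    simp only [Cost.probe]
    simp only [load] at this
    omega

/-- A Chernoff bound with parameter 1. The indicator that a key falls into bucket b has moment
generating function 1 + (e - 1)/B ≤ exp(2/B). There are at most 2B independent keys, so that of the
load is at most e⁴, and Markov's inequality gives exp(4 - x). -/
theorem UniformHashing.load_tail [IsProbabilityMeasure μ] (hH : UniformHashing μ H) {B : ℕ}
    (hB : 1 ≤ B) {es : List Path} (hes : es.Nodup) (hle : es.length ≤ 2 * B) {b : ℕ} (hb : b < B)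
    (x : ℝ) : μ.real {ω | x ≤ (load B es b (H ω) : ℝ)} ≤ Real.exp (4 - x) := by
  set X : Path → Ω → ℝ := fun q ω => if H ω B q = b then 1 else 0 with hX
  have hms : ∀ q, MeasurableSet {ω | H ω B q = b} := fun q =>
    measurableSet_eq_fun (hH.measurable B q) measurable_const
  have hXm : ∀ q, Measurable (X q) := fun q =>
    Measurable.ite (hms q) measurable_const measurable_const
  have hXi : iIndepFun X μ :=
    (hH.indep B).comp (fun _ n => if n = b then (1 : ℝ) else 0) fun _ => measurable_from_nat
  have hload : ∀ ω, (load B es b (H ω) : ℝ) = (∑ q ∈ es.toFinset, X q) ω := by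
    intro ω
    rw [Finset.sum_apply, List.sum_toFinset _ hes]
    simp only [load, hX]
    clear hle hes
    induction es with
    | nil => simp
    | cons q es ih =>
      by_cases h : H ω B q = b
      · simp [h, ih, add_comm]
      · simp [h, ih]
  have hB0 : (0 : ℝ) < B := by exact_mod_cast hB
  have hmgf : ∀ q, mgf (X q) μ 1 ≤ Real.exp (2 / B) := by
    intro q
    have h1 : (fun ω => Real.exp (1 * X q ω)) =
        fun ω => 1 + {ω | H ω B q = b}.indicator (fun _ => Real.exp 1 - 1) ω := by
      funext ω
      by_cases h : H ω B q = b <;> simp [hX, h]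
    have h2 : μ.real {ω | H ω B q = b} = 1 / B := by
      rw [measureReal_def, hH.uniform B q b hb]; simp
    rw [mgf, h1, integral_add (integrable_const _)
      ((integrable_const _).indicator (hms q)), integral_indicator (hms q)]
    simp only [integral_const, probReal_univ, smul_eq_mul, one_mul, measureReal_restrict_apply_univ,
      h2]
    have h3 := Real.exp_one_lt_d9
    have h4 : 1 / (B : ℝ) * (Real.exp 1 - 1) ≤ 2 / B := by
      rw [div_mul_eq_mul_div, one_mul]
      gcongr
      linarith
    have h5 := Real.add_one_le_exp (2 / (B : ℝ))
    linarith
  have hmg : mgf (∑ q ∈ es.toFinset, X q) μ 1 ≤ Real.exp 4 := by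
    rw [hXi.mgf_sum hXm]
    calc ∏ q ∈ es.toFinset, mgf (X q) μ 1 ≤ ∏ _q ∈ es.toFinset, Real.exp (2 / B) :=
          Finset.prod_le_prod (fun q _ => mgf_nonneg) fun q _ => hmgf q
      _ = Real.exp (es.length * (2 / B)) := by
          rw [Finset.prod_const, List.toFinset_card_of_nodup hes, ← Real.exp_nat_mul]
      _ ≤ Real.exp 4 := by
          refine Real.exp_le_exp.2 ?_
          rw [mul_div_assoc', div_le_iff₀ hB0]
          have : (es.length : ℝ) ≤ 2 * B := by exact_mod_cast hle
          linarith
  have hint : Integrable (fun ω => Real.exp (1 * (∑ q ∈ es.toFinset, X q) ω)) μ := by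
    refine Integrable.of_bound (C := Real.exp es.length) ?_ (.of_forall fun ω => ?_)
    · simp only [one_mul, Finset.sum_apply]
      exact (Finset.measurable_sum _ fun q _ => hXm q).exp.aestronglyMeasurable
    · rw [Real.norm_eq_abs, abs_of_pos (Real.exp_pos _), one_mul, ← hload]
      refine Real.exp_le_exp.2 ?_
      exact_mod_cast List.length_filter_le _ _
  have := measure_ge_le_exp_mul_mgf (μ := μ) (X := ∑ q ∈ es.toFinset, X q) x zero_le_one hint
  simp only [hload]
  refine this.trans ?_
  calc Real.exp (-1 * x) * mgf (∑ q ∈ es.toFinset, X q) μ 1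
      ≤ Real.exp (-1 * x) * Real.exp 4 := by gcongr
    _ = Real.exp (4 - x) := by rw [← Real.exp_add]; ring_nf

/-- With high probability, all chains of a family of hash tables are short. -/
theorem UniformHashing.forall_load_le [IsProbabilityMeasure μ] (hH : UniformHashing μ H)
    (ts : List Table) (hts : ∀ t ∈ ts, 1 ≤ t.size ∧ t.elems.Nodup ∧ t.elems.length ≤ 2 * t.size)
    (L : ℕ) :
    1 - (ts.map Table.size).sum * Real.exp (4 - L) ≤
      μ.real {ω | ∀ t ∈ ts, ∀ b, load t.size t.elems b (H ω) ≤ L} := by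
  have hbad : μ.real {ω | ∃ t ∈ ts, ∃ b < t.size, (L : ℝ) ≤ (load t.size t.elems b (H ω) : ℝ)} ≤
      (ts.map Table.size).sum * Real.exp (4 - L) := by
    induction ts with
    | nil => simp
    | cons t ts ih =>
      obtain ⟨h1, h2, h3⟩ := hts t List.mem_cons_self
      have h4 := ih fun t ht => hts t (List.mem_cons_of_mem _ ht)
      have h5 : {ω | ∃ t' ∈ t :: ts, ∃ b < t'.size,
          (L : ℝ) ≤ (load t'.size t'.elems b (H ω) : ℝ)} =
          (⋃ b ∈ Finset.range t.size, {ω | (L : ℝ) ≤ (load t.size t.elems b (H ω) : ℝ)}) ∪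
          {ω | ∃ t ∈ ts, ∃ b < t.size, (L : ℝ) ≤ (load t.size t.elems b (H ω) : ℝ)} := by
        ext ω
        simp
      rw [h5]
      refine (measureReal_union_le _ _).trans ?_
      simp only [List.map_cons, List.sum_cons, Nat.cast_add, add_mul]
      refine add_le_add ((measureReal_biUnion_finset_le _ _).trans ?_) h4
      refine (Finset.sum_le_sum fun b hb =>
        hH.load_tail h1 h2 h3 (Finset.mem_range.1 hb) L).trans ?_
      simp
  -- Only buckets below the size enter the union bound; the others are almost surely empty, so the
  -- conclusion may range over all b.
  have hae : ∀ᵐ ω ∂μ, ∀ t ∈ ts, ∀ q ∈ t.elems, H ω t.size q < t.size := by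
    have : ∀ t ∈ ts, ∀ q ∈ t.elems, ∀ᵐ ω ∂μ, H ω t.size q < t.size :=
      fun t ht q _ => hH.ae_lt (hts t ht).1 q
    exact (Filter.eventually_all_finite (List.finite_toSet ts)).2 fun t ht =>
      (Filter.eventually_all_finite (List.finite_toSet t.elems)).2 fun q hq => this t ht q hq
  set S := {ω | ∀ t ∈ ts, ∀ b, load t.size t.elems b (H ω) ≤ L}
  have hS : μ.real Sᶜ ≤
      μ.real {ω | ∃ t ∈ ts, ∃ b < t.size, (L : ℝ) ≤ (load t.size t.elems b (H ω) : ℝ)} := by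
    refine ENNReal.toReal_mono (measure_ne_top _ _) (measure_mono_ae ?_)
    filter_upwards [hae] with ω hω hωS
    have hωS' : ω ∉ S := hωS
    simp only [S, Set.mem_ofPred_eq, not_forall, not_le] at hωS'
    obtain ⟨t, ht, b, hb⟩ := hωS'
    refine ⟨t, ht, b, ?_, by exact_mod_cast hb.le⟩
    have hne : (t.elems.filter fun q => H ω t.size q = b) ≠ [] := by
      intro h0
      simp [load, h0] at hb
    obtain ⟨q, hq⟩ := List.exists_mem_of_ne_nil _ hne
    rw [List.mem_filter] at hq
    have := hω t ht q hq.1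
    simp at hq
    omega
  have h1 : (1 : ℝ) ≤ μ.real S + μ.real Sᶜ := by
    have := measureReal_union_le (μ := μ) S Sᶜ
    rwa [Set.union_compl_self, probReal_univ] at this
  linarith

end Hashing

end

section

/-! ### Regions of a tree -/

/-- The positions at or below `p`. -/
def Below (p : Path) : Set Path := {q | p <:+ q}

/-- The positions strictly below `p`. -/
def SBelow (p : Path) : Set Path := {q | p <:+ q ∧ q ≠ p}

theorem mem_below_iff {p q : Path} : q ∈ Below p ↔ q = p ∨ q ∈ SBelow p := by
  by_cases h : q = p
  · subst h; simp [Below]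
  · simp [Below, SBelow, h]

theorem mem_sBelow_iff {p q : Path} :
    q ∈ SBelow p ↔ q ∈ Below (false :: p) ∨ q ∈ Below (true :: p) := by
  constructor
  · rintro ⟨⟨x, rfl⟩, hne⟩
    rcases List.eq_nil_or_concat x with rfl | ⟨y, d, rfl⟩
    · simp at hne
    · rcases d with _ | _
      · left; exact ⟨y, by simp⟩
      · right; exact ⟨y, by simp⟩
  · have : ∀ d, q ∈ Below (d :: p) → q ∈ SBelow p := by
      rintro d ⟨x, rfl⟩
      refine ⟨⟨x ++ [d], by simp⟩, fun h => ?_⟩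
      have := congrArg List.length h
      simp at this
      omega
    rintro (h | h) <;> exact this _ h

theorem below_cons_subset {p q : Path} {d : Bool} (h : q ∈ Below (d :: p)) : q ∈ SBelow p := by
  rw [mem_sBelow_iff]
  cases d
  · exact .inl h
  · exact .inr h

theorem sBelow_subset {p q : Path} (h : q ∈ SBelow p) : q ∈ Below p := h.1

theorem below_disjoint {p q : Path} {d e : Bool} (hde : d ≠ e) (h : q ∈ Below (d :: p)) :
    q ∉ Below (e :: p) := by
  rintro h'
  have h1 : (d :: p : List Bool) = e :: p := by
    rcases List.suffix_or_suffix_of_suffix h h' with h2 | h2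
    · exact h2.eq_of_length (by simp)
    · exact (h2.eq_of_length (by simp)).symm
  exact hde (List.cons.inj h1).1

theorem below_trans {p q r : Path} (h : q ∈ Below p) (h' : r ∈ Below q) : r ∈ Below p :=
  List.IsSuffix.trans h h'

theorem not_sBelow_self (p : Path) : p ∉ SBelow p := fun h => h.2 rfl

theorem suffix_antisymm {p q : Path} (h : p <:+ q) (h' : q <:+ p) : p = q :=
  h.eq_of_length (le_antisymm h.length_le h'.length_le)

theorem not_below_cons (p : Path) (d : Bool) : p ∉ Below (d :: p) := fun h =>
  not_sBelow_self p (below_cons_subset h)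

variable {ι V : Type*}

/-- The modifiables that may be allocated by the scope of `p` from the `i`-th allocation on,
or by scopes strictly below. -/
def Own (p : Path) (i : ℕ) : Set (Modifiable ι) :=
  {m | ∃ q j, m = .dyn q j ∧ p <:+ q ∧ (q = p → i ≤ j)}

theorem own_cons_subset {p : Path} {d : Bool} {i j : ℕ} {m : Modifiable ι}
    (h : m ∈ Own (d :: p) j) : m ∈ Own p i := by
  obtain ⟨q, k, rfl, hq, -⟩ := h
  have := below_cons_subset (q := q) hq
  exact ⟨q, k, rfl, this.1, fun h => absurd h this.2⟩

theorem own_succ_subset {p : Path} {i : ℕ} {m : Modifiable ι} (h : m ∈ Own p (i + 1)) :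
    m ∈ Own p i := by
  obtain ⟨q, k, rfl, hq, h2⟩ := h
  exact ⟨q, k, rfl, hq, fun h => by have := h2 h; omega⟩

theorem own_disjoint {p : Path} {d e : Bool} {i j : ℕ} {m : Modifiable ι} (hde : d ≠ e)
    (h : m ∈ Own (d :: p) i) : m ∉ Own (e :: p) j := by
  obtain ⟨q, k, rfl, hq, -⟩ := h
  rintro ⟨q', k', h1, hq', -⟩
  cases h1
  exact below_disjoint hde (q := q) hq hq'

theorem dyn_mem_own (p : Path) (i : ℕ) : (.dyn p i : Modifiable ι) ∈ Own p i :=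
  ⟨p, i, rfl, List.suffix_rfl, fun _ => le_rfl⟩

/-- The modifiables in `E` are those of the scopes above `p`, and of the first `i` allocations
in the scope of `p`. -/
def Outer (E : Set (Modifiable ι)) (p : Path) (i : ℕ) : Prop :=
  ∀ q j, Modifiable.dyn q j ∈ E → q <:+ p ∧ (q = p → j < i)

theorem Outer.not_own {E : Set (Modifiable ι)} {p : Path} {i : ℕ} (h : Outer E p i)
    {m : Modifiable ι} (hm : m ∈ E) : m ∉ Own p i := by
  rintro ⟨q, j, rfl, hq, h2⟩
  obtain ⟨h3, h4⟩ := h q j hm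
  have := suffix_antisymm h3 hq
  have h5 := h4 this
  have h6 := h2 this
  omega

theorem Outer.cons {E : Set (Modifiable ι)} {p : Path} {i : ℕ} (h : Outer E p i) (d : Bool) :
    Outer E (d :: p) 0 := by
  intro q j hm
  obtain ⟨h1, -⟩ := h q j hm
  refine ⟨h1.trans (List.suffix_cons d p), ?_⟩
  rintro rfl
  have := h1.length_le
  simp at this

theorem Outer.insert {E : Set (Modifiable ι)} {p : Path} {i : ℕ} (h : Outer E p i) :
    Outer (insert (.dyn p i) E) p (i + 1) := by
  intro q j hm
  rcases hm with hm | hm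
  · cases hm
    exact ⟨List.suffix_rfl, fun _ => Nat.lt_succ_self _⟩
  · obtain ⟨h1, h2⟩ := h q j hm
    exact ⟨h1, fun h => (h2 h).trans (Nat.lt_succ_self _)⟩

/-! ### Trees and bodies -/

namespace Tree

/-- `x` is the position of a node of the tree at `p`. -/
def Pos : Tree ι V → Path → Path → Prop
  | nil, _, _ => False
  | node _ _ _ l r, p, x => x = p ∨ l.Pos (false :: p) x ∨ r.Pos (true :: p) x

/-- In every scope, the allocations are among the unit-cost operations. -/
def AllocsLe : Tree ι V → Prop
  | nil => True
  | node _ s a l r => a ≤ s ∧ l.AllocsLe ∧ r.AllocsLe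

/-- The span of a traversal of the tree with all children in parallel, at cost `Q` per node. -/
def parSpan (Q : ℕ) : Tree ι V → ℕ
  | nil => 0
  | node _ s _ l r => Q + s + max (l.parSpan Q) (r.parSpan Q)

/-- All modifiables that are read by the nodes. -/
def mods : Tree ι V → List (Modifiable ι)
  | nil => []
  | node lab _ _ l r => lab.mods ++ (l.mods ++ r.mods)

theorem mods_length_le {K : ℕ} {t : Tree ι V} (h : t.ArityLe K) : t.mods.length ≤ K * t.nodes := by
  induction t with
  | nil => simp [mods]
  | node lab s a l r ihl ihr =>
    have h1 := ihl h.2.1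
    have h2 := ihr h.2.2
    have h3 := h.1
    simp only [mods, List.length_append, nodes]
    nlinarith

/-- This turns logarithms of table sizes, and later log n, into multiples of the height. -/
theorem nodes_lt_two_pow (t : Tree ι V) : t.nodes < 2 ^ t.height := by
  induction t with
  | nil => simp [nodes, height]
  | node lab s a l r ihl ihr =>
    simp only [nodes, height]
    have h1 : 2 ^ l.height ≤ 2 ^ max l.height r.height :=
      Nat.pow_le_pow_right (by norm_num) (le_max_left _ _)
    have h2 : 2 ^ r.height ≤ 2 ^ max l.height r.height :=
      Nat.pow_le_pow_right (by norm_num) (le_max_right _ _)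
    rw [pow_add]
    omega

variable [DecidableEq ι]

theorem mem_readers_node {m : Modifiable ι} {lab : Label ι V} {s a : ℕ} {l r : Tree ι V}
    {p q : Path} : q ∈ (node lab s a l r).readers m p ↔
      (m ∈ lab.mods ∧ q = p) ∨ q ∈ l.readers m (false :: p) ∨ q ∈ r.readers m (true :: p) := by
  simp only [readers, List.mem_append]
  by_cases h : m ∈ lab.mods <;> simp [h, or_assoc]

theorem readers_below {m : Modifiable ι} {t : Tree ι V} {p q : Path} (h : q ∈ t.readers m p) :
    q ∈ Below p := by
  induction t generalizing p with
  | nil => simp [readers] at h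
  | node lab s a l r ihl ihr =>
    simp only [readers, List.mem_append] at h
    rcases h with (h | h) | h
    · split_ifs at h
      · simp at h; subst h; exact List.suffix_rfl
      · simp at h
    · exact (below_cons_subset (ihl h)).1
    · exact (below_cons_subset (ihr h)).1

theorem readers_nodup (m : Modifiable ι) (t : Tree ι V) (p : Path) : (t.readers m p).Nodup := by
  induction t generalizing p with
  | nil => simp [readers]
  | node lab s a l r ihl ihr =>
    simp only [readers]
    rw [List.append_assoc, List.nodup_append', List.nodup_append']
    refine ⟨by split_ifs <;> simp, ⟨ihl _, ihr _, ?_⟩, ?_⟩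
    · intro x hx hx'
      exact below_disjoint (by simp) (readers_below hx) (readers_below hx')
    · intro x hx hx'
      split_ifs at hx
      · simp at hx
        subst hx
        rcases List.mem_append.1 hx' with h | h
        · exact not_below_cons _ _ (readers_below h)
        · exact not_below_cons _ _ (readers_below h)
      · simp at hx

theorem readers_length_le (m : Modifiable ι) (t : Tree ι V) (p : Path) :
    (t.readers m p).length ≤ t.nodes := by
  induction t generalizing p with
  | nil => simp [readers]
  | node lab s a l r ihl ihr =>
    have h1 := ihl (false :: p)
    have h2 := ihr (true :: p)
    simp only [readers, nodes, List.length_append]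
    split_ifs <;> simp <;> omega

theorem readers_depth {m : Modifiable ι} {t : Tree ι V} {p q : Path} (h : q ∈ t.readers m p) :
    q.length < p.length + t.height := by
  induction t generalizing p with
  | nil => simp [readers] at h
  | node lab s a l r ihl ihr =>
    simp only [readers, List.mem_append] at h
    simp only [height]
    rcases h with (h | h) | h
    · split_ifs at h
      · simp at h; subst h; omega
      · simp at h
    · have := ihl h
      simp at this
      omega
    · have := ihr h
      simp at this
      omega

/-- Marks sit on ancestors of readers. All marks inside a region therefore lie on nodes of the tree
there, so destroying the tree removes all of them. -/
theorem pos_of_readers {m : Modifiable ι} {t : Tree ι V} {p q x : Path} (h : q ∈ t.readers m p)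
    (hp : x ∈ Below p) (hx : x <:+ q) : t.Pos p x := by
  induction t generalizing p with
  | nil => simp [readers] at h
  | node lab s a l r ihl ihr =>
    rcases mem_below_iff.1 hp with rfl | hp'
    · exact .inl rfl
    simp only [readers, List.mem_append] at h
    rcases h with (h | h) | h
    · split_ifs at h
      · simp at h; subst h
        exact absurd (suffix_antisymm hx hp) hp'.2
      · simp at h
    · refine .inr (.inl (ihl h ?_))
      rcases mem_sBelow_iff.1 hp' with h1 | h1
      · exact h1
      · exact absurd (below_trans h1 hx) (below_disjoint (by simp) (readers_below h))
    · refine .inr (.inr (ihr h ?_))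
      rcases mem_sBelow_iff.1 hp' with h1 | h1
      · exact absurd (below_trans h1 hx) (below_disjoint (by simp) (readers_below h))
      · exact h1

theorem readers_ne_nil {m : Modifiable ι} {t : Tree ι V} (p : Path) (h : t.Reads m) :
    t.readers m p ≠ [] := by
  induction t generalizing p with
  | nil => exact absurd h (by simp [Reads])
  | node lab s a l r ihl ihr =>
    simp only [Reads] at h
    simp only [readers]
    rcases h with h | h | h
    · simp [h]
    · simp [ihl _ h]
    · simp [ihr _ h]

theorem mem_mods_of_reader {m : Modifiable ι} {t : Tree ι V} {p q : Path}
    (h : q ∈ t.readers m p) : m ∈ t.mods := by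
  induction t generalizing p with
  | nil => simp [readers] at h
  | node lab s a l r ihl ihr =>
    simp only [readers, List.mem_append] at h
    simp only [mods, List.mem_append]
    rcases h with (h | h) | h
    · split_ifs at h with hm
      · exact .inl hm
      · simp at h
    · exact .inr (.inl (ihl h))
    · exact .inr (.inr (ihr h))

/-- A node is listed once as a reader even if the modifiable occurs several times among its
arguments, hence only an inequality. -/
theorem readers_length_le_count (m : Modifiable ι) (t : Tree ι V) (p : Path) :
    (t.readers m p).length ≤ t.mods.count m := by
  induction t generalizing p with
  | nil => simp [readers]
  | node lab s a l r ihl ihr =>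
    have h1 := ihl (false :: p)
    have h2 := ihr (true :: p)
    simp only [readers, mods, List.length_append, List.count_append]
    split_ifs with h
    · have := List.count_pos_iff.2 h
      simp
      omega
    · simp
      omega

end Tree

namespace Body

def work (b : Body ι V) : ℕ := b.strand + b.l.work + b.r.work

def span (b : Body ι V) : ℕ := b.strand + (b.l.span + b.r.span)

def nodes (b : Body ι V) : ℕ := b.l.nodes + b.r.nodes

def readers [DecidableEq ι] (b : Body ι V) (m : Modifiable ι) (p : Path) : List Path :=
  b.l.readers m (false :: p) ++ b.r.readers m (true :: p)

def ArityLe (K : ℕ) (b : Body ι V) : Prop := b.l.ArityLe K ∧ b.r.ArityLe K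

theorem node_work (lab : Label ι V) (b : Body ι V) : (b.node lab).work = b.work := rfl

theorem node_span_S (b : Body ι V) : (b.node .S).span = b.span := rfl

theorem node_span_R (b : Body ι V) (ms : List (Modifiable ι)) (f : List V → Prog ι V)
    (vs : List V) : (b.node (.R ms f vs)).span = b.span := rfl

theorem read_work (i : ℕ) (ms : List (Modifiable ι)) (f : List V → Prog ι V) (vs : List V)
    (b k : Body ι V) : (Body.read i ms f vs b k).work = 1 + b.work + k.work := rfl

theorem read_span (i : ℕ) (ms : List (Modifiable ι)) (f : List V → Prog ι V) (vs : List V)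
    (b k : Body ι V) : (Body.read i ms f vs b k).span = 1 + (b.span + k.span) := rfl

theorem par_work (i : ℕ) (a b k : Body ι V) :
    (Body.par i a b k).work = 1 + (a.work + b.work) + k.work := by
  simp [Body.par, work, node, Tree.work]

theorem par_span (i : ℕ) (a b k : Body ι V) :
    (Body.par i a b k).span = 1 + (max a.span b.span + k.span) := by
  simp [Body.par, span, node, Tree.span]

theorem node_nodes (lab : Label ι V) (b : Body ι V) : (b.node lab).nodes = 1 + b.nodes := by
  simp [node, Tree.nodes, nodes, add_assoc]

theorem read_nodes (i : ℕ) (ms : List (Modifiable ι)) (f : List V → Prog ι V) (vs : List V)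
    (b k : Body ι V) : (Body.read i ms f vs b k).nodes = (1 + b.nodes) + (1 + k.nodes) := by
  rw [← node_nodes (.R ms f vs), ← node_nodes .S]; rfl

theorem par_nodes (i : ℕ) (a b k : Body ι V) :
    (Body.par i a b k).nodes = (1 + (1 + a.nodes) + (1 + b.nodes)) + (1 + k.nodes) := by
  rw [← node_nodes .S, ← node_nodes .S, ← node_nodes .S]; rfl

theorem node_readers [DecidableEq ι] (lab : Label ι V) (b : Body ι V) (m : Modifiable ι)
    (p : Path) : (b.node lab).readers m p = (if m ∈ lab.mods then [p] else []) ++ b.readers m p := by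
  simp [node, Tree.readers, readers]

theorem mem_node_readers [DecidableEq ι] {lab : Label ι V} {b : Body ι V} {m : Modifiable ι}
    {p q : Path} : q ∈ (b.node lab).readers m p ↔ (m ∈ lab.mods ∧ q = p) ∨ q ∈ b.readers m p := by
  rw [node, Tree.mem_readers_node, readers, List.mem_append]

theorem mem_readers [DecidableEq ι] {b : Body ι V} {m : Modifiable ι} {p q : Path} :
    q ∈ b.readers m p ↔ q ∈ b.l.readers m (false :: p) ∨ q ∈ b.r.readers m (true :: p) := by
  rw [readers, List.mem_append]

theorem readers_sBelow [DecidableEq ι] {b : Body ι V} {m : Modifiable ι} {p q : Path}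
    (h : q ∈ b.readers m p) : q ∈ SBelow p := by
  rcases List.mem_append.1 h with h | h
  · exact below_cons_subset (Tree.readers_below h)
  · exact below_cons_subset (Tree.readers_below h)

end Body

/-! ### Stores -/

section Store

variable [DecidableEq ι]

theorem writes_of_notMem {σ : Modifiable ι → Option V} {τ : List (Modifiable ι × V)}
    {m : Modifiable ι} (h : ∀ v, (m, v) ∉ τ) : writes σ τ m = σ m := by
  induction τ generalizing σ with
  | nil => rfl
  | cons x τ ih =>
    obtain ⟨m', v'⟩ := x
    rw [writes, ih fun v hv => h v (List.mem_cons_of_mem _ hv), Function.update_of_ne]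
    rintro rfl
    exact h v' List.mem_cons_self

theorem writes_of_mem {σ : Modifiable ι → Option V} {τ : List (Modifiable ι × V)}
    (hn : (τ.map Prod.fst).Nodup) {m : Modifiable ι} {v : V} (h : (m, v) ∈ τ) :
    writes σ τ m = some v := by
  induction τ generalizing σ with
  | nil => simp at h
  | cons x τ ih =>
    obtain ⟨m', v'⟩ := x
    rw [List.map_cons, List.nodup_cons] at hn
    rcases List.mem_cons.1 h with h | h
    · cases h
      rw [writes, writes_of_notMem, Function.update_self]
      exact fun v hv => hn.1 (List.mem_map.2 ⟨_, hv, rfl⟩)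
    · exact ih hn.2 h

theorem writes_eq_some {σ : Modifiable ι → Option V} {τ : List (Modifiable ι × V)}
    {m : Modifiable ι} {v : V} (h : writes σ τ m = some v) : σ m = some v ∨ (m, v) ∈ τ := by
  induction τ generalizing σ with
  | nil => exact .inl h
  | cons x τ ih =>
    obtain ⟨m', v'⟩ := x
    rcases ih h with h1 | h1
    · by_cases hm : m = m'
      · subst hm
        simp at h1
        subst h1
        exact .inr List.mem_cons_self
      · rw [Function.update_of_ne hm] at h1
        exact .inl h1
    · exact .inr (List.mem_cons_of_mem _ h1)

theorem writes_eq_none {σ : Modifiable ι → Option V} {τ : List (Modifiable ι × V)}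
    {m : Modifiable ι} (h : writes σ τ m = none) : σ m = none ∧ ∀ v, (m, v) ∉ τ := by
  induction τ generalizing σ with
  | nil => exact ⟨h, by simp⟩
  | cons x τ ih =>
    obtain ⟨m', v'⟩ := x
    obtain ⟨h1, h2⟩ := ih h
    by_cases hm : m = m'
    · subst hm
      simp at h1
    · rw [Function.update_of_ne hm] at h1
      refine ⟨h1, fun v hv => ?_⟩
      rcases List.mem_cons.1 hv with h3 | h3
      · cases h3; exact hm rfl
      · exact h2 v h3

end Store

/-! ### Properties of valid executions -/

namespace Eval

variable [DecidableEq ι] {E : Set (Modifiable ι)} {σ : Modifiable ι → Option V} {p : Path} {i : ℕ}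
  {A : Prog ι V} {b : Body ι V} {τ : List (Modifiable ι × V)}

theorem mem_outer_or_own (h : Eval E σ p i A b τ) {m : Modifiable ι} {v : V} (hm : (m, v) ∈ τ) :
    m ∈ E ∨ m ∈ Own p i := by
  induction h with
  | done => simp at hm
  | step _ ih => exact ih hm
  | @alloc E σ p i _ _ _ _ ih =>
    rcases ih hm with (h | h) | h
    · exact .inr (h ▸ dyn_mem_own p i)
    · exact .inl h
    · exact .inr (own_succ_subset h)
  | write hE _ _ ih =>
    rcases List.mem_cons.1 hm with h | h
    · cases h; exact .inl hE
    · exact ih h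
  | read _ _ _ _ ih₁ ih₂ =>
    rcases List.mem_append.1 hm with h | h
    · exact (ih₁ h).imp_right own_cons_subset
    · exact (ih₂ h).imp_right own_cons_subset
  | par _ _ _ _ iha ihb ihk =>
    simp only [List.mem_append] at hm
    rcases hm with (h | h) | h
    · exact (iha h).imp_right fun h => own_cons_subset (own_cons_subset (i := 0) h)
    · exact (ihb h).imp_right fun h => own_cons_subset (own_cons_subset (i := 0) h)
    · exact (ihk h).imp_right own_cons_subset

/-- Each write finds its modifiable empty, and the store only grows between the start of the
computation and that write. This is how the write-once discipline is used everywhere below. -/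
theorem store_eq_none (h : Eval E σ p i A b τ) {m : Modifiable ι} {v : V} (hm : (m, v) ∈ τ) :
    σ m = none := by
  induction h with
  | done => simp at hm
  | step _ ih => exact ih hm
  | alloc _ ih => exact ih hm
  | write _ hn _ ih =>
    rcases List.mem_cons.1 hm with h | h
    · cases h; exact hn
    · have h1 := ih h
      rw [Function.update_of_ne] at h1
      · exact h1
      · rintro rfl; simp at h1
  | read _ _ _ _ ih₁ ih₂ =>
    rcases List.mem_append.1 hm with h | h
    · exact ih₁ h
    · exact (writes_eq_none (ih₂ h)).1
  | par _ _ _ _ iha ihb ihk =>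
    simp only [List.mem_append] at hm
    rcases hm with (h | h) | h
    · exact iha h
    · exact ihb h
    · exact (writes_eq_none (ihk h)).1

theorem keys_nodup (h : Eval E σ p i A b τ) : (τ.map Prod.fst).Nodup := by
  induction h with
  | done => simp
  | step _ ih => exact ih
  | alloc _ ih => exact ih
  | @write E σ p i m v k b τ _ _ hk ih =>
    rw [List.map_cons, List.nodup_cons]
    refine ⟨fun h => ?_, ih⟩
    obtain ⟨⟨m', v'⟩, h1, rfl⟩ := List.mem_map.1 h
    have := hk.store_eq_none h1
    simp at this
  | @read _ _ _ _ _ _ _ _ _ _ _ _ _ _ _ h2 ih₁ ih₂ =>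
    rw [List.map_append, List.nodup_append']
    refine ⟨ih₁, ih₂, fun m h h' => ?_⟩
    obtain ⟨⟨m₁, v₁⟩, h1, rfl⟩ := List.mem_map.1 h
    obtain ⟨⟨m₂, v₂⟩, h3, h4⟩ := List.mem_map.1 h'
    cases h4
    exact (writes_eq_none (h2.store_eq_none h3)).2 _ h1
  | @par _ _ _ _ _ _ _ _ τa _ τb _ _ _ _ hd hk iha ihb ihk =>
    have hab : ((τa ++ τb).map Prod.fst).Nodup := by
      rw [List.map_append, List.nodup_append']
      refine ⟨iha, ihb, fun m h h' => ?_⟩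
      obtain ⟨x, h1, rfl⟩ := List.mem_map.1 h
      obtain ⟨y, h3, h4⟩ := List.mem_map.1 h'
      exact hd x h1 y h3 h4.symm
    rw [List.map_append, List.nodup_append']
    refine ⟨hab, ihk, fun m h h' => ?_⟩
    obtain ⟨⟨m₁, v₁⟩, h1, rfl⟩ := List.mem_map.1 h
    obtain ⟨⟨m₂, v₂⟩, h3, h4⟩ := List.mem_map.1 h'
    cases h4
    exact (writes_eq_none (hk.store_eq_none h3)).2 _ h1

/-- Modifiables are read strictly below the scope that allocates them. -/
theorem reader_below (h : Eval E σ p i A b τ) (hE : Outer E p i) {x q : Path} {j : ℕ}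
    (hq : q ∈ b.readers (.dyn x j) p) : q ∈ SBelow x := by
  induction h with
  | done => simp [Body.readers, Tree.readers] at hq
  | step _ ih => exact ih hE hq
  | alloc _ ih => exact ih hE.insert hq
  | write _ _ _ ih => exact ih hE hq
  | @read E σ p i ms f k vs b₁ τ₁ b₂ τ₂ hms _ _ _ ih₁ ih₂ =>
    rw [Body.mem_readers, Body.read, Body.mem_node_readers, Body.mem_node_readers] at hq
    rcases hq with (⟨hm, rfl⟩ | h) | ⟨hm, -⟩ | h
    · have := (hE.cons false) x j (hms _ hm)
      exact ⟨this.1, fun h => absurd (this.2 h.symm) (by simp)⟩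
    · exact ih₁ (hE.cons _) h
    · simp [Label.mods] at hm
    · exact ih₂ (hE.cons _) h
  | @par E σ p i a b k ba τa bb τb bk τk _ _ _ _ iha ihb ihk =>
    rw [Body.mem_readers, Body.par, Tree.mem_readers_node, Body.mem_node_readers,
      Body.mem_node_readers, Body.mem_node_readers] at hq
    rcases hq with (⟨hm, -⟩ | (⟨hm, -⟩ | h) | (⟨hm, -⟩ | h)) | ⟨hm, -⟩ | h
    · simp [Label.mods] at hm
    · simp [Label.mods] at hm
    · exact iha ((hE.cons _).cons _) h
    · simp [Label.mods] at hm
    · exact ihb ((hE.cons _).cons _) h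
    · simp [Label.mods] at hm
    · exact ihk (hE.cons _) h

/-- The worst case is a fork: for one unit of work it creates a P node, two S nodes for the branches
and one for the continuation. -/
theorem nodes_le (h : Eval E σ p i A b τ) : b.nodes ≤ 4 * b.work := by
  induction h with
  | done => simp [Body.nodes, Tree.nodes]
  | step _ ih => simp only [Body.nodes, Body.work, Body.tick] at *; omega
  | alloc _ ih => simp only [Body.nodes, Body.work, Body.tick] at *; omega
  | write _ _ _ ih => simp only [Body.nodes, Body.work, Body.tick] at *; omega
  | read _ _ _ _ ih₁ ih₂ =>
    simp only [Body.nodes, Body.work, Body.read, Body.node, Tree.nodes, Tree.work] at *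
    omega
  | par _ _ _ _ iha ihb ihk =>
    simp only [Body.nodes, Body.work, Body.par, Body.node, Tree.nodes, Tree.work] at *
    omega

theorem length_le_work (h : Eval E σ p i A b τ) : τ.length ≤ b.work := by
  induction h with
  | done => simp
  | step _ ih => simp only [Body.work, Body.tick] at *; omega
  | alloc _ ih => simp only [Body.work, Body.tick] at *; omega
  | write _ _ _ ih => simp only [Body.work, Body.tick, List.length_cons] at *; omega
  | read _ _ _ _ ih₁ ih₂ =>
    simp only [Body.work, Body.read, Body.node, Tree.work, List.length_append] at *
    omega
  | par _ _ _ _ iha ihb ihk =>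
    simp only [Body.work, Body.par, Body.node, Tree.work, List.length_append] at *
    omega

/-- Destruction runs both children in parallel, so it follows a single downward path. Each read or
fork on this path has a unit of span in the run and adds at most two nodes before the next scope (P
and S in the case of a fork), at cost Q each. -/
theorem parSpan_le (h : Eval E σ p i A b τ) (Q : ℕ) :
    b.strand + max (b.l.parSpan Q) (b.r.parSpan Q) ≤ (2 * Q + 1) * b.span := by
  induction h with
  | done => simp [Tree.parSpan]
  | step _ ih => simp only [Body.span, Body.tick] at *; nlinarith
  | alloc _ ih => simp only [Body.span, Body.tick] at *; nlinarith
  | write _ _ _ ih => simp only [Body.span, Body.tick] at *; nlinarith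
  | @read _ _ _ _ ms f _ vs b₁ _ b₂ _ _ _ _ _ ih₁ ih₂ =>
    have h1 : ((Body.node (.R ms f vs) b₁).parSpan Q) ≤ Q + (2 * Q + 1) * b₁.span := by
      simp only [Body.node, Tree.parSpan]; omega
    have h2 : ((Body.node .S b₂).parSpan Q) ≤ Q + (2 * Q + 1) * b₂.span := by
      simp only [Body.node, Tree.parSpan]; omega
    simp only [Body.read]
    rw [Body.span]
    simp only [Body.node_span_S, Body.node_span_R]
    have : max ((Body.node (.R ms f vs) b₁).parSpan Q) ((Body.node .S b₂).parSpan Q) ≤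
        Q + (2 * Q + 1) * b₁.span + (2 * Q + 1) * b₂.span := by
      refine max_le (by omega) (by omega)
    refine (Nat.add_le_add_left this 1).trans ?_
    nlinarith
  | @par _ _ _ _ _ _ _ ba _ bb _ bk _ _ _ _ _ iha ihb ihk =>
    have h1 : ((Body.node .S ba).parSpan Q) ≤ Q + (2 * Q + 1) * max ba.span bb.span := by
      have := Nat.mul_le_mul_left (2 * Q + 1) (le_max_left ba.span bb.span)
      simp only [Body.node, Tree.parSpan]; omega
    have h2 : ((Body.node .S bb).parSpan Q) ≤ Q + (2 * Q + 1) * max ba.span bb.span := by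
      have := Nat.mul_le_mul_left (2 * Q + 1) (le_max_right ba.span bb.span)
      simp only [Body.node, Tree.parSpan]; omega
    have h3 : ((Body.node .S bk).parSpan Q) ≤ Q + (2 * Q + 1) * bk.span := by
      simp only [Body.node, Tree.parSpan]; omega
    simp only [Body.par, Tree.parSpan]
    rw [Body.span]
    simp only [Tree.span, Body.node_span_S]
    have h4 : max (Q + 0 + max ((Body.node .S ba).parSpan Q) ((Body.node .S bb).parSpan Q))
        ((Body.node .S bk).parSpan Q) ≤
        2 * Q + (2 * Q + 1) * max ba.span bb.span + (2 * Q + 1) * bk.span := by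
      refine max_le ?_ (by omega)
      have := max_le h1 h2
      omega
    refine (Nat.add_le_add_left h4 1).trans ?_
    nlinarith

/-- Each allocation is a unit step of its own strand, so deallocation is paid for by the work and
the span of the old run. The i allocations made before the program is entered are not in its strand;
i = 0 at every new scope. -/
theorem allocsLe (h : Eval E σ p i A b τ) :
    b.allocs ≤ i + b.strand ∧ b.l.AllocsLe ∧ b.r.AllocsLe := by
  induction h with
  | done => simp [Tree.AllocsLe]
  | step _ ih => simp only [Body.tick] at *; exact ⟨by omega, ih.2⟩
  | alloc _ ih => simp only [Body.tick] at *; exact ⟨by omega, ih.2⟩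
  | write _ _ _ ih => simp only [Body.tick] at *; exact ⟨by omega, ih.2⟩
  | read _ _ _ _ ih₁ ih₂ =>
    simp only [Body.read, Body.node, Tree.AllocsLe] at *
    exact ⟨by omega, ⟨by omega, ih₁.2⟩, ⟨by omega, ih₂.2⟩⟩
  | par _ _ _ _ iha ihb ihk =>
    simp only [Body.par, Body.node, Tree.AllocsLe] at *
    exact ⟨by omega, ⟨by omega, ⟨by omega, iha.2⟩, ⟨by omega, ihb.2⟩⟩, ⟨by omega, ihk.2⟩⟩

end Eval

end

section

variable {ι V : Type*} [DecidableEq ι]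

/-! ### Invariants of the state -/

/-- The reader sets of the state are parts of those for the tree `T`. -/
structure TabOK (T : Tree ι V) (S : State ι V) : Prop where
  sub : ∀ m, (S.tab m).elems.Sublist (T.readers m [])
  size : ∀ m, (S.tab m).size = max 1 (T.readers m []).length ∨
    ((S.tab m).size = 1 ∧ (S.tab m).elems = [])
  dels : ∀ m, (S.tab m).size ≤ 1 + (S.tab m).elems.length + S.dels.count m

/-- `A` contains the ancestors of its elements. -/
def SuffixClosed (A : Set Path) : Prop := ∀ x y, x <:+ y → y ∈ A → x ∈ A

/-- The marked nodes are those in `A` and the ancestors of the nodes flagged as affected. -/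
def MarkInv (A : Set Path) (S : State ι V) : Prop :=
  ∀ x, x ∈ S.marked ↔ x ∈ A ∨ ∃ q ∈ S.affected, x <:+ q

/-- The nodes flagged as affected are the readers outside of `D` of the modifiables with values that
differ from those in `F`. -/
def FlagInv (F : Modifiable ι → Option V) (D : Set Path) (S : State ι V) : Prop :=
  ∀ q, q ∈ S.affected ↔ q ∉ D ∧ ∃ m, q ∈ (S.tab m).elems ∧ S.val m ≠ F m

structure Inv (T : Tree ι V) (F : Modifiable ι → Option V) (A D : Set Path) (S : State ι V) :
    Prop where
  tab : TabOK T S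
  mark : MarkInv A S
  flag : FlagInv F D S

theorem MarkInv.closed {A : Set Path} {S : State ι V} (h : MarkInv A S) (hA : SuffixClosed A) :
    SuffixClosed (S.marked : Set Path) := by
  intro x y hxy hy
  rcases (h y).1 hy with h1 | ⟨q, hq, h1⟩
  · exact (h x).2 (.inl (hA x y hxy h1))
  · exact (h x).2 (.inr ⟨q, hq, hxy.trans h1⟩)

theorem TabOK.nodup {T : Tree ι V} {S : State ι V} (h : TabOK T S) (m : Modifiable ι) :
    (S.tab m).elems.Nodup := (T.readers_nodup m []).sublist (h.sub m)

theorem TabOK.one_le {T : Tree ι V} {S : State ι V} (h : TabOK T S) (m : Modifiable ι) :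
    1 ≤ (S.tab m).size := by
  rcases h.size m with h | h <;> omega

/-- Tables start with as many buckets as keys and only lose keys until the batch at the end, so the
load factor stays at most 1 during the traversal. -/
theorem TabOK.length_le {T : Tree ι V} {S : State ι V} (h : TabOK T S) (m : Modifiable ι) :
    (S.tab m).elems.length ≤ (S.tab m).size := by
  have := (h.sub m).length_le
  rcases h.size m with h | ⟨_, h⟩
  · omega
  · simp [h]

theorem TabOK.size_le {T : Tree ι V} {S : State ι V} (h : TabOK T S) (m : Modifiable ι) :
    (S.tab m).size ≤ max 1 (T.readers m []).length := by
  rcases h.size m with h | ⟨h, -⟩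
  · omega
  · omega

/-- In the reader sets for the tree `T`, all chains have length at most `L`. -/
def TabGood (T : Tree ι V) (L : ℕ) (g : Hash) : Prop :=
  ∀ m b, load (max 1 (T.readers m []).length) (T.readers m []) b g ≤ L

theorem TabOK.load_le {T : Tree ι V} {S : State ι V} (h : TabOK T S) {L : ℕ} {g : Hash}
    (hg : TabGood T L g) (m : Modifiable ι) (b : ℕ) :
    load (S.tab m).size (S.tab m).elems b g ≤ L := by
  rcases h.size m with h1 | ⟨h1, h2⟩
  · rw [h1]
    exact (load_sublist (h.sub m) g).trans (hg m b)
  · simp [h2, load]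

/-! ### Marking -/

/-- Every visited node but the last is newly marked, because the climb ends as soon as the parent
carries a mark. So the number of steps exceeds the growth of the marked set by at most one. Closure
under ancestors is assumed only along p: the recursive call happens with p's child already inserted
and its ancestors still missing. -/
theorem mark_spec (p : Path) (s : Finset Path)
    (hs : ∀ x y, y <:+ p → x <:+ y → y ∈ s → x ∈ s) :
    (∀ x, x ∈ (mark p s).1 ↔ x ∈ s ∨ x <:+ p) ∧
      (mark p s).2 + s.card ≤ (mark p s).1.card + 1 ∧ (mark p s).2 ≤ p.length + 1 := by
  induction p generalizing s with
  | nil =>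
    refine ⟨fun x => ?_, ?_, ?_⟩
    · simp [mark, or_comm]
    · simp only [mark]
      have := Finset.card_le_card (Finset.subset_insert ([] : Path) s)
      omega
    · simp [mark]
  | cons d p ih =>
    rw [mark]
    split_ifs with hp
    · refine ⟨fun x => ?_, ?_, by simp⟩
      · rw [Finset.mem_insert, List.suffix_cons_iff]
        constructor
        · rintro (h | h)
          · exact .inr (.inl h)
          · exact .inl h
        · rintro (h | h | h)
          · exact .inr h
          · exact .inl h
          · exact .inr (hs x p (List.suffix_cons d p) h hp)
      · have := Finset.card_le_card (Finset.subset_insert (d :: p : Path) s)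
        simp only
        omega
    · have hd : (d :: p) ∉ s := fun h => hp (hs p (d :: p) List.suffix_rfl (List.suffix_cons d p) h)
      obtain ⟨h1, h2, h3⟩ := ih (insert (d :: p) s) (by
        intro x y hy hxy hys
        rcases Finset.mem_insert.1 hys with rfl | h
        · have := hy.length_le
          simp at this
        · exact Finset.mem_insert_of_mem
            (hs x y (hy.trans (List.suffix_cons d p)) hxy h))
      refine ⟨fun x => ?_, ?_, ?_⟩
      · rw [h1, Finset.mem_insert, List.suffix_cons_iff]
        tauto
      · rw [Finset.card_insert_of_notMem hd] at h2
        simp only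
        omega
      · simp only [List.length_cons]
        omega

/-- The potential argument for a whole reader set: two units per reader, and the rest of the
climbing is covered by the increase of the marked set. A single climb has length at most the depth
of the reader, which bounds the span. -/
theorem State.notify_spec (S : State ι V) (ps : List Path)
    (hs : SuffixClosed (S.marked : Set Path)) :
    (S.notify ps).1.val = S.val ∧ (S.notify ps).1.tab = S.tab ∧ (S.notify ps).1.pend = S.pend ∧
    (S.notify ps).1.dels = S.dels ∧
    (∀ q, q ∈ (S.notify ps).1.affected ↔ q ∈ S.affected ∨ q ∈ ps) ∧
    (∀ x, x ∈ (S.notify ps).1.marked ↔ x ∈ S.marked ∨ ∃ q ∈ ps, x <:+ q) ∧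
    (S.notify ps).2.map Prod.fst = ps ∧
    ((S.notify ps).2.map Prod.snd).sum + S.marked.card ≤
      2 * ps.length + (S.notify ps).1.marked.card ∧
    ∀ y ∈ (S.notify ps).2, y.2 ≤ y.1.length + 2 := by
  induction ps generalizing S with
  | nil => simp [State.notify]
  | cons p ps ih =>
    obtain ⟨h1, h2, h3⟩ := mark_spec p S.marked fun x y _ hxy hy => hs x y hxy hy
    have hs' : SuffixClosed (((mark p S.marked).1 : Finset Path) : Set Path) := by
      intro x y hxy hy
      rw [Finset.mem_coe, h1] at hy ⊢
      exact hy.imp (hs x y hxy) hxy.trans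
    obtain ⟨i1, i2, i3, i4, i5, i6, i7, i8, i9⟩ :=
      ih { S with marked := (mark p S.marked).1, affected := insert p S.affected } hs'
    rw [State.notify]
    refine ⟨i1, i2, i3, i4, fun q => ?_, fun x => ?_, ?_, ?_, ?_⟩
    · rw [i5, Finset.mem_insert, List.mem_cons]
      tauto
    · rw [i6, h1]
      simp only [List.mem_cons, exists_eq_or_imp]
      tauto
    · simp [i7]
    · simp only [List.map_cons, List.sum_cons, List.length_cons]
      simp only at i8
      omega
    · intro y hy
      rcases List.mem_cons.1 hy with rfl | hy
      · simp only; omega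
      · exact i9 y hy

/-! ### Writing -/

/-- The numbers of readers of those modifiables that are written with values different from those in
`F`. -/
def changeCost [DecidableEq V] (T : Tree ι V) (F : Modifiable ι → Option V)
    (τ : List (Modifiable ι × V)) : ℕ :=
  (τ.map fun x => if F x.1 = some x.2 then 0 else (T.readers x.1 []).length).sum

theorem changeCost_append [DecidableEq V] (T : Tree ι V) (F : Modifiable ι → Option V)
    (τ₁ τ₂ : List (Modifiable ι × V)) :
    changeCost T F (τ₁ ++ τ₂) = changeCost T F τ₁ + changeCost T F τ₂ := by
  simp [changeCost]

theorem changeCost_cons [DecidableEq V] (T : Tree ι V) (F : Modifiable ι → Option V)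
    (x : Modifiable ι × V) (τ : List (Modifiable ι × V)) :
    changeCost T F (x :: τ) =
      (if F x.1 = some x.2 then 0 else (T.readers x.1 []).length) + changeCost T F τ := by
  simp [changeCost]

section Write

variable [DecidableEq V] {T : Tree ι V} {F : Modifiable ι → Option V} {A D : Set Path}
  {S : State ι V} {Ω : Type*} [MeasurableSpace Ω] {μ : Measure Ω} [IsProbabilityMeasure μ]
  {H : Ω → Hash}

/-- The hypotheses say that the modifiable still has its old value or has no readers, and that none
of its readers was visited before. Then a write that changes the stored value flags exactly the
readers that the invariant requires to be flagged. -/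
theorem State.write_spec (hH : UniformHashing μ H) (L : ℕ) (hI : Inv T F A D S)
    (hA : SuffixClosed A) {m : Modifiable ι} (v : V)
    (hm : S.val m = F m ∨ S.tab m = Table.fresh [])
    (hD : ∀ q ∈ (S.tab m).elems, q ∉ D) :
    Inv T F A D (S.write m v).1 ∧ (S.write m v).1.val = Function.update S.val m (some v) ∧
    (S.write m v).1.tab = S.tab ∧ (S.write m v).1.pend = S.pend ∧ (S.write m v).1.dels = S.dels ∧
    ∃ w, (S.write m v).2.Bounded μ H (TabGood T L) w (2 * T.height + L + 3) ∧
      w + S.marked.card ≤ 4 + 5 * (if F m = some v then 0 else (T.readers m []).length) +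
        (S.write m v).1.marked.card := by
  by_cases hv : S.val m ≠ some v
  · rw [State.write, if_pos hv]
    obtain ⟨i1, i2, i3, i4, i5, i6, i7, i8, i9⟩ :=
      State.notify_spec { S with val := Function.update S.val m (some v) } (S.tab m).elems
        (hI.mark.closed hA)
    set S' := (State.notify { S with val := Function.update S.val m (some v) } (S.tab m).elems).1
      with hS'
    set xs := (State.notify { S with val := Function.update S.val m (some v) } (S.tab m).elems).2
      with hxs
    simp only at i1 i2 i3 i4 i5 i6 i8
    change Inv T F A D S' ∧ S'.val = _ ∧ S'.tab = _ ∧ S'.pend = _ ∧ S'.dels = _ ∧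
      ∃ w, (Cost.tick 1 + Cost.scan (S.tab m).size xs).Bounded μ H (TabGood T L) w _ ∧
        w + S.marked.card ≤ _ + S'.marked.card
    refine ⟨⟨⟨?_, ?_, ?_⟩, ?_, ?_⟩, i1, i2, i3, i4, ?_⟩
    · rw [i2]; exact hI.tab.sub
    · rw [i2]; exact hI.tab.size
    · rw [i2, i4]; exact hI.tab.dels
    · intro x
      rw [i6, hI.mark x]
      simp only [i5]
      constructor
      · rintro ((h | ⟨q, hq, h⟩) | ⟨q, hq, h⟩)
        · exact .inl h
        · exact .inr ⟨q, .inl hq, h⟩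
        · exact .inr ⟨q, .inr hq, h⟩
      · rintro (h | ⟨q, hq | hq, h⟩)
        · exact .inl (.inl h)
        · exact .inl (.inr ⟨q, hq, h⟩)
        · exact .inr ⟨q, hq, h⟩
    -- If the modifiable has readers, it holds its old value `F m`; a value other than the current
    -- one is thus a value other than `F m`.
    · intro q
      rw [i5, hI.flag q, i1, i2]
      constructor
      · rintro (⟨hq, m', h1, h2⟩ | h)
        · refine ⟨hq, m', h1, ?_⟩
          by_cases hmm : m' = m
          · subst hmm
            rcases hm with hm | hm
            · exact absurd hm h2
            · rw [hm] at h1; simp [Table.fresh] at h1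
          · rwa [Function.update_of_ne hmm]
        · refine ⟨hD q h, m, h, ?_⟩
          rw [Function.update_self]
          rcases hm with hm | hm
          · rw [← hm]; exact hv.symm
          · rw [hm] at h; simp [Table.fresh] at h
      · rintro ⟨hq, m', h1, h2⟩
        by_cases hmm : m' = m
        · subst hmm; exact .inr h1
        · rw [Function.update_of_ne hmm] at h2
          exact .inl ⟨hq, m', h1, h2⟩
    · have hscan : (Cost.scan (S.tab m).size xs).Bounded μ H (TabGood T L)
          (1 + (S.tab m).size + (xs.map fun x => 1 + x.2).sum)
          (1 + Nat.clog 2 (S.tab m).size + (L + (T.height + 1))) := by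
        refine hH.scan_bounded (fun g hg b => ?_) (fun x hx => ?_)
        · rw [i7]
          exact hI.tab.load_le hg m b
        · have h1 := i9 x hx
          have h2 : x.1 ∈ (S.tab m).elems := i7 ▸ List.mem_map.2 ⟨x, hx, rfl⟩
          have h3 := Tree.readers_depth ((hI.tab.sub m).subset h2)
          simp at h3
          omega
      have hclog : Nat.clog 2 (S.tab m).size ≤ T.height := by
        refine (Nat.clog_le_iff_le_pow (by norm_num)).2 ?_
        have h1 := hI.tab.size_le m
        have h2 := T.readers_length_le m []
        have h3 := T.nodes_lt_two_pow
        omega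
      refine ⟨_, ((Cost.Bounded.tick 1).add hscan).mono le_rfl (by omega), ?_⟩
      · have h1 : ((xs.map fun x => 1 + x.2)).sum = (S.tab m).elems.length +
            (xs.map Prod.snd).sum := by
          rw [List.sum_map_add]
          have : xs.length = (S.tab m).elems.length := by rw [← i7]; simp
          simp [this]
        have h2 := (hI.tab.sub m).length_le
        have h3 := hI.tab.size_le m
        rw [h1]
        -- If the old run ended with the same value although the current one is different, the
        -- modifiable no longer holds its old value; it then has an empty reader set and the write
        -- takes constant time.
        split_ifs with hF
        · rcases hm with hm | hm
          · exact absurd (hm.trans hF) hv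
          · rw [hm] at i8 ⊢
            simp only [Table.fresh, List.length_nil] at i8 ⊢
            omega
        · omega
  · rw [State.write, if_neg hv]
    rw [not_not] at hv
    refine ⟨hI, ?_, rfl, rfl, rfl, 1, (Cost.Bounded.tick 1).mono le_rfl (by omega), by simp only; omega⟩
    rw [← hv, Function.update_eq_self]

/-- A modifiable without readers contributes to no flag, so its value may be reset freely. -/
theorem State.alloc_inv (hI : Inv T F A D S) {m : Modifiable ι} (hm : (S.tab m).elems = []) :
    Inv T F A D (S.alloc m) := by
  have htab : ∀ m', (S.alloc m).tab m' = if m' = m then Table.fresh [] else S.tab m' := by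
    intro m'
    simp only [State.alloc, Function.update_apply]
  have hval : ∀ m', (S.alloc m).val m' = if m' = m then none else S.val m' := by
    intro m'
    simp only [State.alloc, Function.update_apply]
  refine ⟨⟨fun m' => ?_, fun m' => ?_, fun m' => ?_⟩, hI.mark, fun q => ?_⟩
  · rw [htab]
    split_ifs
    · exact List.nil_sublist _
    · exact hI.tab.sub m'
  · rw [htab]
    split_ifs
    · exact .inr ⟨rfl, rfl⟩
    · exact hI.tab.size m'
  · rw [htab]
    split_ifs
    · simp [Table.fresh]
    · exact hI.tab.dels m'
  · have := hI.flag q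
    refine this.trans (and_congr_right fun _ => exists_congr fun m' => ?_)
    rw [htab, hval]
    split_ifs with h
    · subst h
      simp [hm, Table.fresh]
    · rfl

end Write

end

section

variable {ι V : Type*} [DecidableEq ι]

/-! ### Executions that do not interfere -/

/-- Two computations that start in the store `σ`, in the scope of `E`, with the allocations `O₁`, `O₂`
and the writes `τ₁`, `τ₂`, do not interfere. -/
structure Split (E : Set (Modifiable ι)) (σ : Modifiable ι → Option V) (O₁ O₂ : Set (Modifiable ι))
    (τ₁ τ₂ : List (Modifiable ι × V)) : Prop where
  out₁ : ∀ m ∈ E, m ∉ O₁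
  out₂ : ∀ m ∈ E, m ∉ O₂
  disj : ∀ m ∈ O₁, m ∉ O₂
  keys₁ : ∀ m v, (m, v) ∈ τ₁ → m ∈ E ∨ m ∈ O₁
  keys₂ : ∀ m v, (m, v) ∈ τ₂ → m ∈ E ∨ m ∈ O₂
  none₁ : ∀ m v, (m, v) ∈ τ₁ → σ m = none
  none₂ : ∀ m v, (m, v) ∈ τ₂ → σ m = none
  kdisj : ∀ m v v', (m, v) ∈ τ₁ → (m, v') ∉ τ₂

namespace Split

variable {E : Set (Modifiable ι)} {σ : Modifiable ι → Option V} {O₁ O₂ : Set (Modifiable ι)}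
  {τ₁ τ₂ : List (Modifiable ι × V)}

theorem symm (h : Split E σ O₁ O₂ τ₁ τ₂) : Split E σ O₂ O₁ τ₂ τ₁ :=
  ⟨h.out₂, h.out₁, fun m h1 h2 => h.disj m h2 h1, h.keys₂, h.keys₁, h.none₂, h.none₁,
    fun m v v' h1 h2 => h.kdisj m v' v h2 h1⟩

theorem notMem₁ (h : Split E σ O₁ O₂ τ₁ τ₂) {m : Modifiable ι} (hm : m ∈ O₂) (v : V) :
    (m, v) ∉ τ₁ := fun h1 => by
  rcases h.keys₁ m v h1 with h2 | h2
  · exact h.out₂ m h2 hm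
  · exact h.disj m h2 hm

theorem notMem_own (h : Split E σ O₁ O₂ τ₁ τ₂) {m : Modifiable ι} {v : V} (hm : (m, v) ∈ τ₂) :
    m ∉ O₁ := fun h1 => by
  rcases h.keys₂ m v hm with h2 | h2
  · exact h.out₁ m h2 h1
  · exact h.disj m h1 h2

/-- A computation followed by another one. -/
theorem of_seq {p : Path} {i : ℕ} {k : Prog ι V} {b' : Body ι V} {d e : Bool}
    (hE : Outer E p i) (hde : d ≠ e) (h₁ : ∀ m v, (m, v) ∈ τ₁ → m ∈ E ∨ m ∈ Own (d :: p) 0)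
    (hn : ∀ m v, (m, v) ∈ τ₁ → σ m = none)
    (h₂ : Eval E (writes σ τ₁) (e :: p) 0 k b' τ₂) :
    Split E σ (Own (d :: p) 0) (Own (e :: p) 0) τ₁ τ₂ where
  out₁ m hm := (hE.cons d).not_own hm
  out₂ m hm := (hE.cons e).not_own hm
  disj m hm := own_disjoint hde hm
  keys₁ := h₁
  keys₂ m v hm := h₂.mem_outer_or_own hm
  none₁ := hn
  none₂ m v hm := (writes_eq_none (h₂.store_eq_none hm)).1
  kdisj m v v' hm hm' := (writes_eq_none (h₂.store_eq_none hm')).2 v hm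

/-- Two computations in parallel. -/
theorem of_par {p : Path} {i : ℕ} {a c : Prog ι V} {b b' : Body ι V}
    (hE : Outer E p i) (h₁ : Eval E σ (false :: p) 0 a b τ₁) (h₂ : Eval E σ (true :: p) 0 c b' τ₂)
    (hd : ∀ x ∈ τ₁, ∀ y ∈ τ₂, x.1 ≠ y.1) :
    Split E σ (Own (false :: p) 0) (Own (true :: p) 0) τ₁ τ₂ where
  out₁ m hm := (hE.cons _).not_own hm
  out₂ m hm := (hE.cons _).not_own hm
  disj m hm := own_disjoint (by simp) hm
  keys₁ m v hm := h₁.mem_outer_or_own hm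
  keys₂ m v hm := h₂.mem_outer_or_own hm
  none₁ m v hm := h₁.store_eq_none hm
  none₂ m v hm := h₂.store_eq_none hm
  kdisj m v v' hm hm' := hd _ hm _ hm' rfl

end Split

theorem fresh_writes {E : Set (Modifiable ι)} {σ : Modifiable ι → Option V} {O₁ O₂ : Set (Modifiable ι)}
    {τ₁ τ₂ : List (Modifiable ι × V)} (h : Split E σ O₁ O₂ τ₁ τ₂) (hf : ∀ m ∈ O₂, σ m = none) :
    ∀ m ∈ O₂, writes σ τ₁ m = none := fun m hm => by
  rw [writes_of_notMem fun v => h.notMem₁ hm v]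
  exact hf m hm

/-- The state may hold stale values of the old run where σ is undefined. A valid read touches only
places where σ is defined, and there the state agrees with σ. -/
theorem vals_eq [Inhabited V] {E : Set (Modifiable ι)} {σ : Modifiable ι → Option V} {S : State ι V}
    {ms : List (Modifiable ι)} {vs : List V} (hE : ∀ m ∈ ms, m ∈ E)
    (hvs : ms.map σ = vs.map some) (hv : ∀ m ∈ E, ∀ v, σ m = some v → S.val m = some v) :
    S.vals ms = vs := by
  induction ms generalizing vs with
  | nil =>
    cases vs with
    | nil => rfl
    | cons => simp at hvs
  | cons m ms ih =>
    cases vs with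
    | nil => simp at hvs
    | cons v vs =>
      simp only [List.map_cons, List.cons.injEq] at hvs
      have h1 := hv m (hE m List.mem_cons_self) v hvs.1
      have h2 := ih (fun m hm => hE m (List.mem_cons_of_mem _ hm)) hvs.2
      simp only [State.vals, List.map_cons, h1, Option.getD_some, List.cons.injEq, true_and] at h2 ⊢
      exact h2

/-! ### Re-execution -/

/-- E and σ are scope and store of the from-scratch run, τ the writes to come, O the names it may
allocate. Agreement with σ is demanded only where σ is defined, since values of the old run may
linger elsewhere. The second alternative in `new` is for modifiables that the re-execution itself
has allocated; `safe` excludes that a write reaches a reader which was visited already. -/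
structure ExecPre (T : Tree ι V) (F : Modifiable ι → Option V) (A D : Set Path)
    (E O : Set (Modifiable ι)) (σ : Modifiable ι → Option V) (τ : List (Modifiable ι × V))
    (S : State ι V) : Prop where
  inv : Inv T F A D S
  val : ∀ m ∈ E, ∀ v, σ m = some v → S.val m = some v
  new : ∀ m v, (m, v) ∈ τ → m ∈ E → S.val m = F m ∨ S.tab m = Table.fresh []
  own : ∀ m ∈ O, (S.tab m).elems = []
  safe : ∀ m v, (m, v) ∈ τ → ∀ q ∈ (S.tab m).elems, q ∉ D

/-- Nothing is promised about the values in O: they leave scope with the computation. Reader sets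
outside O do not change at all, since insertions are only queued in `pend`; R and N bound where the
queued readers lie and how many there are. -/
structure ExecPost (T : Tree ι V) (F : Modifiable ι → Option V) (A D : Set Path)
    (O : Set (Modifiable ι)) (R : Set Path) (τ : List (Modifiable ι × V)) (N : ℕ)
    (S S' : State ι V) : Prop where
  inv : Inv T F A D S'
  valW : ∀ m v, (m, v) ∈ τ → m ∉ O → S'.val m = some v
  valN : ∀ m, m ∉ O → (∀ v, (m, v) ∉ τ) → S'.val m = S.val m
  tab : ∀ m, m ∉ O → S'.tab m = S.tab m
  own : ∀ m ∈ O, (S'.tab m).elems = []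
  dels : S'.dels = S.dels
  pend : ∃ new, S'.pend = new ++ S.pend ∧ new.Nodup ∧ (∀ x ∈ new, x.2 ∈ R) ∧ new.length ≤ N

section Exec

variable {T : Tree ι V} {F : Modifiable ι → Option V} {A D : Set Path} {S S₁ S₂ : State ι V}
  {E O O₁ O₂ : Set (Modifiable ι)} {R R₁ R₂ : Set Path} {σ σ₂ : Modifiable ι → Option V}
  {τ₁ τ₂ : List (Modifiable ι × V)} {N₁ N₂ : ℕ}

/-- What the second computation needs survives the first because they share neither written nor
allocated modifiables. The store σ₂ is σ for parallel branches, which do not see each other's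
writes, and σ extended by τ₁ for a continuation. -/
theorem ExecPre.next (hs : Split E σ O₁ O₂ τ₁ τ₂) (h₂ : ExecPre T F A D E O₂ σ τ₂ S)
    (h : ExecPost T F A D O₁ R₁ τ₁ N₁ S S₁)
    (hσ : ∀ m v, σ₂ m = some v → σ m = some v ∨ (m, v) ∈ τ₁) :
    ExecPre T F A D E O₂ σ₂ τ₂ S₁ where
  inv := h.inv
  val m hm v hv := by
    rcases hσ m v hv with h1 | h1
    · rw [h.valN m (hs.out₁ m hm), h₂.val m hm v h1]
      intro v' hv'
      simp [hs.none₁ m v' hv'] at h1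
    · exact h.valW m v h1 (hs.out₁ m hm)
  new m v hm hE := by
    rw [h.valN m (hs.out₁ m hE) (fun v' => fun h1 => hs.kdisj m v' v h1 hm), h.tab m (hs.out₁ m hE)]
    exact h₂.new m v hm hE
  own m hm := by
    rw [h.tab m fun h1 => hs.disj m h1 hm]
    exact h₂.own m hm
  safe m v hm := by
    rw [h.tab m (hs.notMem_own hm)]
    exact h₂.safe m v hm

theorem ExecPost.comp (h₁ : ExecPost T F A D O₁ R₁ τ₁ N₁ S S₁)
    (h₂ : ExecPost T F A D O₂ R₂ τ₂ N₂ S₁ S₂) (ho : ∀ m ∈ O, (S.tab m).elems = [])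
    (hk : ∀ m v v', (m, v) ∈ τ₁ → (m, v') ∉ τ₂)
    (hO₁ : O₁ ⊆ O) (hO₂ : O₂ ⊆ O) (hR₁ : R₁ ⊆ R) (hR₂ : R₂ ⊆ R) (hR : ∀ q ∈ R₁, q ∉ R₂) :
    ExecPost T F A D O R (τ₁ ++ τ₂) (N₁ + N₂) S S₂ where
  inv := h₂.inv
  valW m v hm hO := by
    rcases List.mem_append.1 hm with h | h
    · rw [h₂.valN m (fun h => hO (hO₂ h)) fun v' => hk m v v' h, h₁.valW m v h fun h => hO (hO₁ h)]
    · exact h₂.valW m v h fun h => hO (hO₂ h)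
  valN m hO hm := by
    rw [h₂.valN m (fun h => hO (hO₂ h)) fun v h => hm v (List.mem_append_right _ h),
      h₁.valN m (fun h => hO (hO₁ h)) fun v h => hm v (List.mem_append_left _ h)]
  tab m hO := by rw [h₂.tab m fun h => hO (hO₂ h), h₁.tab m fun h => hO (hO₁ h)]
  own m hO := by
    by_cases h2 : m ∈ O₂
    · exact h₂.own m h2
    · rw [h₂.tab m h2]
      by_cases h1 : m ∈ O₁
      · exact h₁.own m h1
      · rw [h₁.tab m h1]; exact ho m hO
  dels := h₂.dels.trans h₁.dels
  pend := by
    obtain ⟨n₁, e₁, d₁, r₁, l₁⟩ := h₁.pend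
    obtain ⟨n₂, e₂, d₂, r₂, l₂⟩ := h₂.pend
    refine ⟨n₂ ++ n₁, by rw [e₂, e₁, List.append_assoc], ?_, ?_, by rw [List.length_append]; omega⟩
    · rw [List.nodup_append']
      exact ⟨d₂, d₁, fun x hx hx' => hR _ (r₁ x hx') (r₂ x hx)⟩
    · intro x hx
      rcases List.mem_append.1 hx with h | h
      · exact hR₂ (r₂ x h)
      · exact hR₁ (r₁ x h)

theorem ExecPost.mono {τ : List (Modifiable ι × V)} {N N' : ℕ}
    (h : ExecPost T F A D O R τ N S S₁) (hN : N ≤ N') : ExecPost T F A D O R τ N' S S₁ :=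
  { h with pend := let ⟨n, h1, h2, h3, h4⟩ := h.pend; ⟨n, h1, h2, h3, h4.trans hN⟩ }

theorem ExecPre.register {τ : List (Modifiable ι × V)} (h : ExecPre T F A D E O σ τ S)
    (ms : List (Modifiable ι)) (c : Path) : ExecPre T F A D E O σ τ (S.register ms c) :=
  ⟨⟨⟨h.inv.tab.sub, h.inv.tab.size, h.inv.tab.dels⟩, h.inv.mark, h.inv.flag⟩, h.val, h.new, h.own,
    h.safe⟩

theorem ExecPost.register (h : Inv T F A D S) (ms : List (Modifiable ι)) (c : Path) :
    ExecPost T F A D ∅ {c} [] ms.length S (S.register ms c) where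
  inv := ⟨⟨h.tab.sub, h.tab.size, h.tab.dels⟩, h.mark, h.flag⟩
  valW m v hm := by simp at hm
  valN m _ _ := rfl
  tab m _ := rfl
  own m hm := by simp at hm
  dels := rfl
  pend := by
    refine ⟨_, rfl, (List.nodup_dedup ms).map fun x y h => (Prod.mk.inj h).1, ?_, ?_⟩
    · intro x hx
      obtain ⟨m, _, rfl⟩ := List.mem_map.1 hx
      rfl
    · simpa using (List.dedup_sublist ms).length_le

variable [DecidableEq V] [Inhabited V] {Ω : Type*} [MeasurableSpace Ω] {μ : Measure Ω}
  [IsProbabilityMeasure μ] {H : Ω → Hash}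

/-- Re-execution agrees with the execution from scratch. -/
theorem exec_spec (hH : UniformHashing μ H) (L K : ℕ) (hA : SuffixClosed A) {p : Path} {i : ℕ}
    {P : Prog ι V} {b : Body ι V} {τ : List (Modifiable ι × V)} (hev : Eval E σ p i P b τ)
    (hE : Outer E p i) (hf : ∀ m ∈ Own p i, σ m = none) (hK : b.ArityLe K)
    (hpre : ExecPre T F A D E (Own p i) σ τ S) :
    (exec P p i S).body = b ∧
    ExecPost T F A D (Own p i) (SBelow p) τ (K * b.nodes) S (exec P p i S).state ∧
    ∃ w, (exec P p i S).cost.Bounded μ H (TabGood T L) w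
        ((2 * T.height + L + 2 * K + 6) * b.span) ∧
      w + S.marked.card ≤ (5 + 2 * K) * b.work + 5 * changeCost T F τ +
        (exec P p i S).state.marked.card := by
  induction hev generalizing S with
  | done =>
    refine ⟨rfl, ⟨hpre.inv, by simp, fun _ _ _ => rfl, fun _ _ => rfl, hpre.own, rfl,
      [], rfl, by simp, by simp, by simp⟩, 0, (Cost.Bounded.tick 0).mono le_rfl (by omega), ?_⟩
    simp only [exec]
    omega
  | @step E σ p i k b τ _ ih =>
    obtain ⟨h1, h2, w, h3, h4⟩ := ih hE hf hK hpre
    rw [exec]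
    refine ⟨by rw [h1], h2, 1 + w, ((Cost.Bounded.tick 1).add h3).mono le_rfl ?_, ?_⟩
    · simp only [Body.span, Body.tick]
      nlinarith
    · simp only [Body.work, Body.tick] at *
      nlinarith
  | @alloc E σ p i k b τ hk ih =>
    have hown := hpre.own _ (dyn_mem_own p i)
    obtain ⟨h1, h2, w, h3, h4⟩ := ih (S := S.alloc (.dyn p i)) hE.insert
      (fun m hm => hf m (own_succ_subset hm)) hK
      { inv := State.alloc_inv hpre.inv hown
        val := by
          rintro m hm v hv
          have hne : m ≠ .dyn p i := by
            rintro rfl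
            rw [hf _ (dyn_mem_own p i)] at hv
            simp at hv
          rw [State.alloc]
          simp only [Function.update_of_ne hne]
          exact hpre.val m (hm.resolve_left hne) v hv
        new := by
          rintro m v hm hmE
          by_cases hne : m = .dyn p i
          -- A modifiable allocated during the re-execution need not hold its value from the old
          -- run; it is admitted through its empty reader set.
          · right
            simp [State.alloc, hne]
          · simp only [State.alloc, Function.update_of_ne hne]
            exact hpre.new m v hm (hmE.resolve_left hne)
        own := by
          intro m hm
          by_cases hne : m = .dyn p i
          · simp [State.alloc, hne, Table.fresh]
          · simp only [State.alloc, Function.update_of_ne hne]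
            exact hpre.own m (own_succ_subset hm)
        safe := by
          intro m v hm q hq
          by_cases hne : m = .dyn p i
          · simp [State.alloc, hne, Table.fresh] at hq
          · simp only [State.alloc, Function.update_of_ne hne] at hq
            exact hpre.safe m v hm q hq }
    have hne : ∀ {m : Modifiable ι}, m ∉ Own p i → m ≠ .dyn p i := by
      rintro m hm rfl
      exact hm (dyn_mem_own p i)
    rw [exec]
    refine ⟨by rw [h1], ⟨h2.inv, ?_, ?_, ?_, ?_, h2.dels, h2.pend⟩, 1 + w,
      ((Cost.Bounded.tick 1).add h3).mono le_rfl ?_, ?_⟩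
    · exact fun m v hm hO => h2.valW m v hm fun h => hO (own_succ_subset h)
    · intro m hO hm
      refine (h2.valN m (fun h => hO (own_succ_subset h)) hm).trans ?_
      simp only [State.alloc, Function.update_of_ne (hne hO)]
    · intro m hO
      refine (h2.tab m (fun h => hO (own_succ_subset h))).trans ?_
      simp only [State.alloc, Function.update_of_ne (hne hO)]
    · intro m hO
      by_cases hm : m ∈ Own p (i + 1)
      · exact h2.own m hm
      · simp only
        rw [h2.tab m hm]
        by_cases hne : m = .dyn p i
        · simp [State.alloc, hne, Table.fresh]
        · simp only [State.alloc, Function.update_of_ne hne]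
          exact hpre.own m hO
    · simp only [Body.span, Body.tick]
      nlinarith
    · simp only [Body.work, Body.tick, State.alloc] at *
      nlinarith
  | @write E σ p i m v k b τ hmE hmn hk ih =>
    obtain ⟨i1, i2, i3, i4, i5, w', i6, i7⟩ := State.write_spec hH L hpre.inv hA v
      (hpre.new m v List.mem_cons_self hmE) (hpre.safe m v List.mem_cons_self)
    have hmτ : ∀ v', (m, v') ∉ τ := fun v' h => by
      have := hk.store_eq_none h
      simp at this
    have hmO : m ∉ Own p i := hE.not_own hmE
    obtain ⟨h1, h2, w, h3, h4⟩ := ih (S := (S.write m v).1) hE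
      (fun m' hm' => by
        rw [Function.update_of_ne]
        · exact hf m' hm'
        · rintro rfl; exact hmO hm') hK
      { inv := i1
        val := by
          intro m' hm' v' hv'
          rw [i2]
          by_cases hne : m' = m
          · subst hne; simpa using hv'
          · rw [Function.update_of_ne hne] at hv' ⊢
            exact hpre.val m' hm' v' hv'
        new := by
          intro m' v' hm' hE'
          have hne : m' ≠ m := by rintro rfl; exact hmτ v' hm'
          rw [i2, i3, Function.update_of_ne hne]
          exact hpre.new m' v' (List.mem_cons_of_mem _ hm') hE'
        own := by rw [i3]; exact hpre.own
        safe := by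
          rw [i3]
          exact fun m' v' hm' => hpre.safe m' v' (List.mem_cons_of_mem _ hm') }
    rw [exec]
    refine ⟨by rw [h1], ⟨h2.inv, ?_, ?_, ?_, h2.own, h2.dels.trans i5, ?_⟩, w' + w,
      (i6.add h3).mono le_rfl ?_, ?_⟩
    · intro m' v' hm' hO
      rcases List.mem_cons.1 hm' with h | h
      · cases h
        refine (h2.valN m hO hmτ).trans ?_
        rw [i2, Function.update_self]
      · exact h2.valW m' v' h hO
    · intro m' hO hm'
      refine (h2.valN m' hO fun v' h => hm' v' (List.mem_cons_of_mem _ h)).trans ?_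
      rw [i2, Function.update_of_ne]
      rintro rfl
      exact hm' v List.mem_cons_self
    · intro m' hO
      refine (h2.tab m' hO).trans ?_
      rw [i3]
    · obtain ⟨n, e, h⟩ := h2.pend
      exact ⟨n, e.trans (by rw [i4]), h⟩
    · simp only [Body.span, Body.tick]
      nlinarith
    · rw [changeCost_cons]
      simp only [Body.work, Body.tick] at *
      nlinarith
  | @read E σ p i ms f k vs b₁ τ₁ b₂ τ₂ hms hvs h₁ h₂ ih₁ ih₂ =>
    have hvals : S.vals ms = vs := vals_eq hms hvs hpre.val
    have hsplit : Split E σ (Own (false :: p) 0) (Own (true :: p) 0) τ₁ τ₂ :=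
      Split.of_seq hE (by simp)
        (fun m v hm => h₁.mem_outer_or_own hm) (fun m v hm => h₁.store_eq_none hm) h₂
    have hf₁ : ∀ m ∈ Own (false :: p) 0, σ m = none := fun m hm => hf m (own_cons_subset hm)
    have hf₂ : ∀ m ∈ Own (true :: p) 0, σ m = none := fun m hm => hf m (own_cons_subset hm)
    have hK' : ms.length ≤ K ∧ b₁.ArityLe K ∧ b₂.ArityLe K := by
      obtain ⟨⟨h1, h2, h3⟩, -, h4, h5⟩ := hK
      exact ⟨h1, ⟨h2, h3⟩, ⟨h4, h5⟩⟩
    have hpre₁ : ExecPre T F A D E (Own (false :: p) 0) σ τ₁ S :=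
      ⟨hpre.inv, hpre.val, fun m v hm => hpre.new m v (List.mem_append_left _ hm),
        fun m hm => hpre.own m (own_cons_subset hm),
        fun m v hm => hpre.safe m v (List.mem_append_left _ hm)⟩
    have hpre₂ : ExecPre T F A D E (Own (true :: p) 0) σ τ₂ S :=
      ⟨hpre.inv, hpre.val, fun m v hm => hpre.new m v (List.mem_append_right _ hm),
        fun m hm => hpre.own m (own_cons_subset hm),
        fun m v hm => hpre.safe m v (List.mem_append_right _ hm)⟩
    have hreg := ExecPost.register hpre.inv ms (false :: p)
    obtain ⟨a1, a2, w₁, a3, a4⟩ := ih₁ (hE.cons _) hf₁ hK'.2.1 (hpre₁.register ms (false :: p))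
    set o₁ := exec (f vs) (false :: p) 0 (S.register ms (false :: p)) with ho₁
    obtain ⟨c1, c2, w₂, c3, c4⟩ := ih₂ (S := o₁.state) (hE.cons _) (fresh_writes hsplit hf₂)
      hK'.2.2 ((hpre₂.register ms (false :: p)).next hsplit a2 fun m v => writes_eq_some)
    have hpost := (hreg.comp (O := Own p i) (R := Below (false :: p)) a2 hpre.own (by simp)
      (by simp) (fun m => own_cons_subset) (by simp [Below]) (fun q => sBelow_subset)
      (by
        rintro q rfl
        exact not_sBelow_self _)).comp (O := Own p i) (R := SBelow p) c2 hpre.own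
      (by simpa using hsplit.kdisj) subset_rfl (fun m => own_cons_subset)
      (fun q => below_cons_subset) (fun q hq => below_cons_subset (sBelow_subset hq))
      (fun q hq hq' => below_disjoint (by simp) hq (sBelow_subset hq'))
    rw [exec]
    simp only [hvals]
    rw [← ho₁]
    refine ⟨by rw [a1, c1], ?_, _, (((Cost.Bounded.tick (2 + 2 * ms.length)).add a3).add c3).mono
      le_rfl ?_, ?_⟩
    · refine ExecPost.mono (by simpa using hpost) ?_
      rw [Body.read_nodes]
      nlinarith [hK'.1]
    · rw [Body.read_span]
      nlinarith [hK'.1]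
    · rw [changeCost_append, Body.read_work]
      simp only [State.register] at a4
      have := hK'.1
      nlinarith
  | @par E σ p i a b k ba τa bb τb bk τk ha hb hd hk iha ihb ihk =>
    have hsp₁ := Split.of_par (hE.cons false) ha hb hd
    have hkeys : ∀ m v, (m, v) ∈ τa ++ τb → m ∈ E ∨ m ∈ Own (false :: p) 0 := by
      intro m v hm
      rcases List.mem_append.1 hm with h | h
      · exact (ha.mem_outer_or_own h).imp_right own_cons_subset
      · exact (hb.mem_outer_or_own h).imp_right own_cons_subset
    have hnone : ∀ m v, (m, v) ∈ τa ++ τb → σ m = none := by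
      intro m v hm
      rcases List.mem_append.1 hm with h | h
      · exact ha.store_eq_none h
      · exact hb.store_eq_none h
    have hsp₂ : Split E σ (Own (false :: p) 0) (Own (true :: p) 0) (τa ++ τb) τk :=
      Split.of_seq hE (by simp) hkeys hnone hk
    have hfa : ∀ m ∈ Own (false :: false :: p) 0, σ m = none := fun m hm =>
      hf m (own_cons_subset (own_cons_subset (i := 0) hm))
    have hfb : ∀ m ∈ Own (true :: false :: p) 0, σ m = none := fun m hm =>
      hf m (own_cons_subset (own_cons_subset (i := 0) hm))
    have hfk : ∀ m ∈ Own (true :: p) 0, σ m = none := fun m hm => hf m (own_cons_subset hm)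
    have hK' : ba.ArityLe K ∧ bb.ArityLe K ∧ bk.ArityLe K := by
      obtain ⟨⟨-, ⟨-, h1, h2⟩, ⟨-, h3, h4⟩⟩, -, h5, h6⟩ := hK
      exact ⟨⟨h1, h2⟩, ⟨h3, h4⟩, ⟨h5, h6⟩⟩
    have hprea : ExecPre T F A D E (Own (false :: false :: p) 0) σ τa S :=
      ⟨hpre.inv, hpre.val, fun m v hm => hpre.new m v (by simp [hm]),
        fun m hm => hpre.own m (own_cons_subset (own_cons_subset (i := 0) hm)),
        fun m v hm => hpre.safe m v (by simp [hm])⟩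
    have hpreb : ExecPre T F A D E (Own (true :: false :: p) 0) σ τb S :=
      ⟨hpre.inv, hpre.val, fun m v hm => hpre.new m v (by simp [hm]),
        fun m hm => hpre.own m (own_cons_subset (own_cons_subset (i := 0) hm)),
        fun m v hm => hpre.safe m v (by simp [hm])⟩
    have hprek : ExecPre T F A D E (Own (true :: p) 0) σ τk S :=
      ⟨hpre.inv, hpre.val, fun m v hm => hpre.new m v (by simp [hm]),
        fun m hm => hpre.own m (own_cons_subset hm),
        fun m v hm => hpre.safe m v (by simp [hm])⟩
    obtain ⟨a1, a2, wa, a3, a4⟩ := iha ((hE.cons _).cons _) hfa hK'.1 hprea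
    set oa := exec a (false :: false :: p) 0 S with hoa
    obtain ⟨b1, b2, wb, b3, b4⟩ := ihb (S := oa.state) ((hE.cons _).cons _) hfb hK'.2.1
      (hpreb.next hsp₁ a2 fun m v h => .inl h)
    set ob := exec b (true :: false :: p) 0 oa.state with hob
    have hab := a2.comp (O := Own (false :: p) 0) (R := Below (false :: p)) b2
      (fun m hm => hpre.own m (own_cons_subset hm)) hsp₁.kdisj (fun m => own_cons_subset)
      (fun m => own_cons_subset) (fun q hq => (below_cons_subset (sBelow_subset hq)).1)
      (fun q hq => (below_cons_subset (sBelow_subset hq)).1)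
      (fun q hq hq' => below_disjoint (by simp) (sBelow_subset hq) (sBelow_subset hq'))
    obtain ⟨k1, k2, wk, k3, k4⟩ := ihk (S := ob.state) (hE.cons _) (fresh_writes hsp₂ hfk) hK'.2.2
      (hprek.next hsp₂ hab fun m v => writes_eq_some)
    have hpost := hab.comp (O := Own p i) (R := SBelow p) k2 hpre.own hsp₂.kdisj
      (fun m => own_cons_subset) (fun m => own_cons_subset) (fun q => below_cons_subset)
      (fun q hq => below_cons_subset (sBelow_subset hq))
      (fun q hq hq' => below_disjoint (by simp) hq (sBelow_subset hq'))
    rw [exec]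
    simp only
    rw [← hoa, ← hob]
    -- Four units for the fork and one inside `Cost.par` make the 5 in the cost per unit of work.
    refine ⟨by rw [a1, b1, k1], hpost.mono ?_, _, (((Cost.Bounded.tick 4).add
      (a3.par b3)).add k3).mono le_rfl ?_, ?_⟩
    · rw [Body.par_nodes]
      nlinarith
    · rw [Body.par_span, Nat.mul_max_mul_left]
      nlinarith
    · rw [changeCost_append, changeCost_append, Body.par_work]
      nlinarith

end Exec

end

section

variable {ι V : Type*} [DecidableEq ι]

/-! ### Destruction -/

/-- The nodes in `R` have been removed from the reader sets and are not marked any more. -/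
structure DestroyPost (T : Tree ι V) (O : Set (Modifiable ι)) (R : Set Path) (n N : ℕ)
    (S S' : State ι V) : Prop where
  tab : TabOK T S'
  marked : ∀ q, q ∈ S'.marked ↔ q ∈ S.marked ∧ q ∉ R
  affected : ∀ q, q ∈ S'.affected ↔ q ∈ S.affected ∧ q ∉ R
  val : ∀ m, m ∉ O → S'.val m = S.val m
  elems : ∀ m q, q ∈ (S'.tab m).elems → q ∈ (S.tab m).elems ∧ q ∉ R
  keep : ∀ m, m ∉ O → ∀ q, q ∉ R → q ∈ (S.tab m).elems → q ∈ (S'.tab m).elems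
  pend : S'.pend = S.pend
  dels : S'.dels.length ≤ S.dels.length + N
  card : S.marked.card ≤ S'.marked.card + n

section Destroy

variable {T : Tree ι V} {S S₁ S₂ : State ι V} {O O₁ O₂ : Set (Modifiable ι)} {R R₁ R₂ : Set Path}
  {n n₁ n₂ N N₁ N₂ : ℕ}

theorem DestroyPost.comp (h₁ : DestroyPost T O₁ R₁ n₁ N₁ S S₁) (h₂ : DestroyPost T O₂ R₂ n₂ N₂ S₁ S₂)
    (hO₁ : O₁ ⊆ O) (hO₂ : O₂ ⊆ O) (hR : ∀ q, q ∈ R ↔ q ∈ R₁ ∨ q ∈ R₂)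
    (hn : n₁ + n₂ ≤ n) (hN : N₁ + N₂ ≤ N) : DestroyPost T O R n N S S₂ where
  tab := h₂.tab
  marked q := by rw [h₂.marked, h₁.marked, hR]; tauto
  affected q := by rw [h₂.affected, h₁.affected, hR]; tauto
  val m hm := by rw [h₂.val m fun h => hm (hO₂ h), h₁.val m fun h => hm (hO₁ h)]
  elems m q hq := by
    obtain ⟨h1, h2⟩ := h₂.elems m q hq
    obtain ⟨h3, h4⟩ := h₁.elems m q h1
    exact ⟨h3, by rw [hR]; tauto⟩
  keep m hm q hq h := by
    rw [hR] at hq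
    exact h₂.keep m (fun h => hm (hO₂ h)) q (fun h => hq (.inr h))
      (h₁.keep m (fun h => hm (hO₁ h)) q (fun h => hq (.inl h)) h)
  pend := h₂.pend.trans h₁.pend
  dels := by have := h₁.dels; have := h₂.dels; omega
  card := by have := h₁.card; have := h₂.card; omega

/-- No node is removed here, hence the empty region and the zeros; only values and tables of the
scope's own modifiables are reset. -/
theorem State.dealloc_spec (h : TabOK T S) (p : Path) (a : ℕ) :
    DestroyPost T (Own p 0) ∅ 0 0 S (S.dealloc p a) := by
  have htab : ∀ m, (S.dealloc p a).tab m = S.tab m ∨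
      (m ∈ Own p 0 ∧ (S.dealloc p a).tab m = Table.fresh []) := by
    intro m
    cases m with
    | static i => left; simp [State.dealloc]
    | dyn q i =>
      by_cases hq : q = p ∧ i < a
      · right
        exact ⟨⟨q, i, rfl, by rw [hq.1], fun _ => Nat.zero_le _⟩, by simp [State.dealloc, hq]⟩
      · left; simp [State.dealloc, hq]
  refine ⟨⟨fun m => ?_, fun m => ?_, fun m => ?_⟩, by simp [State.dealloc], by simp [State.dealloc],
    fun m hm => ?_, fun m q hq => ?_, fun m hm q _ hq => ?_, rfl, le_rfl, le_rfl⟩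
  · rcases htab m with h1 | ⟨-, h1⟩
    · rw [h1]; exact h.sub m
    · rw [h1]; exact List.nil_sublist _
  · rcases htab m with h1 | ⟨-, h1⟩
    · rw [h1]; exact h.size m
    · rw [h1]; exact .inr ⟨rfl, rfl⟩
  · rcases htab m with h1 | ⟨-, h1⟩
    · rw [h1]; exact h.dels m
    · rw [h1]; simp [Table.fresh]
  · cases m with
    | static i => simp [State.dealloc]
    | dyn q i =>
      have : ¬ (q = p ∧ i < a) := by
        rintro ⟨rfl, -⟩
        exact hm ⟨q, i, rfl, List.suffix_rfl, fun _ => Nat.zero_le _⟩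
      simp [State.dealloc, this]
  · rcases htab m with h1 | ⟨-, h1⟩
    · rw [h1] at hq; exact ⟨hq, by simp⟩
    · rw [h1] at hq; simp [Table.fresh] at hq
  · rcases htab m with h1 | ⟨h2, -⟩
    · rw [h1]; exact hq
    · exact absurd h2 hm

variable {Ω : Type*} [MeasurableSpace Ω] {μ : Measure Ω} [IsProbabilityMeasure μ] {H : Ω → Hash}

theorem State.unregister_spec (hH : UniformHashing μ H) (L : ℕ) (h : TabOK T S) (p : Path)
    (ms : List (Modifiable ι)) :
    TabOK T (S.unregister p ms).1 ∧ (S.unregister p ms).1.val = S.val ∧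
    (S.unregister p ms).1.marked = S.marked ∧ (S.unregister p ms).1.affected = S.affected ∧
    (S.unregister p ms).1.pend = S.pend ∧
    (S.unregister p ms).1.dels.length = S.dels.length + ms.length ∧
    (∀ m q, q ∈ ((S.unregister p ms).1.tab m).elems ↔ q ∈ (S.tab m).elems ∧ (q ≠ p ∨ m ∉ ms)) ∧
    (S.unregister p ms).2.Bounded μ H (TabGood T L) (4 * ms.length) (ms.length * (1 + L)) := by
  induction ms generalizing S with
  | nil =>
    refine ⟨h, rfl, rfl, rfl, rfl, rfl, by simp [State.unregister],
      (Cost.Bounded.tick 0).mono le_rfl (by omega)⟩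
  | cons m ms ih =>
    set S₁ : State ι V := { S with
        tab := Function.update S.tab m ⟨(S.tab m).size, (S.tab m).elems.erase p⟩
        dels := m :: S.dels } with hS₁
    have htab : ∀ m', S₁.tab m' =
        if m' = m then ⟨(S.tab m).size, (S.tab m).elems.erase p⟩ else S.tab m' := by
      intro m'
      simp only [hS₁, Function.update_apply]
    have h₁ : TabOK T S₁ := by
      refine ⟨fun m' => ?_, fun m' => ?_, fun m' => ?_⟩
      · rw [htab]
        split_ifs with hm
        · subst hm; exact List.erase_sublist.trans (h.sub m')
        · exact h.sub m'
      · rw [htab]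
        split_ifs with hm
        · subst hm
          exact (h.size m').imp_right fun ⟨h1, h2⟩ => ⟨h1, by simp [h2]⟩
        · exact h.size m'
      · rw [htab]
        split_ifs with hm
        · subst hm
          have h1 := h.dels m'
          have h2 : (S.tab m').elems.length - 1 ≤ ((S.tab m').elems.erase p).length := by
            rw [List.length_erase]; split_ifs <;> omega
          simp only [hS₁, List.count_cons_self]
          omega
        · have h1 := h.dels m'
          have : S₁.dels.count m' = S.dels.count m' := by
            simp only [hS₁]
            exact List.count_cons_of_ne (Ne.symm hm)
          rw [this]
          exact h1
    obtain ⟨i1, i2, i3, i4, i5, i6, i7, i8⟩ := ih h₁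
    rw [State.unregister]
    refine ⟨i1, i2, i3, i4, i5, ?_, fun m' q => ?_, ?_⟩
    · simp only [List.length_cons]
      rw [i6]
      simp only [hS₁, List.length_cons]
      omega
    · refine (i7 m' q).trans ?_
      rw [htab, List.mem_cons]
      split_ifs with hm
      · subst hm
        simp only [(h.nodup m').mem_erase_iff]
        tauto
      · tauto
    · refine ((hH.probe_bounded (L := L) (h.one_le m) (h.nodup m) ?_ p ?_).add i8).mono ?_ ?_
      · have := h.length_le m; omega
      · exact fun g hg b => h.load_le hg m b
      · simp only [List.length_cons]; omega
      · simp only [List.length_cons]; rw [add_mul]; omega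

theorem Tree.pos_below {t : Tree ι V} {p q : Path} (h : t.Pos p q) : q ∈ Below p := by
  induction t generalizing p with
  | nil => exact absurd h (by simp [Tree.Pos])
  | node lab s a l r ihl ihr =>
    rcases h with rfl | h | h
    · exact List.suffix_rfl
    · exact (below_cons_subset (ihl h)).1
    · exact (below_cons_subset (ihr h)).1

/-- The hypotheses say that every reader registered in the region and every mark or flag there
belongs to a node of t, so walking through t empties the region. Per node, 4K pays for the expected
deletions and 2 for the visit and the fork; deallocations are covered by the work of the old
computation. -/
theorem Tree.destroy_spec (hH : UniformHashing μ H) (L K : ℕ) (t : Tree ι V) (p : Path)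
    (h : TabOK T S)
    (hR : ∀ q ∈ Below p, ∀ m, q ∈ (S.tab m).elems → q ∈ t.readers m p)
    (hM : ∀ q ∈ Below p, q ∈ S.marked ∨ q ∈ S.affected → t.Pos p q)
    (hK : t.ArityLe K) (ha : t.AllocsLe) :
    DestroyPost T (Own p 0) (Below p) t.nodes (K * t.nodes) S (t.destroy p S).1 ∧
    (t.destroy p S).2.Bounded μ H (TabGood T L) ((4 * K + 2) * t.nodes + t.work)
      (t.parSpan (K * (1 + L) + 2)) := by
  induction t generalizing p S with
  | nil =>
    refine ⟨⟨h, fun q => ?_, fun q => ?_, fun _ _ => rfl, fun m q hq => ?_,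
      fun _ _ _ _ hq => hq, rfl, by simp [Tree.destroy], by simp [Tree.destroy]⟩, ?_⟩
    · exact ⟨fun hq => ⟨hq, fun hp => hM q hp (.inl hq)⟩, fun hq => hq.1⟩
    · exact ⟨fun hq => ⟨hq, fun hp => hM q hp (.inr hq)⟩, fun hq => hq.1⟩
    · exact ⟨hq, fun hp => by simpa [Tree.readers] using hR q hp m hq⟩
    · exact (Cost.Bounded.tick 0).mono (by omega) (by omega)
  | node lab s a l r ihl ihr =>
    obtain ⟨u1, u2, u3, u4, u5, u6, u7, u8⟩ := State.unregister_spec hH L h p lab.mods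
    set U := (S.unregister p lab.mods).1 with hU
    have hd := State.dealloc_spec u1 p a
    set S₀ := (U.dealloc p a).clear p with hS₀
    have h₀ : DestroyPost T (Own p 0) {p} 1 K S S₀ := by
      refine ⟨⟨hd.tab.sub, hd.tab.size, hd.tab.dels⟩, fun q => ?_, fun q => ?_, fun m hm => ?_,
        fun m q hq => ?_, fun m hm q hq hq' => ?_, ?_, ?_, ?_⟩
      · simp only [hS₀, State.clear, Finset.mem_erase, Set.mem_singleton_iff]
        rw [hd.marked, u3]
        simp [and_comm]
      · simp only [hS₀, State.clear, Finset.mem_erase, Set.mem_singleton_iff]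
        rw [hd.affected, u4]
        simp [and_comm]
      · refine (hd.val m hm).trans ?_
        rw [u2]
      · obtain ⟨h1, h2⟩ := hd.elems m q hq
        obtain ⟨h3, h4⟩ := (u7 m q).1 h1
        refine ⟨h3, ?_⟩
        rintro rfl
        have h5 := hR q List.suffix_rfl m h3
        rcases Tree.mem_readers_node.1 h5 with ⟨h6, -⟩ | h6 | h6
        · rcases h4 with h4 | h4
          · exact h4 rfl
          · exact h4 h6
        · exact not_below_cons _ _ (Tree.readers_below h6)
        · exact not_below_cons _ _ (Tree.readers_below h6)
      · exact hd.keep m hm q (by simp) ((u7 m q).2 ⟨hq', .inl hq⟩)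
      · exact hd.pend.trans u5
      · have h1 := hd.dels
        have h2 := hK.1
        simp only [hS₀, State.clear]
        omega
      · have h1 := hd.card
        rw [u3] at h1
        have h2 := Finset.card_le_card_sdiff_add_card (s := {p}) (t := (U.dealloc p a).marked)
        have h3 := Finset.pred_card_le_card_erase (s := (U.dealloc p a).marked) (a := p)
        simp only [hS₀, State.clear]
        omega
    have hcase : ∀ {d : Bool} {q : Path}, q ∈ Below (d :: p) →
        (Tree.node lab s a l r).Pos p q → if d then r.Pos (true :: p) q else l.Pos (false :: p) q := by
      rintro d q hq (rfl | h | h)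
      · exact absurd hq (not_below_cons _ _)
      · cases d
        · exact h
        · exact absurd (Tree.pos_below h) (below_disjoint (by simp) hq)
      · cases d
        · exact absurd (Tree.pos_below h) (below_disjoint (by simp) hq)
        · exact h
    have hcase' : ∀ {d : Bool} {q : Path} {m : Modifiable ι}, q ∈ Below (d :: p) →
        q ∈ (Tree.node lab s a l r).readers m p →
        if d then q ∈ r.readers m (true :: p) else q ∈ l.readers m (false :: p) := by
      intro d q m hq h
      rcases Tree.mem_readers_node.1 h with ⟨-, rfl⟩ | h | h
      · exact absurd hq (not_below_cons _ _)
      · cases d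
        · exact h
        · exact absurd (Tree.readers_below h) (below_disjoint (by simp) hq)
      · cases d
        · exact absurd (Tree.readers_below h) (below_disjoint (by simp) hq)
        · exact h
    obtain ⟨l1, l2⟩ := ihl (S := S₀) (false :: p) h₀.tab
      (fun q hq m hm => by
        simpa using hcase' hq (hR q (below_cons_subset hq).1 m (h₀.elems m q hm).1))
      (fun q hq hm => by
        rw [h₀.marked, h₀.affected] at hm
        simpa using hcase hq (hM q (below_cons_subset hq).1 (by tauto)))
      hK.2.1 ha.2.1
    have h₁ := h₀.comp (O := Own p 0) (R := {p} ∪ Below (false :: p)) (n := 1 + l.nodes)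
      (N := K + K * l.nodes) l1 subset_rfl (fun m => own_cons_subset) (fun q => Iff.rfl) le_rfl le_rfl
    obtain ⟨r1, r2⟩ := ihr (S := (l.destroy (false :: p) S₀).1) (true :: p) h₁.tab
      (fun q hq m hm => by
        simpa using hcase' hq (hR q (below_cons_subset hq).1 m (h₁.elems m q hm).1))
      (fun q hq hm => by
        rw [h₁.marked, h₁.affected] at hm
        simpa using hcase hq (hM q (below_cons_subset hq).1 (by tauto)))
      hK.2.2 ha.2.2
    rw [Tree.destroy]
    refine ⟨h₁.comp r1 subset_rfl (fun m => own_cons_subset) (fun q => ?_) ?_ ?_,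
      (((Cost.Bounded.tick (1 + a)).add u8).add (l2.par r2)).mono ?_ ?_⟩
    · rw [mem_below_iff, mem_sBelow_iff, ← or_assoc]
      rfl
    · simp only [Tree.nodes]; omega
    · simp only [Tree.nodes]; nlinarith
    · have h1 := hK.1
      have h2 := ha.1
      simp only [Tree.nodes, Tree.work]
      nlinarith
    · have h1 := Nat.mul_le_mul_right (1 + L) hK.1
      have h2 := ha.1
      simp only [Tree.parSpan]
      omega

end Destroy

end

section

variable {ι V : Type*} [DecidableEq V]

/-! ### Differences between two trees -/

namespace Tree

/-- The number of nodes in the subtrees of the affected reads. -/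
def affectedNodes : Tree ι V → Tree ι V → ℕ
  | node (.R ms f vs) s a l r, node (.R ms' f' vs') s' a' l' r' =>
      if vs ≠ vs' then
        (node (.R ms f vs) s a l r).nodes + (node (.R ms' f' vs') s' a' l' r').nodes
      else affectedNodes l l' + affectedNodes r r'
  | node _ _ _ l r, node _ _ _ l' r' => affectedNodes l l' + affectedNodes r r'
  | _, _ => 0

/-- The number of nodes at or above affected reads. -/
def spine : Tree ι V → Tree ι V → ℕ
  | node (.R _ _ vs) _ _ l r, node (.R _ _ vs') _ _ l' r' =>
      if vs ≠ vs' then 1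
      else (spine l l' + spine r r') + min 1 (spine l l' + spine r r')
  | node .S _ _ l r, node .S _ _ l' r' =>
      (spine l l' + spine r r') + min 1 (spine l l' + spine r r')
  | node .P _ _ l r, node .P _ _ l' r' =>
      (spine l l' + spine r r') + min 1 (spine l l' + spine r r')
  | _, _ => 0

/-- The budget of a visit: the distance pays for re-execution and deallocation, the affected nodes
for destruction, and the spine for the nodes that are merely traversed. -/
def gap (t t' : Tree ι V) : ℕ := dist t t' + affectedNodes t t' + spine t t'

end Tree

namespace Body

def affectedNodes (b b' : Body ι V) : ℕ := b.l.affectedNodes b'.l + b.r.affectedNodes b'.r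

def spine (b b' : Body ι V) : ℕ := b.l.spine b'.l + b.r.spine b'.r

def gap (b b' : Body ι V) : ℕ := b.l.gap b'.l + b.r.gap b'.r

theorem affectedNodes_S (b b' : Body ι V) :
    (b.node .S).affectedNodes (b'.node .S) = b.affectedNodes b' := by
  simp [node, Tree.affectedNodes, affectedNodes]

theorem spine_S (b b' : Body ι V) :
    (b.node .S).spine (b'.node .S) = b.spine b' + min 1 (b.spine b') := by
  simp [node, Tree.spine, spine]

theorem dist_S (b b' : Body ι V) :
    (b.node .S).dist (b'.node .S) = b.l.dist b'.l + b.r.dist b'.r := by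
  simp [node, Tree.dist]

theorem gap_S (b b' : Body ι V) :
    (b.node .S).gap (b'.node .S) = b.gap b' + min 1 (b.spine b') := by
  rw [Tree.gap, affectedNodes_S, spine_S, dist_S, affectedNodes, spine, gap, Tree.gap, Tree.gap]
  omega

variable {ms : List (Modifiable ι)} {f : List V → Prog ι V} {vs vs' : List V}

theorem affectedNodes_R (b b' : Body ι V) (h : vs = vs') :
    (b.node (.R ms f vs)).affectedNodes (b'.node (.R ms f vs')) = b.affectedNodes b' := by
  simp [node, Tree.affectedNodes, affectedNodes, h]

theorem spine_R (b b' : Body ι V) (h : vs = vs') :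
    (b.node (.R ms f vs)).spine (b'.node (.R ms f vs')) = b.spine b' + min 1 (b.spine b') := by
  simp [node, Tree.spine, spine, h]

theorem dist_R (b b' : Body ι V) (h : vs = vs') :
    (b.node (.R ms f vs)).dist (b'.node (.R ms f vs')) = b.l.dist b'.l + b.r.dist b'.r := by
  simp [node, Tree.dist, h]

theorem gap_R (b b' : Body ι V) (h : vs = vs') :
    (b.node (.R ms f vs)).gap (b'.node (.R ms f vs')) = b.gap b' + min 1 (b.spine b') := by
  rw [Tree.gap, affectedNodes_R b b' h, spine_R b b' h, dist_R b b' h, affectedNodes, spine, gap,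
    Tree.gap, Tree.gap]
  omega

theorem affectedNodes_R_ne (b b' : Body ι V) (h : vs ≠ vs') :
    (b.node (.R ms f vs)).affectedNodes (b'.node (.R ms f vs')) =
      (1 + b.nodes) + (1 + b'.nodes) := by
  rw [← node_nodes (.R ms f vs) b, ← node_nodes (.R ms f vs') b']
  simp [node, Tree.affectedNodes, h]

theorem spine_R_ne (b b' : Body ι V) (h : vs ≠ vs') :
    (b.node (.R ms f vs)).spine (b'.node (.R ms f vs')) = 1 := by
  simp [node, Tree.spine, h]

theorem dist_R_ne (b b' : Body ι V) (h : vs ≠ vs') :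
    (b.node (.R ms f vs)).dist (b'.node (.R ms f vs')) = b.work + b'.work := by
  rw [← node_work (.R ms f vs) b, ← node_work (.R ms f vs') b']
  simp [node, Tree.dist, h]

theorem gap_R_ne (b b' : Body ι V) (h : vs ≠ vs') :
    (b.node (.R ms f vs)).gap (b'.node (.R ms f vs')) =
      b.work + b'.work + ((1 + b.nodes) + (1 + b'.nodes)) + 1 := by
  rw [Tree.gap, affectedNodes_R_ne b b' h, spine_R_ne b b' h, dist_R_ne b b' h]

end Body

namespace Tree

theorem affectedNodes_P (s a s' a' : ℕ) (l r l' r' : Tree ι V) :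
    (node .P s a l r).affectedNodes (node .P s' a' l' r') =
      l.affectedNodes l' + r.affectedNodes r' := by
  simp [affectedNodes]

theorem dist_P (s a s' a' : ℕ) (l r l' r' : Tree ι V) :
    (node .P s a l r).dist (node .P s' a' l' r') = l.dist l' + r.dist r' := by
  simp [dist]

theorem spine_P (s a s' a' : ℕ) (l r l' r' : Tree ι V) :
    (node .P s a l r).spine (node .P s' a' l' r') =
      (l.spine l' + r.spine r') + min 1 (l.spine l' + r.spine r') := by
  simp [spine]

theorem gap_P (s a s' a' : ℕ) (l r l' r' : Tree ι V) :
    (node .P s a l r).gap (node .P s' a' l' r') =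
      (l.gap l' + r.gap r') + min 1 (l.spine l' + r.spine r') := by
  rw [gap, affectedNodes_P, dist_P, spine_P, gap, gap]
  omega

end Tree

variable [DecidableEq ι]

/-! ### Traversal of a region -/

/-- What holds before the nodes in the region `R` are visited. In the new run, this part of the
computation starts in the store `σ` and performs the writes `τ`; `O` contains the modifiables
that are allocated in the region, and `rd` tells which modifiables are read by its nodes. -/
structure PropPre (T : Tree ι V) (F : Modifiable ι → Option V) (A D : Set Path)
    (E O : Set (Modifiable ι)) (R : Set Path) (σ : Modifiable ι → Option V)
    (τ : List (Modifiable ι × V)) (rd : Modifiable ι → Path → Prop) (S : State ι V) : Prop where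
  inv : Inv T F A D S
  val : ∀ m ∈ E, ∀ v, σ m = some v → S.val m = some v
  new : ∀ m v, (m, v) ∈ τ → m ∈ E → S.val m = F m
  own : ∀ m ∈ O, S.val m = F m
  readers : ∀ q ∈ R, ∀ m, q ∈ (S.tab m).elems ↔ rd m q
  fresh : ∀ q ∈ R, q ∉ D
  safe : ∀ m v, (m, v) ∈ τ → ∀ q ∈ (S.tab m).elems, q ∉ D
  out : ∀ q ∈ R, q ∉ A

/-- What holds after the nodes in the region `R` have been visited. -/
structure PropPost (T : Tree ι V) (F : Modifiable ι → Option V) (A D : Set Path)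
    (O : Set (Modifiable ι)) (R : Set Path) (σ : Modifiable ι → Option V)
    (τ : List (Modifiable ι × V)) (N : ℕ) (S S' : State ι V) : Prop where
  inv : Inv T F A (D ∪ R) S'
  valW : ∀ m v, (m, v) ∈ τ → m ∉ O → S'.val m = some v
  valN : ∀ m, m ∉ O → (∀ v, (m, v) ∉ τ) → S'.val m = S.val m
  tabOut : ∀ m, m ∉ O → ∀ q, q ∉ R → (q ∈ (S'.tab m).elems ↔ q ∈ (S.tab m).elems)
  tabSub : ∀ m, m ∉ O → ∀ q, q ∈ (S'.tab m).elems → q ∈ (S.tab m).elems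
  rem : ∀ m, m ∉ O → ∀ q ∈ R, q ∈ (S'.tab m).elems → σ m ≠ none ∨ ∃ v, (m, v) ∈ τ
  pend : ∃ new, S'.pend = new ++ S.pend ∧ new.Nodup ∧
    ∀ x ∈ new, x.2 ∈ R ∧ ∀ m, x.2 ∉ (S'.tab m).elems
  count : S'.pend.length + S'.dels.length ≤ S.pend.length + S.dels.length + N

section Compose

variable {T : Tree ι V} {F : Modifiable ι → Option V} {A D : Set Path} {S S₁ S₂ : State ι V}
  {E O O' O₁ O₂ : Set (Modifiable ι)} {R R' R₁ R₂ : Set Path} {σ σ₂ : Modifiable ι → Option V}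
  {τ τ' τ₁ τ₂ : List (Modifiable ι × V)} {N N₁ N₂ : ℕ} {rd rd' rd₁ rd₂ : Modifiable ι → Path → Prop}

theorem PropPre.restrict (h : PropPre T F A D E O R σ τ rd S) (hO : O' ⊆ O) (hR : R' ⊆ R)
    (hτ : τ' ⊆ τ) (hrd : ∀ q ∈ R', ∀ m, rd m q ↔ rd' m q) : PropPre T F A D E O' R' σ τ' rd' S where
  inv := h.inv
  val := h.val
  new m v hm := h.new m v (hτ hm)
  own m hm := h.own m (hO hm)
  readers q hq m := (h.readers q (hR hq) m).trans (hrd q hq m)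
  fresh q hq := h.fresh q (hR hq)
  safe m v hm := h.safe m v (hτ hm)
  out q hq := h.out q (hR hq)

/-- The point is `safe`. By `rem`, a node of R₁ that is still registered after its visit with a
modifiable outside O₁ reads something written by then. The second computation writes only what is
unwritten, so its writes never reach visited nodes. Modifiables in O₁ are read inside R₁ only and do
not matter for R₂. -/
theorem PropPre.next (hs : Split E σ O₁ O₂ τ₁ τ₂) (h₂ : PropPre T F A D E O₂ R₂ σ τ₂ rd₂ S)
    (h : PropPost T F A D O₁ R₁ σ τ₁ N S S₁)
    (hσ : ∀ m v, σ₂ m = some v → σ m = some v ∨ (m, v) ∈ τ₁)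
    (hO : ∀ m ∈ O₁, ∀ q ∈ T.readers m [], q ∈ R₁) (hR : ∀ q ∈ R₁, q ∉ R₂) :
    PropPre T F A (D ∪ R₁) E O₂ R₂ σ₂ τ₂ rd₂ S₁ where
  inv := h.inv
  val m hm v hv := by
    rcases hσ m v hv with h1 | h1
    · rw [h.valN m (hs.out₁ m hm), h₂.val m hm v h1]
      intro v' hv'
      simp [hs.none₁ m v' hv'] at h1
    · exact h.valW m v h1 (hs.out₁ m hm)
  new m v hm hE := by
    rw [h.valN m (hs.out₁ m hE) fun v' h1 => hs.kdisj m v' v h1 hm]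
    exact h₂.new m v hm hE
  own m hm := by
    rw [h.valN m (fun h1 => hs.disj m h1 hm) (hs.notMem₁ hm)]
    exact h₂.own m hm
  readers q hq m := by
    rw [← h₂.readers q hq m]
    by_cases hm : m ∈ O₁
    · have hn : q ∉ T.readers m [] := fun h1 => hR q (hO m hm q h1) hq
      exact ⟨fun h1 => absurd ((h.inv.tab.sub m).subset h1) hn,
        fun h1 => absurd ((h₂.inv.tab.sub m).subset h1) hn⟩
    · exact h.tabOut m hm q fun h1 => hR q h1 hq
  fresh q hq := by
    rintro (h1 | h1)
    · exact h₂.fresh q hq h1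
    · exact hR q h1 hq
  safe m v hm q hq := by
    have hmO := hs.notMem_own hm
    rintro (h1 | h1)
    · exact h₂.safe m v hm q (h.tabSub m hmO q hq) h1
    -- A visited reader of m would have read m before this write, which validity of the new run
    -- excludes.
    · rcases h.rem m hmO q h1 hq with h2 | ⟨v', h2⟩
      · exact h2 (hs.none₂ m v hm)
      · exact hs.kdisj m v' v h2 hm
  out := h₂.out

/-- The queued readers of R₁ remain absent from the reader sets: the second part only deletes from
the sets of modifiables outside O₂, and those of modifiables in O₂ contain nodes of R₂ only. -/
theorem PropPost.comp (hs : Split E σ O₁ O₂ τ₁ τ₂) (h₁ : PropPost T F A D O₁ R₁ σ τ₁ N₁ S S₁)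
    (h₂ : PropPost T F A (D ∪ R₁) O₂ R₂ σ₂ τ₂ N₂ S₁ S₂)
    (hσ : ∀ m v, σ₂ m = some v → σ m = some v ∨ (m, v) ∈ τ₁)
    (hO : ∀ m ∈ O₂, ∀ q ∈ T.readers m [], q ∈ R₂) (hRd : ∀ q ∈ R₁, q ∉ R₂)
    (hO₁ : O₁ ⊆ O) (hO₂ : O₂ ⊆ O) (hR : ∀ q, q ∈ R ↔ q ∈ R₁ ∨ q ∈ R₂)
    (hτ : ∀ x, x ∈ τ ↔ x ∈ τ₁ ∨ x ∈ τ₂) :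
    PropPost T F A D O R σ τ (N₁ + N₂) S S₂ where
  inv := by
    have : D ∪ R = D ∪ R₁ ∪ R₂ := by
      ext q
      simp only [Set.mem_union, hR, or_assoc]
    rw [this]
    exact h₂.inv
  valW m v hm hmO := by
    rcases (hτ _).1 hm with h | h
    · rw [h₂.valN m (fun h => hmO (hO₂ h)) fun v' => hs.kdisj m v v' h,
        h₁.valW m v h fun h => hmO (hO₁ h)]
    · exact h₂.valW m v h fun h => hmO (hO₂ h)
  valN m hmO hm := by
    rw [h₂.valN m (fun h => hmO (hO₂ h)) fun v h => hm v ((hτ _).2 (.inr h)),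
      h₁.valN m (fun h => hmO (hO₁ h)) fun v h => hm v ((hτ _).2 (.inl h))]
  tabOut m hmO q hq := by
    rw [hR] at hq
    rw [h₂.tabOut m (fun h => hmO (hO₂ h)) q fun h => hq (.inr h),
      h₁.tabOut m (fun h => hmO (hO₁ h)) q fun h => hq (.inl h)]
  tabSub m hmO q hq :=
    h₁.tabSub m (fun h => hmO (hO₁ h)) q (h₂.tabSub m (fun h => hmO (hO₂ h)) q hq)
  rem m hmO q hq hq' := by
    have hmO₁ : m ∉ O₁ := fun h => hmO (hO₁ h)
    have hmO₂ : m ∉ O₂ := fun h => hmO (hO₂ h)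
    rcases (hR q).1 hq with h | h
    · exact (h₁.rem m hmO₁ q h (h₂.tabSub m hmO₂ q hq')).imp_right
        fun ⟨v, hv⟩ => ⟨v, (hτ _).2 (.inl hv)⟩
    · rcases h₂.rem m hmO₂ q h hq' with h1 | ⟨v, hv⟩
      · obtain ⟨v, hv⟩ := Option.ne_none_iff_exists'.1 h1
        rcases hσ m v hv with h2 | h2
        · exact .inl (by simp [h2])
        · exact .inr ⟨v, (hτ _).2 (.inl h2)⟩
      · exact .inr ⟨v, (hτ _).2 (.inr hv)⟩
  pend := by
    obtain ⟨n₁, e₁, d₁, r₁⟩ := h₁.pend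
    obtain ⟨n₂, e₂, d₂, r₂⟩ := h₂.pend
    refine ⟨n₂ ++ n₁, by rw [e₂, e₁, List.append_assoc], ?_, fun x hx => ?_⟩
    · rw [List.nodup_append']
      exact ⟨d₂, d₁, fun x hx hx' => hRd _ (r₁ x hx').1 (r₂ x hx).1⟩
    · rcases List.mem_append.1 hx with h | h
      · exact ⟨(hR _).2 (.inr (r₂ x h).1), (r₂ x h).2⟩
      · refine ⟨(hR _).2 (.inl (r₁ x h).1), fun m hm => ?_⟩
        by_cases hmO : m ∈ O₂
        · exact hRd _ (r₁ x h).1 (hO m hmO _ ((h₂.inv.tab.sub m).subset hm))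
        · exact (r₁ x h).2 m (h₂.tabSub m hmO _ hm)
  count := by have := h₁.count; have := h₂.count; omega

/-- Flags outside of the visited region persist. -/
theorem PropPost.affected (hs : Split E σ O₁ O₂ τ₁ τ₂)
    (hpre : PropPre T F A D E O₁ R₁ σ τ₁ rd₁ S) (h : PropPost T F A D O₁ R₁ σ τ₁ N S S₁)
    (hO : ∀ m ∈ O₁, ∀ q ∈ T.readers m [], q ∈ R₁) {q : Path} (hq : q ∈ S.affected) (hqR : q ∉ R₁) :
    q ∈ S₁.affected := by
  obtain ⟨hD, m, hm, hne⟩ := (hpre.inv.flag q).1 hq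
  have hmO : m ∉ O₁ := fun h1 => hqR (hO m h1 q ((hpre.inv.tab.sub m).subset hm))
  refine (h.inv.flag q).2 ⟨fun h1 => h1.elim hD hqR, m, (h.tabOut m hmO q hqR).2 hm, ?_⟩
  rw [h.valN m hmO]
  · exact hne
  · intro v hv
    rcases hs.keys₁ m v hv with h1 | h1
    · exact hne (hpre.new m v hv h1)
    · exact hmO h1

end Compose

end

/-! ### Visiting nodes: S nodes and P nodes -/

section

variable {ι V : Type*} [DecidableEq V] [DecidableEq ι] [Inhabited V]

/-- A child is visited if it is marked. -/
def Tree.visit (t : Tree ι V) (c : Path) (S : State ι V) : Tree ι V × State ι V × Cost :=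
  if c ∈ S.marked then t.propagate c S else (t, S, Cost.tick 0)

theorem Tree.visit_of_mem {t : Tree ι V} {c : Path} {S : State ι V} (h : c ∈ S.marked) :
    t.visit c S = t.propagate c S := if_pos h

theorem Tree.visit_of_notMem {t : Tree ι V} {c : Path} {S : State ι V} (h : c ∉ S.marked) :
    t.visit c S = (t, S, Cost.tick 0) := if_neg h

section Spec

variable {Ω : Type*} [MeasurableSpace Ω] (μ : Measure Ω) (H : Ω → Hash) (T : Tree ι V)
  (F : Modifiable ι → Option V) (K L : ℕ)

/-- The amortized cost of a visit. -/
def CostSpec (X s : ℕ) (τ : List (Modifiable ι × V)) (S S' : State ι V) (c : Cost) : Prop :=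
  ∃ w, c.Bounded μ H (TabGood T L) w s ∧
    w + S.marked.card ≤ (4 * K + 6) * X + 5 * changeCost T F τ + S'.marked.card

/-- Visiting the tree `t` at `c` turns it into `t'`. -/
def NodeSpec (c : Path) (t t' : Tree ι V) (E : Set (Modifiable ι)) (σ : Modifiable ι → Option V)
    (τ : List (Modifiable ι × V)) (s : ℕ) : Prop :=
  ∀ A D S, SuffixClosed A →
    PropPre T F A D E (Own c 0) (Below c) σ τ (fun m q => q ∈ t.readers m c) S →
    ((∀ x, x <:+ c → x ≠ c → x ∈ A) ∨ ∀ q ∈ S.affected, q ∉ Below c) →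
    (t.visit c S).1 = t' ∧
    PropPost T F A D (Own c 0) (Below c) σ τ (K * t.affectedNodes t') S (t.visit c S).2.1 ∧
    CostSpec μ H T F K L (t.gap t') s τ S (t.visit c S).2.1 (t.visit c S).2.2 ∧
    ((∃ q ∈ S.affected, q ∈ Below c) → 0 < t.spine t')

/-- Visiting the children of the scope of `p` turns `b` into `b'`. -/
def BodySpec (p : Path) (i : ℕ) (b b' : Body ι V) (E : Set (Modifiable ι))
    (σ : Modifiable ι → Option V) (τ : List (Modifiable ι × V)) (s : ℕ) : Prop :=
  ∀ A D S, SuffixClosed A →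
    PropPre T F A D E (Own p i) (SBelow p) σ τ (fun m q => q ∈ b.readers m p) S →
    (p ∈ A ∨ ∀ q ∈ S.affected, q ∉ SBelow p) →
    (b.strand = b'.strand ∧ b.allocs = b'.allocs ∧ (b.l.visit (false :: p) S).1 = b'.l ∧
      (b.r.visit (true :: p) (b.l.visit (false :: p) S).2.1).1 = b'.r) ∧
    PropPost T F A D (Own p i) (SBelow p) σ τ (K * b.affectedNodes b') S
      (b.r.visit (true :: p) (b.l.visit (false :: p) S).2.1).2.1 ∧
    CostSpec μ H T F K L (b.gap b') s τ S
      (b.r.visit (true :: p) (b.l.visit (false :: p) S).2.1).2.1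
      ((b.l.visit (false :: p) S).2.2 + (b.r.visit (true :: p) (b.l.visit (false :: p) S).2.1).2.2) ∧
    ((∃ q ∈ S.affected, q ∈ SBelow p) → 0 < b.spine b')

end Spec

section Visit

variable {Ω : Type*} [MeasurableSpace Ω] {μ : Measure Ω} [IsProbabilityMeasure μ] {H : Ω → Hash}
  {T : Tree ι V} {F : Modifiable ι → Option V} {K L : ℕ} {A D : Set Path} {S S₁ S₂ : State ι V}
  {E O : Set (Modifiable ι)} {R : Set Path} {σ σ₂ : Modifiable ι → Option V}
  {τ τ₁ τ₂ : List (Modifiable ι × V)} {rd : Modifiable ι → Path → Prop}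

/-- Dynamic scoping: what is allocated at or below p is read strictly below p. -/
theorem own_readers (hT : ∀ x j, ∀ q ∈ T.readers (.dyn x j) [], q ∈ SBelow x) {p : Path} {i : ℕ} :
    ∀ m ∈ Own p i, ∀ q ∈ T.readers m [], q ∈ SBelow p := by
  rintro _ ⟨x, j, rfl, hx, -⟩ q hq
  have h := hT x j q hq
  exact ⟨hx.trans h.1, fun h1 => h.2 (suffix_antisymm (h1 ▸ hx) h.1)⟩

/-- An unmarked region contains no affected nodes. -/
theorem Inv.not_affected (h : Inv T F A D S) {c : Path} (hc : c ∉ S.marked) :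
    ∀ q ∈ S.affected, q ∉ Below c := fun q hq hq' => hc ((h.mark c).2 (.inr ⟨q, hq, hq'⟩))

/-- Marked nodes have affected nodes below. -/
theorem Inv.exists_affected (h : Inv T F A D S) {c : Path} (hc : c ∈ S.marked) (hA : c ∉ A) :
    ∃ q ∈ S.affected, q ∈ Below c := ((h.mark c).1 hc).resolve_left hA

/-- The common core of sequential and parallel children: two visits in disjoint regions by
computations that do not interfere. It is stated for arbitrary positions so that it applies to the
children of a P node in either order. The last conclusion is what lets `propagate` test the marks of
both branches beforehand: the first visit does not remove the mark of the second child. -/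
theorem visit_pair (hT : ∀ x j, ∀ q ∈ T.readers (.dyn x j) [], q ∈ SBelow x)
    {c₁ c₂ : Path} {t₁ t₁' t₂ t₂' : Tree ι V} {s₁ s₂ : ℕ}
    (hs : Split E σ (Own c₁ 0) (Own c₂ 0) τ₁ τ₂)
    (hσ : ∀ m v, σ₂ m = some v → σ m = some v ∨ (m, v) ∈ τ₁)
    (n₁ : NodeSpec μ H T F K L c₁ t₁ t₁' E σ τ₁ s₁)
    (n₂ : NodeSpec μ H T F K L c₂ t₂ t₂' E σ₂ τ₂ s₂)
    (hR : ∀ q, q ∈ R ↔ q ∈ Below c₁ ∨ q ∈ Below c₂) (hd : ∀ q ∈ Below c₁, q ∉ Below c₂)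
    (hO₁ : Own c₁ 0 ⊆ O) (hO₂ : Own c₂ 0 ⊆ O) (hτ : ∀ x, x ∈ τ ↔ x ∈ τ₁ ∨ x ∈ τ₂)
    (hA : SuffixClosed A) (hpre : PropPre T F A D E O R σ τ rd S)
    (hrd₁ : ∀ q ∈ Below c₁, ∀ m, rd m q ↔ q ∈ t₁.readers m c₁)
    (hrd₂ : ∀ q ∈ Below c₂, ∀ m, rd m q ↔ q ∈ t₂.readers m c₂)
    (hpar : (∀ x, (x <:+ c₁ ∧ x ≠ c₁) ∨ (x <:+ c₂ ∧ x ≠ c₂) → x ∈ A) ∨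
      ∀ q ∈ S.affected, q ∉ R) :
    ((t₁.visit c₁ S).1 = t₁' ∧ (t₂.visit c₂ (t₁.visit c₁ S).2.1).1 = t₂') ∧
    PropPost T F A D O R σ τ (K * (t₁.affectedNodes t₁' + t₂.affectedNodes t₂')) S
      (t₂.visit c₂ (t₁.visit c₁ S).2.1).2.1 ∧
    (CostSpec μ H T F K L (t₁.gap t₁') s₁ τ₁ S (t₁.visit c₁ S).2.1 (t₁.visit c₁ S).2.2 ∧
      CostSpec μ H T F K L (t₂.gap t₂') s₂ τ₂ (t₁.visit c₁ S).2.1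
        (t₂.visit c₂ (t₁.visit c₁ S).2.1).2.1 (t₂.visit c₂ (t₁.visit c₁ S).2.1).2.2) ∧
    ((∃ q ∈ S.affected, q ∈ R) → 0 < t₁.spine t₁' + t₂.spine t₂') ∧
    (c₂ ∈ S.marked → c₂ ∈ (t₁.visit c₁ S).2.1.marked) := by
  have hO₁R : ∀ m ∈ Own c₁ 0, ∀ q ∈ T.readers m [], q ∈ Below c₁ := fun m hm q hq =>
    (own_readers hT m hm q hq).1
  have hO₂R : ∀ m ∈ Own c₂ 0, ∀ q ∈ T.readers m [], q ∈ Below c₂ := fun m hm q hq =>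
    (own_readers hT m hm q hq).1
  have hpre₁ : PropPre T F A D E (Own c₁ 0) (Below c₁) σ τ₁ (fun m q => q ∈ t₁.readers m c₁) S :=
    hpre.restrict hO₁ (fun q hq => (hR q).2 (.inl hq)) (fun x hx => (hτ x).2 (.inl hx)) hrd₁
  have hpre₂ : PropPre T F A D E (Own c₂ 0) (Below c₂) σ τ₂ (fun m q => q ∈ t₂.readers m c₂) S :=
    hpre.restrict hO₂ (fun q hq => (hR q).2 (.inr hq)) (fun x hx => (hτ x).2 (.inr hx)) hrd₂
  obtain ⟨a1, a2, a3, a4⟩ := n₁ A D S hA hpre₁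
    (hpar.imp (fun h x hx hx' => h x (.inl ⟨hx, hx'⟩)) fun h q hq hq' => h q hq ((hR q).2 (.inl hq')))
  have hpers : ∀ q ∈ S.affected, q ∈ Below c₂ → q ∈ (t₁.visit c₁ S).2.1.affected := fun q hq hq' =>
    PropPost.affected hs hpre₁ a2 hO₁R hq fun h => hd q h hq'
  -- If nothing in the region is flagged, the first child is unmarked, its visit changes nothing,
  -- and the second child finds no flag either.
  have hpar₂ : (∀ x, x <:+ c₂ → x ≠ c₂ → x ∈ A) ∨
      ∀ q ∈ (t₁.visit c₁ S).2.1.affected, q ∉ Below c₂ := by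
    rcases hpar with h | h
    · exact .inl fun x hx hx' => h x (.inr ⟨hx, hx'⟩)
    · right
      have hc₁ : c₁ ∉ S.marked := by
        intro hc
        obtain ⟨q, hq, hq'⟩ := hpre.inv.exists_affected hc
          (hpre.out c₁ ((hR _).2 (.inl List.suffix_rfl)))
        exact h q hq ((hR q).2 (.inl hq'))
      rw [Tree.visit_of_notMem hc₁]
      exact fun q hq hq' => h q hq ((hR q).2 (.inr hq'))
  obtain ⟨b1, b2, b3, b4⟩ := n₂ A (D ∪ Below c₁) _ hA (hpre₂.next hs a2 hσ hO₁R hd) hpar₂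
  refine ⟨⟨a1, b1⟩, ?_, ⟨a3, b3⟩, ?_, ?_⟩
  · rw [mul_add]
    exact a2.comp hs b2 hσ hO₂R hd hO₁ hO₂ hR hτ
  · rintro ⟨q, hq, hqR⟩
    rcases (hR q).1 hqR with h | h
    · have := a4 ⟨q, hq, h⟩; omega
    · have := b4 ⟨q, hpers q hq h, h⟩; omega
  · intro hc
    obtain ⟨q, hq, hq'⟩ := hpre.inv.exists_affected hc
      (hpre.out c₂ ((hR _).2 (.inr List.suffix_rfl)))
    exact (a2.inv.mark c₂).2 (.inr ⟨q, hpers q hq hq', hq'⟩)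

/-- After all nodes strictly below `c` have been visited, `c` can be unmarked. -/
theorem clear_inv {A' : Set Path} {c : Path} (hI : Inv T F A' (D ∪ SBelow c) S)
    (hA' : ∀ x, x ∈ A' ↔ x ∈ A ∨ x = c) (hc : c ∉ A) (hp : ∀ x, x <:+ c → x ≠ c → x ∈ A) :
    Inv T F A (D ∪ Below c) (S.clear c) where
  tab := ⟨hI.tab.sub, hI.tab.size, hI.tab.dels⟩
  mark x := by
    simp only [State.clear, Finset.mem_erase]
    rw [hI.mark, hA']
    constructor
    · rintro ⟨hx, (h | h) | ⟨q, hq, h⟩⟩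
      · exact .inl h
      · exact absurd h hx
      · by_cases hqc : q = c
        · subst hqc; exact .inl (hp x h hx)
        · exact .inr ⟨q, ⟨hqc, hq⟩, h⟩
    · rintro (h | ⟨q, ⟨hqc, hq⟩, h⟩)
      · exact ⟨by rintro rfl; exact hc h, .inl (.inl h)⟩
      · refine ⟨?_, .inr ⟨q, hq, h⟩⟩
        rintro rfl
        exact ((hI.flag q).1 hq).1 (.inr ⟨h, hqc⟩)
  flag q := by
    simp only [State.clear, Finset.mem_erase]
    rw [hI.flag]
    simp only [Set.mem_union, mem_below_iff]
    tauto

theorem card_clear (S : State ι V) (c : Path) : S.marked.card ≤ (S.clear c).marked.card + 1 := by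
  have := Finset.pred_card_le_card_erase (s := S.marked) (a := c)
  simp only [State.clear]
  omega

theorem PropPost.clear {A' : Set Path} {c : Path} {N : ℕ}
    (h : PropPost T F A' D (Own c 0) (SBelow c) σ τ N S S₁)
    (hA' : ∀ x, x ∈ A' ↔ x ∈ A ∨ x = c) (hc : c ∉ A) (hp : ∀ x, x <:+ c → x ≠ c → x ∈ A)
    (hrem : ∀ m, m ∉ Own c 0 → c ∈ (S.tab m).elems → σ m ≠ none) :
    PropPost T F A D (Own c 0) (Below c) σ τ N S (S₁.clear c) where
  inv := clear_inv h.inv hA' hc hp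
  valW := h.valW
  valN := h.valN
  tabOut m hm q hq := h.tabOut m hm q fun h => hq h.1
  tabSub := h.tabSub
  rem m hm q hq hq' := by
    rcases mem_below_iff.1 hq with rfl | h1
    · exact .inl (hrem m hm (h.tabSub m hm q hq'))
    · exact h.rem m hm q h1 hq'
  pend := by
    obtain ⟨n, h1, h2, h3⟩ := h.pend
    exact ⟨n, h1, h2, fun x hx => ⟨(h3 x hx).1.1, (h3 x hx).2⟩⟩
  count := h.count

/-- A node that is not re-executed is visited by visiting its children. -/
theorem node_of_body {c : Path} {b b' : Body ι V} {lab lab' : Label ι V} {s : ℕ}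
    (hb : BodySpec μ H T F K L c 0 b b' E σ τ s) (hA : SuffixClosed A)
    (hpre : PropPre T F A D E (Own c 0) (Below c) σ τ (fun m q => q ∈ (b.node lab).readers m c) S)
    (hpar : (∀ x, x <:+ c → x ≠ c → x ∈ A) ∨ ∀ q ∈ S.affected, q ∉ Below c)
    (hc : c ∉ S.affected) (hmods : ∀ m ∈ lab.mods, σ m ≠ none) (hlab : lab = lab')
    (hprop : (b.node lab).propagate c S =
      (.node lab b.strand b.allocs (b.l.visit (false :: c) S).1
        (b.r.visit (true :: c) (b.l.visit (false :: c) S).2.1).1,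
        (b.r.visit (true :: c) (b.l.visit (false :: c) S).2.1).2.1.clear c,
        Cost.tick 1 + (b.l.visit (false :: c) S).2.2 +
          (b.r.visit (true :: c) (b.l.visit (false :: c) S).2.1).2.2)) :
    ((b.node lab).visit c S).1 = b'.node lab' ∧
    PropPost T F A D (Own c 0) (Below c) σ τ (K * b.affectedNodes b') S
      ((b.node lab).visit c S).2.1 ∧
    CostSpec μ H T F K L (b.gap b' + min 1 (b.spine b')) (1 + s) τ S ((b.node lab).visit c S).2.1
      ((b.node lab).visit c S).2.2 ∧
    ((∃ q ∈ S.affected, q ∈ Below c) → 0 < b.spine b') := by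
  subst hlab
  have hcA : c ∉ A := hpre.out c List.suffix_rfl
  have hrem : ∀ m, m ∉ Own c 0 → c ∈ (S.tab m).elems → σ m ≠ none := by
    intro m _ hm
    rcases Body.mem_node_readers.1 ((hpre.readers c List.suffix_rfl m).1 hm) with ⟨h, -⟩ | h
    · exact hmods m h
    · exact absurd (Body.readers_sBelow h) (not_sBelow_self c)
  have hrd : ∀ q ∈ SBelow c, ∀ m, q ∈ (b.node lab).readers m c ↔ q ∈ b.readers m c := by
    intro q hq m
    rw [Body.mem_node_readers]
    exact ⟨fun h => h.resolve_left fun h => hq.2 h.2, .inr⟩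
  have hpre' := hpre.restrict subset_rfl (fun q (hq : q ∈ SBelow c) => hq.1) (fun _ h => h) hrd
  have hspine : (∃ q ∈ S.affected, q ∈ Below c) → ∃ q ∈ S.affected, q ∈ SBelow c := by
    rintro ⟨q, hq, hqc⟩
    exact ⟨q, hq, hqc, by rintro rfl; exact hc hq⟩
  by_cases hm : c ∈ S.marked
  · have haff := hpre.inv.exists_affected hm hcA
    have hp : ∀ x, x <:+ c → x ≠ c → x ∈ A := by
      refine hpar.resolve_right fun h => ?_
      obtain ⟨q, hq, hq'⟩ := haff
      exact h q hq hq'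
    -- The node joins the path of the traversal. Its mark is at present justified by flags below;
    -- membership in the path keeps it justified while these flags disappear.
    have hI' : Inv T F (A ∪ {c}) D S := by
      refine ⟨hpre.inv.tab, fun x => ?_, hpre.inv.flag⟩
      rw [hpre.inv.mark]
      constructor
      · rintro (h | h)
        · exact .inl (.inl h)
        · exact .inr h
      · rintro ((h | h) | h)
        · exact .inl h
        · rw [Set.mem_singleton_iff] at h
          rw [h]
          exact .inr haff
        · exact .inr h
    have hA' : SuffixClosed (A ∪ {c}) := by
      rintro x y hxy (h | h)
      · exact .inl (hA x y hxy h)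
      · rw [Set.mem_singleton_iff] at h
        subst h
        by_cases hxy' : x = y
        · exact .inr hxy'
        · exact .inl (hp x hxy hxy')
    obtain ⟨⟨h1, h2, h3, h4⟩, h5, ⟨w, h6, h7⟩, h8⟩ := hb (A ∪ {c}) D S hA'
      { hpre' with
        inv := hI'
        out := by
          rintro q hq (h | h)
          · exact hpre'.out q hq h
          · exact hq.2 h }
      (.inl (.inr rfl))
    rw [Tree.visit_of_mem hm, hprop]
    refine ⟨?_, h5.clear (fun x => Iff.rfl) hcA hp hrem, ⟨1 + w, ?_, ?_⟩, fun h => h8 (hspine h)⟩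
    · simp only [h1, h2, h3, h4, Body.node]
    · have := (Cost.Bounded.tick (μ := μ) (H := H) (G := TabGood T L) 1).add h6
      refine ⟨?_, ?_, ?_⟩
      · convert this.meas using 2
        simp only [Cost.add_work, add_assoc]
      · convert this.work using 3
        simp only [Cost.add_work, add_assoc]
      · intro g hg
        have := this.span g hg
        simp only [Cost.add_span] at this ⊢
        omega
    -- A marked node has an affected read below, so it lies on the spine; this unit of the budget
    -- pays for the visit and for the mark that is cleared.
    · have h9 := h8 (hspine haff)
      have h10 := card_clear (b.r.visit (true :: c) (b.l.visit (false :: c) S).2.1).2.1 c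
      have h11 : min 1 (b.spine b') = 1 := by omega
      rw [h11]
      simp only
      rw [mul_add]
      omega
  -- Without a mark the children are unmarked as well and both visits are void. The specification of
  -- the body then says that the old subtree already equals the new one.
  · have hna := hpre.inv.not_affected hm
    have hsub : ∀ d : Bool, (d :: c) ∉ S.marked := fun d hd =>
      hm (hpre.inv.mark.closed hA c (d :: c) (List.suffix_cons d c) hd)
    obtain ⟨⟨h1, h2, h3, h4⟩, h5, ⟨w, h6, h7⟩, h8⟩ := hb A D S hA hpre'
      (.inr fun q hq hq' => hna q hq hq'.1)
    have e1 : b.l.visit (false :: c) S = (b.l, S, Cost.tick 0) := Tree.visit_of_notMem (hsub _)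
    have e2 : b.r.visit (true :: c) S = (b.r, S, Cost.tick 0) := Tree.visit_of_notMem (hsub _)
    simp only [e1, e2] at h3 h4 h5
    rw [Tree.visit_of_notMem hm]
    refine ⟨?_, ?_, ⟨0, (Cost.Bounded.tick 0).mono le_rfl (Nat.zero_le _), ?_⟩,
      fun h => h8 (hspine h)⟩
    · simp only [h1, h2, h3, h4, Body.node]
    · refine ⟨⟨hpre.inv.tab, hpre.inv.mark, fun q => ?_⟩, h5.valW, h5.valN,
        fun _ _ _ _ => Iff.rfl, fun _ _ _ h => h, fun m hmO q hq hq' => ?_,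
        ⟨[], rfl, by simp, by simp⟩, h5.count⟩
      · rw [h5.inv.flag]
        simp only [Set.mem_union, mem_below_iff]
        constructor
        · rintro ⟨h, h'⟩
          refine ⟨?_, h'⟩
          rintro (h9 | h9 | h9)
          · exact h (.inl h9)
          · subst h9
            exact hc ((h5.inv.flag q).2 ⟨h, h'⟩)
          · exact h (.inr h9)
        · rintro ⟨h, h'⟩
          exact ⟨fun h9 => h (h9.imp_right .inr), h'⟩
      · rcases mem_below_iff.1 hq with rfl | h9
        · exact .inl (hrem m hmO hq')
        · exact h5.rem m hmO q h9 hq'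
    · simp only
      omega

/-- An S node reads nothing, so it can never be flagged itself. -/
theorem seq_node_spec {c : Path} {b b' : Body ι V} {s : ℕ}
    (hb : BodySpec μ H T F K L c 0 b b' E σ τ s) :
    NodeSpec μ H T F K L c (b.node .S) (b'.node .S) E σ τ (1 + s) := by
  intro A D S hA hpre hpar
  have hc : c ∉ S.affected := by
    intro hc
    obtain ⟨-, m, hm, -⟩ := (hpre.inv.flag c).1 hc
    rcases Body.mem_node_readers.1 ((hpre.readers c List.suffix_rfl m).1 hm) with ⟨h, -⟩ | h
    · simp [Label.mods] at h
    · exact absurd (Body.readers_sBelow h) (not_sBelow_self c)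
  rw [Body.affectedNodes_S, Body.gap_S, Body.spine_S]
  obtain ⟨h1, h2, h3, h4⟩ := node_of_body hb hA hpre hpar hc (by simp [Label.mods]) rfl rfl
  exact ⟨h1, h2, h3, fun h => by have := h4 h; omega⟩

/-- The algorithm tests both marks before it visits either branch. The two visits are simulated one
after the other, in the order for which an unmarked branch comes first, so that its visit is void.
-/
theorem par_node_spec (hT : ∀ x j, ∀ q ∈ T.readers (.dyn x j) [], q ∈ SBelow x) {c : Path}
    {t₁ t₁' t₂ t₂' : Tree ι V} {s : ℕ}
    (hs : Split E σ (Own (false :: c) 0) (Own (true :: c) 0) τ₁ τ₂)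
    (n₁ : NodeSpec μ H T F K L (false :: c) t₁ t₁' E σ τ₁ s)
    (n₂ : NodeSpec μ H T F K L (true :: c) t₂ t₂' E σ τ₂ s) :
    NodeSpec μ H T F K L c (.node .P 0 0 t₁ t₂) (.node .P 0 0 t₁' t₂') E σ (τ₁ ++ τ₂) (2 + s) := by
  intro A D S hA hpre hpar
  have hcA : c ∉ A := hpre.out c List.suffix_rfl
  have hcn : ∀ m, c ∉ (S.tab m).elems := by
    intro m hm
    rcases Tree.mem_readers_node.1 ((hpre.readers c List.suffix_rfl m).1 hm) with ⟨h, -⟩ | h | h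
    · simp [Label.mods] at h
    · exact not_below_cons _ _ (Tree.readers_below h)
    · exact not_below_cons _ _ (Tree.readers_below h)
  have hc : c ∉ S.affected := by
    intro hc
    obtain ⟨-, m, hm, -⟩ := (hpre.inv.flag c).1 hc
    exact hcn m hm
  have hrd₁ : ∀ q ∈ Below (false :: c), ∀ m, q ∈ (Tree.node .P 0 0 t₁ t₂).readers m c ↔
      q ∈ t₁.readers m (false :: c) := by
    intro q hq m
    rw [Tree.mem_readers_node]
    constructor
    · rintro (⟨h, -⟩ | h | h)
      · simp [Label.mods] at h
      · exact h
      · exact absurd (Tree.readers_below h) (below_disjoint (by simp) hq)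
    · exact fun h => .inr (.inl h)
  have hrd₂ : ∀ q ∈ Below (true :: c), ∀ m, q ∈ (Tree.node .P 0 0 t₁ t₂).readers m c ↔
      q ∈ t₂.readers m (true :: c) := by
    intro q hq m
    rw [Tree.mem_readers_node]
    constructor
    · rintro (⟨h, -⟩ | h | h)
      · simp [Label.mods] at h
      · exact absurd (Tree.readers_below h) (below_disjoint (by simp) hq)
      · exact h
    · exact fun h => .inr (.inr h)
  have hrem : ∀ m, m ∉ Own c 0 → c ∈ (S.tab m).elems → σ m ≠ none := fun m _ h => absurd h (hcn m)
  have hpre' : PropPre T F A D E (Own c 0) (SBelow c) σ (τ₁ ++ τ₂)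
      (fun m q => q ∈ (Tree.node .P 0 0 t₁ t₂).readers m c) S :=
    hpre.restrict subset_rfl (fun q hq => hq.1) (fun _ h => h) fun _ _ _ => Iff.rfl
  have hspine : (∃ q ∈ S.affected, q ∈ Below c) → ∃ q ∈ S.affected, q ∈ SBelow c := by
    rintro ⟨q, hq, hqc⟩
    exact ⟨q, hq, hqc, by rintro rfl; exact hc hq⟩
  have hparts : ∀ {A' : Set Path} (hA' : SuffixClosed A')
      (hp : PropPre T F A' D E (Own c 0) (SBelow c) σ (τ₁ ++ τ₂)
        (fun m q => q ∈ (Tree.node .P 0 0 t₁ t₂).readers m c) S)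
      (hpar' : (∀ x, x <:+ c → x ∈ A') ∨ ∀ q ∈ S.affected, q ∉ SBelow c), _ :=
    fun {A'} hA' hp hpar' => visit_pair hT (O := Own c 0) (R := SBelow c) hs (fun m v h => .inl h) n₁
      n₂ (fun q => mem_sBelow_iff) (fun q hq => below_disjoint (by simp) hq)
      (fun m => own_cons_subset) (fun m => own_cons_subset) (fun x => List.mem_append) hA' hp hrd₁
      hrd₂ (hpar'.imp_left fun h x hx => h x (by
        rcases hx with ⟨h1, h2⟩ | ⟨h1, h2⟩
        · exact (List.suffix_cons_iff.1 h1).resolve_left h2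
        · exact (List.suffix_cons_iff.1 h1).resolve_left h2))
  have hparts' : ∀ {A' : Set Path} (hA' : SuffixClosed A')
      (hp : PropPre T F A' D E (Own c 0) (SBelow c) σ (τ₁ ++ τ₂)
        (fun m q => q ∈ (Tree.node .P 0 0 t₁ t₂).readers m c) S)
      (hpar' : (∀ x, x <:+ c → x ∈ A') ∨ ∀ q ∈ S.affected, q ∉ SBelow c), _ :=
    fun {A'} hA' hp hpar' => visit_pair hT (O := Own c 0) (R := SBelow c) hs.symm
      (fun m v h => .inl h) n₂
      n₁ (fun q => mem_sBelow_iff.trans or_comm) (fun q hq => below_disjoint (by simp) hq)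
      (fun m => own_cons_subset) (fun m => own_cons_subset)
      (fun x => List.mem_append.trans or_comm) hA' hp hrd₂
      hrd₁ (hpar'.imp_left fun h x hx => h x (by
        rcases hx with ⟨h1, h2⟩ | ⟨h1, h2⟩
        · exact (List.suffix_cons_iff.1 h1).resolve_left h2
        · exact (List.suffix_cons_iff.1 h1).resolve_left h2))
  rw [Tree.affectedNodes_P, Tree.gap_P, Tree.spine_P]
  by_cases hm : c ∈ S.marked
  · have haff := hpre.inv.exists_affected hm hcA
    have hp : ∀ x, x <:+ c → x ≠ c → x ∈ A := by
      refine hpar.resolve_right fun h => ?_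
      obtain ⟨q, hq, hq'⟩ := haff
      exact h q hq hq'
    have hI' : Inv T F (A ∪ {c}) D S := by
      refine ⟨hpre.inv.tab, fun x => ?_, hpre.inv.flag⟩
      rw [hpre.inv.mark]
      constructor
      · rintro (h | h)
        · exact .inl (.inl h)
        · exact .inr h
      · rintro ((h | h) | h)
        · exact .inl h
        · rw [Set.mem_singleton_iff] at h
          rw [h]
          exact .inr haff
        · exact .inr h
    have hA' : SuffixClosed (A ∪ {c}) := by
      rintro x y hxy (h | h)
      · exact .inl (hA x y hxy h)
      · rw [Set.mem_singleton_iff] at h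
        subst h
        by_cases hxy' : x = y
        · exact .inr hxy'
        · exact .inl (hp x hxy hxy')
    have hpre'' : PropPre T F (A ∪ {c}) D E (Own c 0) (SBelow c) σ (τ₁ ++ τ₂)
        (fun m q => q ∈ (Tree.node .P 0 0 t₁ t₂).readers m c) S :=
      { hpre' with
        inv := hI'
        out := by
          rintro q hq (h | h)
          · exact hpre'.out q hq h
          · exact hq.2 h }
    have hparA : (∀ x, x <:+ c → x ∈ A ∪ {c}) ∨ ∀ q ∈ S.affected, q ∉ SBelow c := by
      left
      intro x hx
      by_cases hxc : x = c
      · exact .inr hxc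
      · exact .inl (hp x hx hxc)
    rw [Tree.visit_of_mem hm, Tree.propagate]
    by_cases h1 : false :: c ∈ S.marked
    · by_cases h2 : true :: c ∈ S.marked
      · obtain ⟨⟨e1, e2⟩, p1, ⟨⟨w₁, c1, c2⟩, ⟨w₂, c3, c4⟩⟩, p2, p3⟩ := hparts hA' hpre'' hparA
        have h2' := p3 h2
        rw [if_pos ⟨h1, h2⟩]
        rw [Tree.visit_of_mem h2', Tree.visit_of_mem h1] at *
        refine ⟨by simp only [e1, e2], p1.clear (fun x => Iff.rfl) hcA hp hrem,
          ⟨_, ((Cost.Bounded.tick 1).add (c1.par c3)).mono le_rfl ?_, ?_⟩, fun h => ?_⟩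
        · rw [max_self]; omega
        · have h9 := p2 (hspine haff)
          have h11 : min 1 (t₁.spine t₁' + t₂.spine t₂') = 1 := by omega
          have h10 := card_clear (t₂.propagate (true :: c) (t₁.propagate (false :: c) S).2.1).2.1 c
          rw [h11, changeCost_append]
          simp only
          rw [mul_add, mul_add]
          omega
        · have := p2 (hspine h); omega
      -- Only the left branch is marked: the opposite order makes the void visit of the right branch
      -- come first.
      · obtain ⟨⟨e1, e2⟩, p1, ⟨⟨w₁, c1, c2⟩, ⟨w₂, c3, c4⟩⟩, p2, p3⟩ := hparts' hA' hpre'' hparA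
        rw [if_neg (fun h => h2 h.2), if_pos h1]
        rw [Tree.visit_of_notMem h2] at *
        rw [Tree.visit_of_mem h1] at *
        refine ⟨by simp only at e1 e2; simp only [e1, e2],
          PropPost.clear (by rwa [add_comm]) (fun x => Iff.rfl) hcA hp hrem,
          ⟨_, ((Cost.Bounded.tick 1).add c3).mono le_rfl (by omega), ?_⟩, fun h => ?_⟩
        · have h9 := p2 (hspine haff)
          have h11 : min 1 (t₁.spine t₁' + t₂.spine t₂') = 1 := by omega
          have h10 := card_clear (t₁.propagate (false :: c) S).2.1 c
          rw [h11, changeCost_append]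
          simp only at c4 ⊢
          rw [mul_add, mul_add]
          omega
        · have := p2 (hspine h); omega
    -- A marked P node has a flagged node strictly below; if it is not on the left, it is on the
    -- right.
    · have h2 : true :: c ∈ S.marked := by
        obtain ⟨q, hq, hq'⟩ := hspine haff
        rcases mem_sBelow_iff.1 hq' with h | h
        · exact absurd h (hpre.inv.not_affected h1 q hq)
        · exact (hpre.inv.mark _).2 (.inr ⟨q, hq, h⟩)
      obtain ⟨⟨e1, e2⟩, p1, ⟨⟨w₁, c1, c2⟩, ⟨w₂, c3, c4⟩⟩, p2, p3⟩ := hparts hA' hpre'' hparA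
      rw [if_neg (fun h => h1 h.1), if_neg h1]
      rw [Tree.visit_of_notMem h1] at *
      rw [Tree.visit_of_mem h2] at *
      refine ⟨by simp only at e1 e2; simp only [e1, e2], p1.clear (fun x => Iff.rfl) hcA hp hrem,
        ⟨_, ((Cost.Bounded.tick 1).add c3).mono le_rfl (by omega), ?_⟩, fun h => ?_⟩
      · have h9 := p2 (hspine haff)
        have h11 : min 1 (t₁.spine t₁' + t₂.spine t₂') = 1 := by omega
        have h10 := card_clear (t₂.propagate (true :: c) S).2.1 c
        rw [h11, changeCost_append]
        simp only at c4 ⊢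
        rw [mul_add, mul_add]
        omega
      · have := p2 (hspine h); omega
  · have hna := hpre.inv.not_affected hm
    have hsub : ∀ d : Bool, (d :: c) ∉ S.marked := fun d hd =>
      hm (hpre.inv.mark.closed hA c (d :: c) (List.suffix_cons d c) hd)
    obtain ⟨⟨e1, e2⟩, h5, ⟨⟨w₁, c1, c2⟩, ⟨w₂, c3, c4⟩⟩, p2, p3⟩ := hparts hA hpre'
      (.inr fun q hq hq' => hna q hq hq'.1)
    rw [Tree.visit_of_notMem (hsub _)] at e1 e2 h5
    rw [Tree.visit_of_notMem (hsub _)] at e2 h5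
    simp only at e1 e2 h5
    rw [Tree.visit_of_notMem hm]
    refine ⟨by rw [e1, e2], ?_, ⟨0, (Cost.Bounded.tick 0).mono le_rfl (Nat.zero_le _), ?_⟩,
      fun h => by have := p2 (hspine h); omega⟩
    · refine ⟨⟨hpre.inv.tab, hpre.inv.mark, fun q => ?_⟩, h5.valW, h5.valN,
        fun _ _ _ _ => Iff.rfl, fun _ _ _ h => h, fun m hmO q hq hq' => ?_,
        ⟨[], rfl, by simp, by simp⟩, h5.count⟩
      · rw [h5.inv.flag]
        simp only [Set.mem_union, mem_below_iff]
        constructor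
        · rintro ⟨h, h'⟩
          refine ⟨?_, h'⟩
          rintro (h9 | h9 | h9)
          · exact h (.inl h9)
          · subst h9
            exact hc ((h5.inv.flag q).2 ⟨h, h'⟩)
          · exact h (.inr h9)
        · rintro ⟨h, h'⟩
          exact ⟨fun h9 => h (h9.imp_right .inr), h'⟩
      · rcases mem_below_iff.1 hq with rfl | h9
        · exact absurd hq' (hcn m)
        · exact h5.rem m hmO q h9 hq'
    · simp only
      omega

end Visit

end

/-! ### Visiting a read node: destruction, then re-execution -/

section

variable {ι V : Type*} [DecidableEq V] [DecidableEq ι] [Inhabited V]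

section ReadNode

variable {Ω : Type*} [MeasurableSpace Ω] {μ : Measure Ω} [IsProbabilityMeasure μ] {H : Ω → Hash}
  {T : Tree ι V} {F : Modifiable ι → Option V} {K L : ℕ} {A D : Set Path} {S S₁ S₂ : State ι V}
  {E : Set (Modifiable ι)} {σ : Modifiable ι → Option V}
  {τ : List (Modifiable ι × V)} {rd : Modifiable ι → Path → Prop}

theorem NodeSpec.mono {c : Path} {t t' : Tree ι V} {s s' : ℕ} (h : NodeSpec μ H T F K L c t t' E σ τ s)
    (hs : s ≤ s') : NodeSpec μ H T F K L c t t' E σ τ s' := fun A D S hA hpre hpar =>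
  let ⟨h1, h2, ⟨w, h3, h4⟩, h5⟩ := h A D S hA hpre hpar
  ⟨h1, h2, ⟨w, h3.mono le_rfl hs, h4⟩, h5⟩

/-- The subtrees of the node `c` are destroyed. -/
theorem destroy_children (hH : UniformHashing μ H)
    (hT : ∀ x j, ∀ q ∈ T.readers (.dyn x j) [], q ∈ SBelow x) {c : Path} {b : Body ι V}
    {lab : Label ι V} {O : Set (Modifiable ι)}
    (hK : b.ArityLe K) (hal : b.l.AllocsLe) (har : b.r.AllocsLe)
    (hpre : PropPre T F A D E O (Below c) σ τ (fun m q => q ∈ (b.node lab).readers m c) S) :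
    DestroyPost T (Own c 0) (SBelow c) b.nodes (K * b.nodes) S
        (b.r.destroy (true :: c) (b.l.destroy (false :: c) (S.dealloc c b.allocs)).1).1 ∧
      (Cost.par (b.l.destroy (false :: c) (S.dealloc c b.allocs)).2
        (b.r.destroy (true :: c) (b.l.destroy (false :: c) (S.dealloc c b.allocs)).1).2).Bounded μ H
        (TabGood T L) (1 + ((4 * K + 2) * b.l.nodes + b.l.work) + ((4 * K + 2) * b.r.nodes + b.r.work))
        (1 + max (b.l.parSpan (K * (1 + L) + 2)) (b.r.parSpan (K * (1 + L) + 2))) := by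
  have hd := State.dealloc_spec hpre.inv.tab c b.allocs
  have hread : ∀ {d : Bool} {q : Path} {m : Modifiable ι}, q ∈ Below (d :: c) →
      q ∈ (S.tab m).elems → if d then q ∈ b.r.readers m (true :: c) else
        q ∈ b.l.readers m (false :: c) := by
    intro d q m hq h
    have hs := below_cons_subset hq
    rcases Tree.mem_readers_node.1 ((hpre.readers q hs.1 m).1 h) with ⟨-, h⟩ | h | h
    · exact absurd h hs.2
    · cases d
      · exact h
      · exact absurd (Tree.readers_below h) (below_disjoint (by simp) hq)
    · cases d
      · exact absurd (Tree.readers_below h) (below_disjoint (by simp) hq)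
      · exact h
  have hpos : ∀ {d : Bool} {q : Path}, q ∈ Below (d :: c) → q ∈ S.marked ∨ q ∈ S.affected →
      if d then b.r.Pos (true :: c) q else b.l.Pos (false :: c) q := by
    intro d q hq h
    have hq' : ∃ q' ∈ S.affected, q <:+ q' := by
      rcases h with h | h
      · exact ((hpre.inv.mark q).1 h).resolve_left (hpre.out q (below_cons_subset hq).1)
      · exact ⟨q, h, List.suffix_rfl⟩
    obtain ⟨q', h1, h2⟩ := hq'
    obtain ⟨-, m, h3, -⟩ := (hpre.inv.flag q').1 h1
    have h4 := hread (below_trans hq h2) h3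
    cases d
    · exact Tree.pos_of_readers h4 hq h2
    · exact Tree.pos_of_readers h4 hq h2
  obtain ⟨l1, l2⟩ := Tree.destroy_spec (S := S.dealloc c b.allocs) hH L K b.l (false :: c) hd.tab
    (fun q hq m hm => by simpa using hread hq (hd.elems m q hm).1)
    (fun q hq hm => by
      rw [hd.marked, hd.affected] at hm
      simpa using hpos hq (by tauto)) hK.1 hal
  have h₁ := hd.comp (O := Own c 0) (R := Below (false :: c)) (n := b.l.nodes) (N := K * b.l.nodes) l1
    subset_rfl (fun m => own_cons_subset) (fun q => by simp) (by omega) (by omega)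
  obtain ⟨r1, r2⟩ := Tree.destroy_spec (S := (b.l.destroy (false :: c) (S.dealloc c b.allocs)).1) hH L K
    b.r (true :: c) h₁.tab
    (fun q hq m hm => by simpa using hread hq (h₁.elems m q hm).1)
    (fun q hq hm => by
      rw [h₁.marked, h₁.affected] at hm
      simpa using hpos hq (by tauto)) hK.2 har
  exact ⟨h₁.comp r1 subset_rfl (fun m => own_cons_subset) (fun q => mem_sBelow_iff) le_rfl
    (by rw [Body.nodes, mul_add]), l2.par r2⟩

/-- Marks above c remain justified although the flags below c are gone, because c itself is flagged.
The modifiables whose values were reset have readers in the destroyed region only. -/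
theorem DestroyPost.inv (hT : ∀ x j, ∀ q ∈ T.readers (.dyn x j) [], q ∈ SBelow x) {c : Path} {n N : ℕ}
    (h : DestroyPost T (Own c 0) (SBelow c) n N S S₁) (hI : Inv T F A D S)
    (hA : ∀ q ∈ Below c, q ∉ A) (hc : c ∈ S.affected) : Inv T F A D S₁ where
  tab := h.tab
  mark x := by
    rw [h.marked, hI.mark]
    constructor
    · rintro ⟨h1 | ⟨q, hq, h1⟩, hx⟩
      · exact .inl h1
      · right
        by_cases hqc : q ∈ SBelow c
        · refine ⟨c, (h.affected c).2 ⟨hc, not_sBelow_self c⟩, ?_⟩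
          rcases List.suffix_or_suffix_of_suffix h1 hqc.1 with h2 | h2
          · exact h2
          · by_cases hxc : x = c
            · rw [hxc]
            · exact absurd ⟨h2, hxc⟩ hx
        · exact ⟨q, (h.affected q).2 ⟨hq, hqc⟩, h1⟩
    · rintro (h1 | ⟨q, hq, h1⟩)
      · exact ⟨.inl h1, fun h2 => hA x h2.1 h1⟩
      · obtain ⟨h2, h3⟩ := (h.affected q).1 hq
        refine ⟨.inr ⟨q, h2, h1⟩, fun hx => h3 ⟨hx.1.trans h1, ?_⟩⟩
        rintro rfl
        exact hx.2 (suffix_antisymm h1 hx.1)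
  flag q := by
    rw [h.affected, hI.flag]
    constructor
    · rintro ⟨⟨h1, m, h2, h3⟩, h4⟩
      have hm : m ∉ Own c 0 := fun hm => h4 (own_readers hT m hm q ((hI.tab.sub m).subset h2))
      exact ⟨h1, m, h.keep m hm q h4 h2, by rwa [h.val m hm]⟩
    · rintro ⟨h1, m, h2, h3⟩
      obtain ⟨h4, h5⟩ := h.elems m q h2
      have hm : m ∉ Own c 0 := fun hm => h5 (own_readers hT m hm q ((hI.tab.sub m).subset h4))
      exact ⟨⟨h1, m, h4, by rwa [h.val m hm] at h3⟩, h5⟩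

theorem eq_of_map_some {vs vs' : List V} (h : vs.map some = vs'.map some) : vs = vs' :=
  List.map_injective_iff.2 (Option.some_injective V) h

/-- The span of change propagation per unit of span of the two runs. -/
def spanRate (T : Tree ι V) (K L : ℕ) : ℕ :=
  2 * T.height + L + 2 * K + 6 + (2 * (K * (1 + L) + 2) + 1)

/-- All arguments are already written in the new run, so the state holds the values vs' for them,
while F gives vs. By the invariant, the node is flagged exactly if these lists differ. If so,
destruction and re-execution are charged to the work and the nodes of both subtrees; if not, both
runs continue with the same reader program and the claim is that for its body. -/
theorem read_node_spec (hH : UniformHashing μ H)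
    (hT : ∀ x j, ∀ q ∈ T.readers (.dyn x j) [], q ∈ SBelow x) {c : Path}
    {E₀ : Set (Modifiable ι)} {σ₀ : Modifiable ι → Option V} {τ₀ : List (Modifiable ι × V)}
    {ms : List (Modifiable ι)} {f : List V → Prog ι V} {vs vs' : List V} {b b' : Body ι V}
    (hE : Outer E c 0) (hf : ∀ m ∈ Own c 0, σ m = none) (hms : ∀ m ∈ ms, m ∈ E)
    (hlen : ms.length ≤ K)
    (hF : ms.map F = vs.map some) (hσ : ms.map σ = vs'.map some)
    (h₀ : Eval E₀ σ₀ c 0 (f vs) b τ₀) (h : Eval E σ c 0 (f vs') b' τ)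
    (hK : b.ArityLe K) (hK' : b'.ArityLe K)
    (hb : vs = vs' → BodySpec μ H T F K L c 0 b b' E σ τ (spanRate T K L * (b.span + b'.span))) :
    NodeSpec μ H T F K L c (b.node (.R ms f vs)) (b'.node (.R ms f vs')) E σ τ
      ((K + 2) + spanRate T K L * (b.span + b'.span)) := by
  intro A D S hA hpre hpar
  have hσs : ∀ m ∈ ms, ∃ v, σ m = some v := by
    intro m hm
    have : σ m ∈ vs'.map some := hσ ▸ List.mem_map_of_mem hm
    obtain ⟨v, -, hv⟩ := List.mem_map.1 this
    exact ⟨v, hv.symm⟩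
  have hσne : ∀ m ∈ ms, σ m ≠ none := by
    intro m hm h1
    obtain ⟨v, hv⟩ := hσs m hm
    simp [hv] at h1
  have hval : ∀ m ∈ ms, S.val m = σ m := by
    intro m hm
    obtain ⟨v, hv⟩ := hσs m hm
    rw [hv]
    exact hpre.val m (hms m hm) v hv
  have hcm : ∀ m, c ∈ (S.tab m).elems ↔ m ∈ ms := by
    intro m
    rw [hpre.readers c List.suffix_rfl m, Body.mem_node_readers]
    constructor
    · rintro (⟨h1, -⟩ | h1)
      · exact h1
      · exact absurd (Body.readers_sBelow h1) (not_sBelow_self c)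
    · exact fun h1 => .inl ⟨h1, rfl⟩
  by_cases hc : c ∈ S.affected
  · obtain ⟨hcD, m₀, hm₀, hne₀⟩ := (hpre.inv.flag c).1 hc
    have hm₀' := (hcm m₀).1 hm₀
    have hvs : vs ≠ vs' := by
      rintro rfl
      rw [← hσ, List.map_inj_left] at hF
      exact hne₀ ((hval m₀ hm₀').trans (hF m₀ hm₀').symm)
    have hcA : c ∉ A := hpre.out c List.suffix_rfl
    have hp : ∀ x, x <:+ c → x ≠ c → x ∈ A := hpar.resolve_right fun h => h c hc List.suffix_rfl
    have hcmk : c ∈ S.marked := (hpre.inv.mark c).2 (.inr ⟨c, hc, List.suffix_rfl⟩)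
    obtain ⟨a1, a2, a3⟩ := h₀.allocsLe
    obtain ⟨d1, d2⟩ := destroy_children (L := L) hH hT hK a2 a3 hpre
    rw [Tree.visit_of_mem hcmk, Body.node, Tree.propagate, if_pos hc]
    simp only
    set x := b.l.destroy (false :: c) (S.dealloc c b.allocs) with hx
    set y := b.r.destroy (true :: c) x.1 with hy
    have hEO : ∀ m ∈ E, m ∉ Own c 0 := fun m hm => hE.not_own hm
    have hyI := d1.inv hT hpre.inv hpre.out hc
    have hyE : ∀ m ∈ E, y.1.val m = S.val m := fun m hm => d1.val m (hEO m hm)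
    have hyval : ∀ m ∈ E, ∀ v, σ m = some v → y.1.val m = some v := fun m hm v hv => by
      rw [hyE m hm]; exact hpre.val m hm v hv
    have hyown : ∀ m ∈ Own c 0, (y.1.tab m).elems = [] := by
      intro m hm
      rw [List.eq_nil_iff_forall_not_mem]
      intro q hq
      obtain ⟨h1, h2⟩ := d1.elems m q hq
      exact h2 (own_readers hT m hm q ((hpre.inv.tab.sub m).subset h1))
    rw [vals_eq hms hσ hyval]
    obtain ⟨e1, e2, w, e3, e4⟩ := exec_spec hH L K hA h hE hf hK'
      { inv := hyI
        val := hyval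
        new := fun m v hm hmE => .inl ((hyE m hmE).trans (hpre.new m v hm hmE))
        own := hyown
        safe := fun m v hm q hq => hpre.safe m v hm q (d1.elems m q hq).1 }
    set o := exec (f vs') c 0 y.1 with ho
    -- Re-execution only queues its insertions. Hence no reader set contains a node below c, and the
    -- region can be declared visited without changing the flags.
    have hnotin : ∀ m, ∀ q ∈ SBelow c, q ∉ (o.state.tab m).elems := by
      intro m q hq hq'
      by_cases hm : m ∈ Own c 0
      · rw [e2.own m hm] at hq'; simp at hq'
      · rw [e2.tab m hm] at hq'
        exact (d1.elems m q hq').2 hq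
    have hm₀O : m₀ ∉ Own c 0 := hEO m₀ (hms m₀ hm₀')
    -- The node stays registered with `m₀`, which was written before and so is not written again; it
    -- remains flagged until it is cleared, and may be added to the path.
    have hco : c ∈ o.state.affected := by
      refine (e2.inv.flag c).2 ⟨hcD, m₀, ?_, ?_⟩
      · rw [e2.tab m₀ hm₀O]
        exact d1.keep m₀ hm₀O c (not_sBelow_self c) hm₀
      · rw [e2.valN m₀ hm₀O fun v hv => hσne m₀ hm₀' (h.store_eq_none hv), d1.val m₀ hm₀O]
        exact hne₀
    have hI' : Inv T F (A ∪ {c}) (D ∪ SBelow c) o.state := by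
      refine ⟨e2.inv.tab, fun z => ?_, fun q => ?_⟩
      · rw [e2.inv.mark]
        constructor
        · rintro (h | h)
          · exact .inl (.inl h)
          · exact .inr h
        · rintro ((h | h) | h)
          · exact .inl h
          · rw [Set.mem_singleton_iff] at h
            rw [h]
            exact .inr ⟨c, hco, List.suffix_rfl⟩
          · exact .inr h
      · rw [e2.inv.flag]
        constructor
        · rintro ⟨h1, m, h2, h3⟩
          exact ⟨fun h4 => h4.elim h1 fun h5 => hnotin m q h5 h2, m, h2, h3⟩
        · rintro ⟨h1, h2⟩
          exact ⟨fun h4 => h1 (.inl h4), h2⟩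
    have hms' : ∀ m, m ∉ Own c 0 → ∀ q ∈ Below c, q ∈ (o.state.tab m).elems → m ∈ ms := by
      intro m hm q hq hq'
      rcases mem_below_iff.1 hq with rfl | h1
      · rw [e2.tab m hm] at hq'
        exact (hcm m).1 (d1.elems m q hq').1
      · exact absurd hq' (hnotin m q h1)
    rw [← Body.node, Body.affectedNodes_R_ne _ _ hvs, Body.gap_R_ne _ _ hvs, Body.spine_R_ne _ _ hvs]
    refine ⟨by rw [e1], ⟨clear_inv hI' (fun x => Iff.rfl) hcA hp, e2.valW, fun m hm hn => ?_,
      fun m hm q hq => ?_, fun m hm q hq => ?_, fun m hm q hq hq' => ?_, ?_, ?_⟩,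
      ⟨1 + b.allocs + ms.length + (1 + ((4 * K + 2) * b.l.nodes + b.l.work) +
        ((4 * K + 2) * b.r.nodes + b.r.work)) + w, ?_, ?_⟩, fun _ => Nat.one_pos⟩
    · exact (e2.valN m hm hn).trans (d1.val m hm)
    · change q ∈ (o.state.tab m).elems ↔ _
      rw [e2.tab m hm]
      exact ⟨fun h1 => (d1.elems m q h1).1, d1.keep m hm q fun h1 => hq h1.1⟩
    · change q ∈ (o.state.tab m).elems at hq
      rw [e2.tab m hm] at hq
      exact (d1.elems m q hq).1
    · exact .inl (hσne m (hms' m hm q hq hq'))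
    · obtain ⟨new, p1, p2, p3, -⟩ := e2.pend
      refine ⟨new, ?_, p2, fun z hz => ⟨(p3 z hz).1, fun m => hnotin m _ (p3 z hz)⟩⟩
      exact p1.trans (by rw [d1.pend])
    · obtain ⟨new, p1, p2, p3, p4⟩ := e2.pend
      have h1 := d1.dels
      have h2 : o.state.dels.length = y.1.dels.length := by rw [e2.dels]
      have h3 : o.state.pend.length = new.length + S.pend.length := by
        rw [p1, d1.pend, List.length_append]
      simp only [State.clear]
      rw [mul_add, mul_add, mul_add]
      omega
    · refine (((Cost.Bounded.tick _).add d2).add e3).mono le_rfl ?_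
      have h1 := h₀.parSpan_le (K * (1 + L) + 2)
      have h2 : (2 * (K * (1 + L) + 2) + 1) * b.span ≤ spanRate T K L * b.span :=
        Nat.mul_le_mul_right _ (by rw [spanRate]; omega)
      have h3 : (2 * T.height + L + 2 * K + 6) * b'.span ≤ spanRate T K L * b'.span :=
        Nat.mul_le_mul_right _ (by rw [spanRate]; omega)
      rw [mul_add (spanRate T K L)]
      omega
    -- Marks lost by destruction number at most the nodes destroyed, and one more is cleared at c;
    -- both are covered by the affected nodes.
    · have h1 := card_clear o.state c
      have h2 := d1.card
      simp only [Body.work, Body.nodes] at *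
      nlinarith
  · have hvs : vs = vs' := by
      refine eq_of_map_some ?_
      rw [← hF, ← hσ, List.map_inj_left]
      intro m hm
      rw [← hval m hm]
      by_contra hne
      exact hc ((hpre.inv.flag c).2 ⟨hpre.fresh c List.suffix_rfl, m, (hcm m).2 hm, fun h => hne h.symm⟩)
    subst hvs
    rw [Body.affectedNodes_R _ _ rfl, Body.gap_R _ _ rfl, Body.spine_R _ _ rfl]
    obtain ⟨h1, h2, ⟨w, h3, h3'⟩, h4⟩ := node_of_body (lab := .R ms f vs) (hb rfl) hA hpre hpar hc hσne
      rfl (by rw [Body.node, Tree.propagate, if_neg hc]; rfl)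
    exact ⟨h1, h2, ⟨w, h3.mono le_rfl (by omega), h3'⟩, fun h => by have := h4 h; omega⟩

end ReadNode

end

/-! ### Propagation through the body of a scope -/

section

variable {ι V : Type*} [DecidableEq V] [DecidableEq ι] [Inhabited V]

section BodySpec

variable {Ω : Type*} [MeasurableSpace Ω] {μ : Measure Ω} [IsProbabilityMeasure μ] {H : Ω → Hash}
  {T : Tree ι V} {F : Modifiable ι → Option V} {K L : ℕ} {A D : Set Path} {S S₁ S₂ : State ι V}
  {E : Set (Modifiable ι)} {σ : Modifiable ι → Option V}
  {τ τ₁ τ₂ : List (Modifiable ι × V)} {p : Path} {i : ℕ} {b b' : Body ι V}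

/-- Nothing below an empty scope is registered as a reader, so the region counts as visited at no
cost. -/
theorem body_done_spec : BodySpec μ H T F K L p i (⟨0, i, .nil, .nil⟩ : Body ι V) ⟨0, i, .nil, .nil⟩ E σ []
    0 := by
  have hv : ∀ (c : Path) (S : State ι V), (Tree.nil : Tree ι V).visit c S = (.nil, S, Cost.tick 0) := by
    intro c S
    rw [Tree.visit, Tree.propagate]
    exact ite_self _
  intro A D S hA hpre hpar
  simp only [hv]
  have hn : ∀ q ∈ SBelow p, ∀ m, q ∉ (S.tab m).elems := by
    intro q hq m hm
    have := (hpre.readers q hq m).1 hm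
    simp [Body.readers, Tree.readers] at this
  refine ⟨by simp, ⟨⟨hpre.inv.tab, hpre.inv.mark, fun q => ?_⟩, by simp, fun _ _ _ => rfl,
    fun _ _ _ _ => Iff.rfl, fun _ _ _ h => h, fun m _ q hq hq' => absurd hq' (hn q hq m),
    ⟨[], by simp⟩, by omega⟩, ⟨0, ((Cost.Bounded.tick 0).add (Cost.Bounded.tick 0)).mono le_rfl le_rfl,
      by simp⟩, ?_⟩
  · rw [hpre.inv.flag]
    constructor
    · rintro ⟨h1, m, h2, h3⟩
      exact ⟨fun h4 => h4.elim h1 fun h5 => hn q h5 m h2, m, h2, h3⟩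
    · rintro ⟨h1, h2⟩
      exact ⟨fun h4 => h1 (.inl h4), h2⟩
  · rintro ⟨q, hq, hq'⟩
    obtain ⟨-, m, h2, -⟩ := (hpre.inv.flag q).1 hq
    exact absurd h2 (hn q hq' m)

theorem BodySpec.tick {s s' : ℕ} (h : BodySpec μ H T F K L p i b b' E σ τ s) (hs : s ≤ s') :
    BodySpec μ H T F K L p i b.tick b'.tick E σ τ s' := by
  intro A D S hA hpre hpar
  obtain ⟨⟨h1, h2⟩, h3, ⟨w, h4, h5⟩, h6⟩ := h A D S hA hpre hpar
  exact ⟨⟨by simp only [Body.tick, h1], h2⟩, h3, ⟨w, h4.mono le_rfl hs, h5⟩, h6⟩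

theorem PropPost.mono_own {O O' : Set (Modifiable ι)} {R : Set Path} {N : ℕ}
    (h : PropPost T F A D O R σ τ N S S₁) (hO : O ⊆ O') : PropPost T F A D O' R σ τ N S S₁ where
  inv := h.inv
  valW m v hm hmO := h.valW m v hm fun h1 => hmO (hO h1)
  valN m hmO := h.valN m fun h1 => hmO (hO h1)
  tabOut m hmO := h.tabOut m fun h1 => hmO (hO h1)
  tabSub m hmO := h.tabSub m fun h1 => hmO (hO h1)
  rem m hmO := h.rem m fun h1 => hmO (hO h1)
  pend := h.pend
  count := h.count

/-- The strand of a reused scope is not run again. Both runs allocate the modifiable under the same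
name, and it keeps its value from the old run until then. -/
theorem BodySpec.alloc {s : ℕ} (h : BodySpec μ H T F K L p (i + 1) b b' (insert (.dyn p i) E) σ τ s)
    (hf : σ (.dyn p i) = none) : BodySpec μ H T F K L p i b b' E σ τ s := by
  intro A D S hA hpre hpar
  obtain ⟨h1, h3, h4⟩ := h A D S hA
    { inv := hpre.inv
      val := by
        rintro m (rfl | hm) v hv
        · simp [hf] at hv
        · exact hpre.val m hm v hv
      new := by
        rintro m v hm (rfl | hmE)
        · exact hpre.own _ (dyn_mem_own p i)
        · exact hpre.new m v hm hmE
      own := fun m hm => hpre.own m (own_succ_subset hm)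
      readers := hpre.readers
      fresh := hpre.fresh
      safe := hpre.safe
      out := hpre.out } hpar
  exact ⟨h1, h3.mono_own fun m => own_succ_subset, h4⟩

/-- A write in a reused strand has the same value v in both runs. The state already holds v as the
old value, so the write happens without any action and changes no flag. -/
theorem BodySpec.write {s : ℕ} {m : Modifiable ι} {v : V}
    (h : BodySpec μ H T F K L p i b b' E (Function.update σ m (some v)) τ s)
    (hmE : m ∈ E) (hE : Outer E p i) (hm : ∀ v', (m, v') ∉ τ) (hF : F m = some v) :
    BodySpec μ H T F K L p i b b' E σ ((m, v) :: τ) s := by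
  intro A D S hA hpre hpar
  have hmv : S.val m = some v := (hpre.new m v List.mem_cons_self hmE).trans hF
  obtain ⟨h1, h3, ⟨w, h4, h5⟩, h6⟩ := h A D S hA
    { inv := hpre.inv
      val := by
        intro m' hm' v' hv'
        by_cases hne : m' = m
        · subst hne; rw [Function.update_self] at hv'; rw [hmv, hv']
        · rw [Function.update_of_ne hne] at hv'
          exact hpre.val m' hm' v' hv'
      new := fun m' v' hm' => hpre.new m' v' (List.mem_cons_of_mem _ hm')
      own := hpre.own
      readers := hpre.readers
      fresh := hpre.fresh
      safe := fun m' v' hm' => hpre.safe m' v' (List.mem_cons_of_mem _ hm')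
      out := hpre.out } hpar
  refine ⟨h1, ⟨h3.inv, ?_, ?_, h3.tabOut, h3.tabSub, ?_, h3.pend, h3.count⟩, ⟨w, h4, ?_⟩, h6⟩
  · intro m' v' hm' hO
    rcases List.mem_cons.1 hm' with h | h
    · cases h
      rw [h3.valN m hO hm, hmv]
    · exact h3.valW m' v' h hO
  · exact fun m' hO hm' => h3.valN m' hO fun v' h => hm' v' (List.mem_cons_of_mem _ h)
  · intro m' hO q hq hq'
    by_cases hne : m' = m
    · exact .inr ⟨v, by rw [hne]; exact List.mem_cons_self⟩
    · refine (h3.rem m' hO q hq hq').imp (fun h => ?_) fun ⟨v', h⟩ => ⟨v', List.mem_cons_of_mem _ h⟩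
      rwa [Function.update_of_ne hne] at h
  · rw [changeCost_cons, if_pos hF]
    omega

theorem body_of_children (hT : ∀ x j, ∀ q ∈ T.readers (.dyn x j) [], q ∈ SBelow x)
    {t₁ t₁' t₂ t₂' : Tree ι V} {s₁ s₂ s : ℕ} {n a : ℕ}
    (hs : Split E σ (Own (false :: p) 0) (Own (true :: p) 0) τ₁ τ₂)
    (n₁ : NodeSpec μ H T F K L (false :: p) t₁ t₁' E σ τ₁ s₁)
    (n₂ : NodeSpec μ H T F K L (true :: p) t₂ t₂' E (writes σ τ₁) τ₂ s₂) (hss : s₁ + s₂ ≤ s) :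
    BodySpec μ H T F K L p i ⟨n, a, t₁, t₂⟩ ⟨n, a, t₁', t₂'⟩ E σ (τ₁ ++ τ₂) s := by
  intro A D S hA hpre hpar
  obtain ⟨h1, h2, ⟨⟨w₁, c1, c2⟩, ⟨w₂, c3, c4⟩⟩, h4, -⟩ := visit_pair hT (O := Own p i) (R := SBelow p) hs
    (fun m v => writes_eq_some) n₁ n₂ (fun q => mem_sBelow_iff)
    (fun q hq => below_disjoint (by simp) hq) (fun m => own_cons_subset) (fun m => own_cons_subset)
    (fun x => List.mem_append) hA hpre
    (fun q hq m => by
      rw [Body.mem_readers]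
      exact ⟨fun h => h.resolve_right fun h1 =>
        below_disjoint (by simp) hq (Tree.readers_below h1), .inl⟩)
    (fun q hq m => by
      rw [Body.mem_readers]
      exact ⟨fun h => h.resolve_left fun h1 =>
        below_disjoint (by simp) hq (Tree.readers_below h1), .inr⟩)
    (hpar.imp_left fun h x hx => hA x p (by
        rcases hx with ⟨h1, h2⟩ | ⟨h1, h2⟩
        · exact (List.suffix_cons_iff.1 h1).resolve_left h2
        · exact (List.suffix_cons_iff.1 h1).resolve_left h2) h)
  refine ⟨⟨rfl, rfl, h1⟩, h2, ⟨w₁ + w₂, (c1.add c3).mono le_rfl hss, ?_⟩, h4⟩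
  rw [changeCost_append, Body.gap]
  simp only at c2 c4 ⊢
  rw [mul_add (4 * K + 6)]
  omega

/-- Change propagation in the scope of a node agrees with the execution from scratch. -/
theorem body_spec (hH : UniformHashing μ H)
    (hT : ∀ x j, ∀ q ∈ T.readers (.dyn x j) [], q ∈ SBelow x)
    {σ₀ : Modifiable ι → Option V} {P : Prog ι V} {τ₀ : List (Modifiable ι × V)}
    (h₀ : Eval E σ₀ p i P b τ₀) (h : Eval E σ p i P b' τ) (hE : Outer E p i)
    (hf : ∀ m ∈ Own p i, σ m = none) (hF : ∀ m v, σ₀ m = some v → F m = some v)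
    (hFτ : ∀ m v, (m, v) ∈ τ₀ → F m = some v) (hK : b.ArityLe K) (hK' : b'.ArityLe K) :
    BodySpec μ H T F K L p i b b' E σ τ (spanRate T K L * (b.span + b'.span)) := by
  -- A read or fork contributes one unit to the span of each of the two runs; these two units pay
  -- for the fixed overhead of visiting its nodes.
  have hQ : K + 10 ≤ 2 * spanRate T K L := by rw [spanRate]; nlinarith
  -- Both runs execute the same program, so inverting the new run yields the same constructor. Only
  -- the values received by a reader may differ, and then the induction hypothesis for the reader is
  -- not used.
  induction h₀ generalizing σ b' τ with
  | done =>
    cases h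
    simpa [Body.span, Tree.span] using body_done_spec
  | step _ ih =>
    cases h with
    | step h =>
    exact (ih h hE hf hF hFτ hK hK').tick (Nat.mul_le_mul_left _ (by simp [Body.span, Body.tick]; omega))
  | @alloc E σ₀ p i _ _ _ _ ih =>
    cases h with
    | alloc h =>
    exact ((ih h hE.insert (fun m hm => hf m (own_succ_subset hm)) hF hFτ hK hK').alloc
      (hf _ (dyn_mem_own p i))).tick (Nat.mul_le_mul_left _ (by simp [Body.span, Body.tick]; omega))
  | @write E σ₀ p i m v _ _ _ _ _ _ ih =>
    cases h with
    | write hmE hmn h =>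
    have hFm := hFτ m v List.mem_cons_self
    refine ((ih h hE (fun m' hm' => ?_) (fun m' v' hv' => ?_)
      (fun m' v' hm' => hFτ m' v' (List.mem_cons_of_mem _ hm')) hK hK').write hmE hE (fun v' h1 => ?_)
      hFm).tick (Nat.mul_le_mul_left _ (by simp [Body.span, Body.tick]; omega))
    · rw [Function.update_of_ne]
      · exact hf m' hm'
      · rintro rfl; exact hE.not_own hmE hm'
    · by_cases hne : m' = m
      · subst hne; rw [Function.update_self] at hv'; rw [hFm, hv']
      · rw [Function.update_of_ne hne] at hv'
        exact hF m' v' hv'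
    · have := h.store_eq_none h1
      simp at this
  | @read E σ₀ p i ms f k vs b₁ τ₁ b₂ τ₂ hms hvs h₁ h₂ ih₁ ih₂ =>
    cases h with
    | @read _ _ _ _ _ _ _ vs' b₁' τ₁' b₂' τ₂' hms' hvs' h₁' h₂' =>
    have hs : Split E σ (Own (false :: p) 0) (Own (true :: p) 0) τ₁' τ₂' :=
      .of_seq hE (by simp) (fun m v hm => h₁'.mem_outer_or_own hm) (fun m v hm => h₁'.store_eq_none hm) h₂'
    have hf₁ : ∀ m ∈ Own (false :: p) 0, σ m = none := fun m hm => hf m (own_cons_subset hm)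
    have hf₂ : ∀ m ∈ Own (true :: p) 0, σ m = none := fun m hm => hf m (own_cons_subset hm)
    have hFτ₁ : ∀ m v, (m, v) ∈ τ₁ → F m = some v := fun m v hm => hFτ m v (List.mem_append_left _ hm)
    have hFms : ms.map F = vs.map some := by
      rw [← hvs, List.map_inj_left]
      intro m hm
      have : σ₀ m ∈ vs.map some := hvs ▸ List.mem_map_of_mem hm
      obtain ⟨v, -, hv⟩ := List.mem_map.1 this
      rw [← hv]
      exact hF m v hv.symm
    refine body_of_children hT hs
      (read_node_spec hH hT (hE.cons _) hf₁ hms hK.1.1 hFms hvs' h₁ h₁' hK.1.2 hK'.1.2 fun hv => ?_)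
      (seq_node_spec (ih₂ h₂' (hE.cons _) (fresh_writes hs hf₂) (fun m v hv => ?_)
        (fun m v hm => hFτ m v (List.mem_append_right _ hm)) hK.2.2 hK'.2.2)) ?_
    -- With equal values, both runs apply the reader function to the same list and the two reader
    -- programs coincide.
    · subst hv
      exact ih₁ h₁' (hE.cons _) hf₁ hF hFτ₁ hK.1.2 hK'.1.2
    · exact (writes_eq_some hv).elim (hF m v) (hFτ₁ m v)
    · rw [Body.read_span, Body.read_span]
      nlinarith
  | @par E σ₀ p i a c k ba τa bb τb bk τk h₁ h₂ hd h₃ ih₁ ih₂ ih₃ =>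
    cases h with
    | @par _ _ _ _ _ _ _ ba' τa' bb' τb' bk' τk' h₁' h₂' hd' h₃' =>
    have hs₁ := Split.of_par (hE.cons false) h₁' h₂' hd'
    have hs : Split E σ (Own (false :: p) 0) (Own (true :: p) 0) (τa' ++ τb') τk' := by
      refine .of_seq hE (by simp) (fun m v hm => ?_) (fun m v hm => ?_) h₃'
      · rcases List.mem_append.1 hm with hm | hm
        · exact (h₁'.mem_outer_or_own hm).imp_right own_cons_subset
        · exact (h₂'.mem_outer_or_own hm).imp_right own_cons_subset
      · rcases List.mem_append.1 hm with hm | hm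
        · exact h₁'.store_eq_none hm
        · exact h₂'.store_eq_none hm
    have hf₁ : ∀ m ∈ Own (false :: p) 0, σ m = none := fun m hm => hf m (own_cons_subset hm)
    have hf₂ : ∀ m ∈ Own (true :: p) 0, σ m = none := fun m hm => hf m (own_cons_subset hm)
    have hFa : ∀ m v, (m, v) ∈ τa → F m = some v := fun m v hm =>
      hFτ m v (List.mem_append_left _ (List.mem_append_left _ hm))
    have hFb : ∀ m v, (m, v) ∈ τb → F m = some v := fun m v hm =>
      hFτ m v (List.mem_append_left _ (List.mem_append_right _ hm))
    have hsp : ∀ x y : ℕ, x ≤ max ba.span bb.span → y ≤ max ba'.span bb'.span →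
        1 + spanRate T K L * (x + y) ≤
          1 + spanRate T K L * (max ba.span bb.span + max ba'.span bb'.span) := fun x y hx hy =>
      Nat.add_le_add_left (Nat.mul_le_mul_left _ (Nat.add_le_add hx hy)) 1
    refine body_of_children hT hs
      (par_node_spec hT hs₁
        ((seq_node_spec (ih₁ h₁' ((hE.cons _).cons _) (fun m hm => hf₁ m (own_cons_subset hm)) hF hFa
          hK.1.2.1.2 hK'.1.2.1.2)).mono (hsp _ _ (le_max_left _ _) (le_max_left _ _)))
        ((seq_node_spec (ih₂ h₂' ((hE.cons _).cons _) (fun m hm => hf₁ m (own_cons_subset hm)) hF hFb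
          hK.1.2.2.2 hK'.1.2.2.2)).mono (hsp _ _ (le_max_right _ _) (le_max_right _ _))))
      (seq_node_spec (ih₃ h₃' (hE.cons _) (fresh_writes hs hf₂) (fun m v hv => ?_)
        (fun m v hm => hFτ m v (List.mem_append_right _ hm)) hK.2.2 hK'.2.2)) ?_
    · rcases writes_eq_some hv with h | h
      · exact hF m v h
      · exact (List.mem_append.1 h).elim (hFa m v) (hFb m v)
    · rw [Body.par_span, Body.par_span]
      nlinarith

end BodySpec

end

section

variable {ι V : Type*} [DecidableEq V]

/-! ### Comparison of two runs -/

namespace Tree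

/-- The modifiables that are read in those subtrees of the first tree which belong to affected
reads. -/
def affectedMods : Tree ι V → Tree ι V → List (Modifiable ι)
  | node (.R ms f vs) s a l r, node (.R ms' f' vs') s' a' l' r' =>
      if vs ≠ vs' then (node (.R ms f vs) s a l r).mods
      else affectedMods l l' ++ affectedMods r r'
  | node _ _ _ l r, node _ _ _ l' r' => affectedMods l l' ++ affectedMods r r'
  | _, _ => []

theorem affectedMods_length_le {K : ℕ} {t t' : Tree ι V} (h : t.ArityLe K) :
    (t.affectedMods t').length ≤ K * t.affectedNodes t' := by
  induction t generalizing t' with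
  | nil => simp [affectedMods]
  | node lab s a l r ihl ihr =>
    have hl := fun t' => ihl (t' := t') h.2.1
    have hr := fun t' => ihr (t' := t') h.2.2
    have hm := mods_length_le h
    cases t' with
    | nil => cases lab <;> simp [affectedMods]
    | node lab' s' a' l' r' =>
      have h1 := hl l'
      have h2 := hr r'
      have h3 : (affectedMods l l' ++ affectedMods r r').length ≤
          K * (affectedNodes l l' + affectedNodes r r') := by
        rw [List.length_append, mul_add]; omega
      cases lab <;> cases lab' <;> simp only [affectedMods, affectedNodes] <;> try exact h3
      split_ifs
      · rw [mul_add]; exact hm.trans (Nat.le_add_right _ _)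
      · exact h3

theorem affectedNodes_le (t t' : Tree ι V) : t.affectedNodes t' ≤ t.nodes + t'.nodes := by
  induction t generalizing t' with
  | nil => simp [affectedNodes]
  | node lab s a l r ihl ihr =>
    cases t' with
    | nil => cases lab <;> simp [affectedNodes]
    | node lab' s' a' l' r' =>
      have h1 := ihl l'
      have h2 := ihr r'
      cases lab <;> cases lab' <;> simp only [affectedNodes, nodes] <;> try omega
      split_ifs <;> omega

theorem affectedNodes_comm (t t' : Tree ι V) : t.affectedNodes t' = t'.affectedNodes t := by
  induction t generalizing t' with
  | nil => cases t' with
    | nil => rfl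
    | node lab => cases lab <;> rfl
  | node lab s a l r ihl ihr =>
    cases t' with
    | nil => cases lab <;> rfl
    | node lab' s' a' l' r' =>
      have h1 := ihl l'
      have h2 := ihr r'
      cases lab <;> cases lab' <;> simp only [affectedNodes, h1, h2]
      rw [add_comm (nodes _), ite_congr (propext ne_comm) (fun _ => rfl) fun _ => rfl]

theorem dist_comm (t t' : Tree ι V) : t.dist t' = t'.dist t := by
  induction t generalizing t' with
  | nil => cases t' with
    | nil => rfl
    | node lab => cases lab <;> rfl
  | node lab s a l r ihl ihr =>
    cases t' with
    | nil => cases lab <;> rfl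
    | node lab' s' a' l' r' =>
      have h1 := ihl l'
      have h2 := ihr r'
      cases lab <;> cases lab' <;> simp only [dist, h1, h2]
      rw [add_comm (work _), ite_congr (propext ne_comm) (fun _ => rfl) fun _ => rfl]

/-! ### The number of affected reads -/

theorem finite_positions (t : Tree ι V) : {q | (t.sub q).kind ≠ none}.Finite := by
  induction t with
  | nil =>
    refine Set.Finite.subset Set.finite_empty fun q hq => ?_
    cases q <;> simp [sub, kind] at hq
  | node lab s a l r ihl ihr =>
    refine (((ihl.image (List.cons false)).union (ihr.image (List.cons true))).insert []).subset ?_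
    rintro (_ | ⟨d, q⟩) hq
    · exact .inl rfl
    · right
      cases d
      · exact .inl ⟨q, hq, rfl⟩
      · exact .inr ⟨q, hq, rfl⟩

theorem finite_affected (t t' : Tree ι V) : {q | Affected t t' q}.Finite :=
  t.finite_positions.subset fun q hq => by
    have := hq.1.1.2
    simp [this]

theorem cognate_cons {lab lab' : Label ι V} {s a s' a' : ℕ} {l r l' r' : Tree ι V} (d : Bool)
    {q : List Bool} (hk : lab.kind = lab'.kind) :
    Cognate (node lab s a l r) (node lab' s' a' l' r') (d :: q) ↔
      Cognate (if d then r else l) (if d then r' else l') q := by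
  have hs : ∀ (lab : Label ι V) s a (l r : Tree ι V) q,
      (node lab s a l r).sub (d :: q) = (if d then r else l).sub q := by
    intro lab s a l r q
    cases d <;> rfl
  rw [Cognate, Cognate, hs]
  refine and_congr_left fun _ => ⟨fun h q₀ hq => ?_, fun h q₀ hq => ?_⟩
  · have := h (d :: q₀) (by simpa using hq)
    rwa [hs, hs] at this
  · rcases q₀ with _ | ⟨e, q₀⟩
    · simp [sub, kind, hk]
    · obtain ⟨rfl, hq'⟩ := List.cons_prefix_cons.1 hq
      rw [hs, hs]
      exact h q₀ hq'

theorem differ_cons {lab lab' : Label ι V} {s a s' a' : ℕ} {l r l' r' : Tree ι V} (d : Bool)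
    {q : List Bool} (hk : lab.kind = lab'.kind) :
    Differ (node lab s a l r) (node lab' s' a' l' r') (d :: q) ↔
      Differ (if d then r else l) (if d then r' else l') q := by
  rw [Differ, Differ, cognate_cons d hk]
  cases d <;> rfl

theorem affected_cons {lab lab' : Label ι V} {s a s' a' : ℕ} {l r l' r' : Tree ι V} (d : Bool)
    {q : List Bool} (hk : lab.kind = lab'.kind)
    (hn : ¬ Differ (node lab s a l r) (node lab' s' a' l' r') [])
    (h : Affected (if d then r else l) (if d then r' else l') q) :
    Affected (node lab s a l r) (node lab' s' a' l' r') (d :: q) := by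
  refine ⟨(differ_cons d hk).2 h.1, fun q₀ hq hne => ?_⟩
  rcases q₀ with _ | ⟨e, q₀⟩
  · exact hn
  · obtain ⟨rfl, hq'⟩ := List.cons_prefix_cons.1 hq
    rw [differ_cons e hk]
    exact h.2 q₀ hq' fun h1 => hne (by rw [h1])

/-- Affected pairs of the two child trees, prefixed by different branches, are distinct affected
pairs of the whole; no pair is subsumed by the root, which does not differ. -/
theorem numAffected_node {lab lab' : Label ι V} {s a s' a' : ℕ} {l r l' r' : Tree ι V}
    (hk : lab.kind = lab'.kind) (hn : ¬ Differ (node lab s a l r) (node lab' s' a' l' r') []) :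
    l.numAffected l' + r.numAffected r' ≤
      (node lab s a l r).numAffected (node lab' s' a' l' r') := by
  rw [numAffected, numAffected, ← Set.ncard_image_of_injective _ (List.cons_injective (a := false)),
    ← Set.ncard_image_of_injective {q | Affected r r' q} (List.cons_injective (a := true)),
    ← Set.ncard_union_eq ?_ ((finite_affected l l').image _) ((finite_affected r r').image _)]
  · refine Set.ncard_le_ncard ?_ (finite_affected _ _)
    rintro _ (⟨q, hq, rfl⟩ | ⟨q, hq, rfl⟩)
    · exact affected_cons false hk hn hq
    · exact affected_cons true hk hn hq
  · rw [Set.disjoint_left]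
    rintro _ ⟨q, -, rfl⟩ ⟨q', -, h⟩
    simp at h

/-- Every node of the spine lies on the path to an affected read, and such a path has at most as
many nodes as the height. In the induction, the node itself is counted only if something below it is
affected, and then there is room for one more level. -/
theorem spine_le (t t' : Tree ι V) : t.spine t' ≤ t.numAffected t' * t.height := by
  induction t generalizing t' with
  | nil => simp [spine]
  | node lab s a l r ihl ihr =>
    cases t' with
    | nil => cases lab <;> simp [spine]
    | node lab' s' a' l' r' =>
      have hrec : lab.kind = lab'.kind →
          ¬ Differ (node lab s a l r) (node lab' s' a' l' r') [] →
          (spine l l' + spine r r') + min 1 (spine l l' + spine r r') ≤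
            (node lab s a l r).numAffected (node lab' s' a' l' r') * (node lab s a l r).height := by
        intro hk hn
        have h1 := numAffected_node hk hn
        have h2 := (ihl l').trans (Nat.mul_le_mul_left _ (le_max_left l.height r.height))
        have h3 := (ihr r').trans (Nat.mul_le_mul_left _ (le_max_right l.height r.height))
        set N := (node lab s a l r).numAffected (node lab' s' a' l' r')
        set x := spine l l' + spine r r' with hx
        rw [height]
        have h4 : x ≤ N * max l.height r.height := by
          refine le_trans ?_ (Nat.mul_le_mul_right _ h1)
          rw [add_mul]; omega
        have h5 : min 1 x ≤ N := by
          rcases Nat.eq_zero_or_pos N with h0 | h0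
          · rw [h0, zero_mul] at h4; omega
          · omega
        rw [mul_add, mul_one]
        omega
      have hS : lab.kind ≠ .R → ¬ Differ (node lab s a l r) (node lab' s' a' l' r') [] := by
        intro h1 h2
        have := h2.1.2
        simp only [sub, kind, Option.some.injEq] at this
        exact h1 this
      cases lab <;> cases lab' <;> simp only [spine]
      all_goals try exact Nat.zero_le _
      · exact hrec rfl (hS (by simp [Label.kind]))
      · exact hrec rfl (hS (by simp [Label.kind]))
      · split_ifs with hv
        · refine Nat.mul_pos ((Set.ncard_pos (finite_affected _ _)).2 ⟨[], ?_⟩)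
            (by rw [height]; omega)
          exact ⟨⟨⟨fun q₀ hq => by rw [List.prefix_nil.1 hq]; rfl, rfl⟩, hv⟩,
            fun q₀ hq hne => absurd (List.prefix_nil.1 hq) hne⟩
        · exact hrec rfl fun h => hv h.2

end Tree

namespace Body

def dist (b b' : Body ι V) : ℕ := b.l.dist b'.l + b.r.dist b'.r

def affectedMods (b b' : Body ι V) : List (Modifiable ι) :=
  b.l.affectedMods b'.l ++ b.r.affectedMods b'.r

theorem affectedMods_S (b b' : Body ι V) :
    (b.node .S).affectedMods (b'.node .S) = b.affectedMods b' := by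
  simp [node, Tree.affectedMods, affectedMods]

theorem affectedMods_par (i : ℕ) (a c k a' c' k' : Body ι V) :
    (Body.par i a c k).affectedMods (.par i a' c' k') =
      a.affectedMods a' ++ c.affectedMods c' ++ k.affectedMods k' := by
  simp [Body.par, node, Tree.affectedMods, affectedMods]

theorem affectedNodes_par (i : ℕ) (a c k a' c' k' : Body ι V) :
    (Body.par i a c k).affectedNodes (.par i a' c' k') =
      a.affectedNodes a' + c.affectedNodes c' + k.affectedNodes k' := by
  simp [Body.par, node, Tree.affectedNodes, affectedNodes]

theorem dist_par (i : ℕ) (a c k a' c' k' : Body ι V) :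
    (Body.par i a c k).dist (.par i a' c' k') = a.dist a' + c.dist c' + k.dist k' := by
  simp [Body.par, node, Tree.dist, dist]

theorem le_spine_par (i : ℕ) (a c k a' c' k' : Body ι V) :
    a.spine a' + c.spine c' + k.spine k' ≤ (Body.par i a c k).spine (.par i a' c' k') := by
  have h : (Body.par i a c k).spine (.par i a' c' k') =
      (Tree.node .P 0 0 (a.node .S) (c.node .S)).spine (.node .P 0 0 (a'.node .S) (c'.node .S)) +
        (k.node .S).spine (k'.node .S) := rfl
  rw [h, spine_S, Tree.spine_P, spine_S, spine_S]
  omega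

end Body

variable [DecidableEq ι]

theorem Body.readers_S (b : Body ι V) (m : Modifiable ι) (p : Path) :
    (b.node .S).readers m p = b.readers m p := by
  rw [Body.node_readers, if_neg (by simp [Label.mods])]; rfl

theorem Body.readers_par (i : ℕ) (a c k : Body ι V) (m : Modifiable ι) (p : Path) :
    (Body.par i a c k).readers m p = a.readers m (false :: false :: p) ++
      c.readers m (true :: false :: p) ++ k.readers m (true :: p) := by
  rw [Body.readers, Body.par]
  simp only [Tree.readers, Body.readers_S, Label.mods]
  simp

/-- Everything is decided at reads. If the values agree, the final stores agree on the arguments, so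
a modifiable with different final values is read inside affected subtrees only. If they differ, the
writes of the reader go into X and are bounded by its work, and the nodes are at most four times the
work plus the two roots, of which each affected pair on the spine pays for its own. -/
theorem Eval.compare {E : Set (Modifiable ι)} {σ σ' F F' : Modifiable ι → Option V} {p : Path} {i : ℕ}
    {P : Prog ι V} {b b' : Body ι V} {τ τ' : List (Modifiable ι × V)}
    (h : Eval E σ p i P b τ) (h' : Eval E σ' p i P b' τ')
    (hF : ∀ m v, σ m = some v → F m = some v) (hFτ : ∀ m v, (m, v) ∈ τ → F m = some v)
    (hF' : ∀ m v, σ' m = some v → F' m = some v) (hFτ' : ∀ m v, (m, v) ∈ τ' → F' m = some v) :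
    (∀ m, F m ≠ F' m → (b.readers m p).length ≤ (b.affectedMods b').count m) ∧
    (∃ X : List (Modifiable ι × V), X.length ≤ b.dist b' ∧ ∀ x ∈ τ, x ∈ X ∨ x ∈ τ') ∧
    b.affectedNodes b' ≤ 4 * b.dist b' + 2 * b.spine b' ∧ (b.spine b' = 0 → b.dist b' = 0) := by
  induction h generalizing σ' b' τ' with
  | done =>
    cases h'
    exact ⟨by simp [Body.readers, Tree.readers], ⟨[], by simp⟩, by
      simp [Body.affectedNodes, Tree.affectedNodes, Body.dist, Tree.dist]⟩
  | step _ ih =>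
    cases h' with
    | step h' =>
    have := ih h' hF hFτ hF' hFτ'
    exact this
  | alloc _ ih =>
    cases h' with
    | alloc h' =>
    have := ih h' hF hFτ hF' hFτ'
    exact this
  | @write E σ p i m v _ _ _ _ _ _ ih =>
    cases h' with
    | write _ _ h' =>
    have hup : ∀ {ρ G : Modifiable ι → Option V}, (∀ m v, ρ m = some v → G m = some v) →
        G m = some v → ∀ m' v', Function.update ρ m (some v) m' = some v' → G m' = some v' := by
      intro ρ G hG hm m' v' hv'
      by_cases hne : m' = m
      · subst hne
        rw [Function.update_self] at hv'
        rw [hm, hv']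
      · rw [Function.update_of_ne hne] at hv'
        exact hG m' v' hv'
    obtain ⟨h1, ⟨X, h2, h3⟩, h4, h5⟩ := ih h' (hup hF (hFτ m v List.mem_cons_self))
      (fun m' v' hm' => hFτ m' v' (List.mem_cons_of_mem _ hm'))
      (hup hF' (hFτ' m v List.mem_cons_self))
      (fun m' v' hm' => hFτ' m' v' (List.mem_cons_of_mem _ hm'))
    refine ⟨h1, ⟨X, h2, fun x hx => ?_⟩, h4, h5⟩
    rcases List.mem_cons.1 hx with rfl | hx
    · exact .inr List.mem_cons_self
    · exact (h3 x hx).imp_right (List.mem_cons_of_mem _)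
  | @read E σ p i ms f k vs b₁ τ₁ b₂ τ₂ hms hvs h₁ h₂ ih₁ ih₂ =>
    cases h' with
    | @read _ _ _ _ _ _ _ vs' b₁' τ₁' b₂' τ₂' hms' hvs' h₁' h₂' =>
    obtain ⟨k1, ⟨X₂, k2, k3⟩, k4, k5⟩ := ih₂ h₂'
      (fun m v hv => (writes_eq_some hv).elim (hF m v) fun h => hFτ m v (List.mem_append_left _ h))
      (fun m v hm => hFτ m v (List.mem_append_right _ hm))
      (fun m v hv => (writes_eq_some hv).elim (hF' m v) fun h => hFτ' m v (List.mem_append_left _ h))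
      (fun m v hm => hFτ' m v (List.mem_append_right _ hm))
    have hR : (∀ m, F m ≠ F' m → ((b₁.node (.R ms f vs)).readers m (false :: p)).length ≤
          ((b₁.node (.R ms f vs)).affectedMods (b₁'.node (.R ms f vs'))).count m) ∧
        (∃ X : List (Modifiable ι × V),
          X.length ≤ (b₁.node (.R ms f vs)).dist (b₁'.node (.R ms f vs')) ∧
          ∀ x ∈ τ₁, x ∈ X ∨ x ∈ τ₁') ∧
        (b₁.node (.R ms f vs)).affectedNodes (b₁'.node (.R ms f vs')) ≤
          4 * (b₁.node (.R ms f vs)).dist (b₁'.node (.R ms f vs')) +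
            2 * (b₁.node (.R ms f vs)).spine (b₁'.node (.R ms f vs')) ∧
        ((b₁.node (.R ms f vs)).spine (b₁'.node (.R ms f vs')) = 0 →
          (b₁.node (.R ms f vs)).dist (b₁'.node (.R ms f vs')) = 0) := by
      by_cases hv : vs = vs'
      · subst hv
        obtain ⟨j1, ⟨X₁, j2, j3⟩, j4, j5⟩ := ih₁ h₁' hF (fun m v hm => hFτ m v (List.mem_append_left _ hm))
          hF' (fun m v hm => hFτ' m v (List.mem_append_left _ hm))
        rw [Body.affectedNodes_R _ _ rfl, Body.dist_R _ _ rfl, Body.spine_R _ _ rfl]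
        refine ⟨fun m hm => ?_, ⟨X₁, j2, j3⟩, ?_, ?_⟩
        -- Equal values were read, and by writing once they are the final values in both runs.
        · have hmm : m ∉ ms := by
            intro hm'
            have h1 : σ m ∈ vs.map some := hvs ▸ List.mem_map_of_mem hm'
            obtain ⟨v, -, hv⟩ := List.mem_map.1 h1
            have h2 := (List.map_inj_left.1 (hvs.trans hvs'.symm)) m hm'
            exact hm ((hF m v hv.symm).trans (hF' m v (h2 ▸ hv.symm)).symm)
          have h1 := j1 m hm
          rw [Body.node_readers, if_neg (by simpa [Label.mods] using hmm)]
          simpa [Body.node, Tree.affectedMods, Body.affectedMods] using h1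
        · rw [Body.dist] at j4
          omega
        · rw [Body.dist] at j5
          omega
      · rw [Body.affectedNodes_R_ne _ _ hv, Body.dist_R_ne _ _ hv, Body.spine_R_ne _ _ hv]
        refine ⟨fun m _ => ?_, ⟨τ₁, ?_, fun x hx => .inl hx⟩, ?_, by omega⟩
        · have := Tree.readers_length_le_count m (b₁.node (.R ms f vs)) (false :: p)
          simpa [Body.node, Tree.affectedMods, hv] using this
        · have := h₁.length_le_work
          omega
        · have := h₁.nodes_le
          have := h₁'.nodes_le
          omega
    obtain ⟨j1, ⟨X₁, j2, j3⟩, j4, j5⟩ := hR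
    refine ⟨fun m hm => ?_, ⟨X₁ ++ X₂, ?_, fun x hx => ?_⟩, ?_, ?_⟩
    · have h1 := j1 m hm
      have h2 := k1 m hm
      simp only [Body.readers, Body.read, Body.affectedMods, List.length_append, List.count_append]
      rw [Body.affectedMods_S]
      rw [Body.readers_S]
      omega
    · rw [List.length_append, Body.dist, Body.read, Body.read, Body.dist_S]
      rw [Body.dist] at k2
      exact Nat.add_le_add j2 k2
    · simp only [List.mem_append] at hx ⊢
      rcases hx with hx | hx
      · rcases j3 x hx with h | h
        · exact .inl (.inl h)
        · exact .inr (.inl h)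
      · rcases k3 x hx with h | h
        · exact .inl (.inr h)
        · exact .inr (.inr h)
    · rw [Body.affectedNodes, Body.dist, Body.spine, Body.read, Body.read]
      simp only [Body.affectedNodes_S, Body.dist_S, Body.spine_S]
      rw [Body.dist] at k4
      omega
    · rw [Body.dist, Body.spine, Body.read, Body.read]
      simp only [Body.dist_S, Body.spine_S]
      rw [Body.dist] at k5
      omega
  | @par E σ p i a c k ba τa bb τb bk τk h₁ h₂ hd h₃ ih₁ ih₂ ih₃ =>
    cases h' with
    | @par _ _ _ _ _ _ _ ba' τa' bb' τb' bk' τk' h₁' h₂' hd' h₃' =>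
    obtain ⟨i1, ⟨X₁, i2, i3⟩, i4, i5⟩ := ih₁ h₁' hF
      (fun m v hm => hFτ m v (List.mem_append_left _ (List.mem_append_left _ hm))) hF'
      (fun m v hm => hFτ' m v (List.mem_append_left _ (List.mem_append_left _ hm)))
    obtain ⟨j1, ⟨X₂, j2, j3⟩, j4, j5⟩ := ih₂ h₂' hF
      (fun m v hm => hFτ m v (List.mem_append_left _ (List.mem_append_right _ hm))) hF'
      (fun m v hm => hFτ' m v (List.mem_append_left _ (List.mem_append_right _ hm)))
    obtain ⟨k1, ⟨X₃, k2, k3⟩, k4, k5⟩ := ih₃ h₃'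
      (fun m v hv => (writes_eq_some hv).elim (hF m v) fun h => hFτ m v (List.mem_append_left _ h))
      (fun m v hm => hFτ m v (List.mem_append_right _ hm))
      (fun m v hv => (writes_eq_some hv).elim (hF' m v) fun h => hFτ' m v (List.mem_append_left _ h))
      (fun m v hm => hFτ' m v (List.mem_append_right _ hm))
    have hsp := Body.le_spine_par i ba bb bk ba' bb' bk'
    rw [Body.affectedMods_par, Body.affectedNodes_par, Body.dist_par]
    refine ⟨fun m hm => ?_, ⟨X₁ ++ X₂ ++ X₃, ?_, fun x hx => ?_⟩, ?_, ?_⟩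
    · rw [Body.readers_par, List.length_append, List.length_append, List.count_append,
        List.count_append]
      exact Nat.add_le_add (Nat.add_le_add (i1 m hm) (j1 m hm)) (k1 m hm)
    · rw [List.length_append, List.length_append]
      exact Nat.add_le_add (Nat.add_le_add i2 j2) k2
    · simp only [List.mem_append] at hx ⊢
      rcases hx with (hx | hx) | hx
      · rcases i3 x hx with h | h
        · exact .inl (.inl (.inl h))
        · exact .inr (.inl (.inl h))
      · rcases j3 x hx with h | h
        · exact .inl (.inl (.inr h))
        · exact .inr (.inl (.inr h))
      · rcases k3 x hx with h | h
        · exact .inl (.inr h)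
        · exact .inr (.inr h)
    · omega
    · intro h0
      rw [i5 (by omega), j5 (by omega), k5 (by omega)]

end

section

variable {ι V : Type*} [DecidableEq ι]

theorem sum_count_le {α : Type*} [DecidableEq α] {l : List α} (hl : l.Nodup) (xs : List α) :
    (l.map fun a => xs.count a).sum ≤ xs.length := by
  induction l generalizing xs with
  | nil => simp
  | cons a l ih =>
    rw [List.nodup_cons] at hl
    have h1 := ih hl.2 (xs.filter (· ≠ a))
    have h2 : (l.map fun b => (xs.filter (· ≠ a)).count b) = l.map fun b => xs.count b := by
      refine List.map_congr_left fun b hb => List.count_filter ?_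
      simp only [ne_eq, decide_not, Bool.not_eq_eq_eq_not, Bool.not_true, decide_eq_false_iff_not]
      rintro rfl
      exact hl.1 hb
    rw [h2] at h1
    have h3 : xs.count a + (xs.filter (· ≠ a)).length = xs.length := by
      rw [List.count_eq_length_filter, List.length_eq_length_filter_add (l := xs) (· == a)]
      congr 2
      refine List.filter_congr fun b _ => ?_
      simp [beq_eq_decide]
    simp only [List.map_cons, List.sum_cons]
    omega

/-! ### Updating the reader sets -/

namespace State

/-- The insertions into the reader set of `m`. -/
def newReaders (S : State ι V) (m : Modifiable ι) : List Path :=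
  (S.pend.filter fun x => x.1 = m).map Prod.snd

/-- The modifiables whose reader sets have changed. -/
def touched (S : State ι V) : List (Modifiable ι) := (S.pend.map Prod.fst ++ S.dels).dedup

/-- The hash tables that are used in the update of the reader sets. -/
def flushTables (S : State ι V) : List Table :=
  S.touched.flatMap fun m =>
    (if ((S.tab m).elems ++ S.newReaders m).length ≤ 2 * (S.tab m).size then
      [⟨(S.tab m).size, (S.tab m).elems ++ S.newReaders m⟩] else []) ++
    [Table.fresh ((S.tab m).elems ++ S.newReaders m)]

theorem length_newReaders (S : State ι V) (m : Modifiable ι) :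
    (S.newReaders m).length = (S.pend.map Prod.fst).count m := by
  rw [newReaders, List.length_map, List.count_eq_countP, List.countP_map, List.countP_eq_length_filter]
  rfl

theorem nodup_newReaders {T : Tree ι V} {S : State ι V} (hI : TabOK T S) (hn : S.pend.Nodup)
    (hd : ∀ x ∈ S.pend, ∀ m, x.2 ∉ (S.tab m).elems) (m : Modifiable ι) :
    ((S.tab m).elems ++ S.newReaders m).Nodup := by
  rw [List.nodup_append']
  refine ⟨hI.nodup m, ?_, ?_⟩
  · refine List.Nodup.map_on ?_ (hn.filter _)
    intro x hx y hy h
    simp only [List.mem_filter, decide_eq_true_eq] at hx hy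
    exact Prod.ext (hx.2.trans hy.2.symm) h
  · intro q hq hq'
    obtain ⟨x, hx, rfl⟩ := List.mem_map.1 hq'
    exact hd x (List.mem_filter.1 hx).1 m hq

theorem length_touched_le (S : State ι V) : S.touched.length ≤ S.pend.length + S.dels.length := by
  refine (List.dedup_sublist _).length_le.trans ?_
  simp

theorem length_readers_le {T : Tree ι V} {S : State ι V} (hI : TabOK T S) (m : Modifiable ι) :
    ((S.tab m).elems ++ S.newReaders m).length ≤ T.nodes + S.pend.length := by
  have h1 := (hI.sub m).length_le
  have h2 := T.readers_length_le m []
  have h3 : (S.newReaders m).length ≤ S.pend.length := by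
    rw [length_newReaders]
    simpa using List.count_le_length (l := S.pend.map Prod.fst) (a := m)
  rw [List.length_append]
  omega

theorem size_le_nodes {T : Tree ι V} {S : State ι V} (hI : TabOK T S) (m : Modifiable ι) :
    (S.tab m).size ≤ T.nodes + 1 := by
  have h1 := hI.size_le m
  have h2 := T.readers_length_le m []
  omega

/-- The queued readers are distinct and absent from the current tables, so the combined contents
have no duplicates. This family is what the union bound has to cover in addition to the initial
tables. -/
theorem flushTables_spec {T : Tree ι V} {S : State ι V} (hI : TabOK T S) (hn : S.pend.Nodup)
    (hd : ∀ x ∈ S.pend, ∀ m, x.2 ∉ (S.tab m).elems) :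
    (∀ t ∈ S.flushTables, 1 ≤ t.size ∧ t.elems.Nodup ∧ t.elems.length ≤ 2 * t.size) ∧
    (S.flushTables.map Table.size).sum ≤
      (S.pend.length + S.dels.length) * (2 * (T.nodes + S.pend.length + 1)) := by
  constructor
  · intro t ht
    obtain ⟨m, -, ht⟩ := List.mem_flatMap.1 ht
    have hnd := nodup_newReaders hI hn hd m
    rcases List.mem_append.1 ht with ht | ht
    · split_ifs at ht with h
      · rw [List.mem_singleton] at ht
        subst ht
        exact ⟨hI.one_le m, hnd, h⟩
      · simp at ht
    · rw [List.mem_singleton] at ht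
      subst ht
      refine ⟨le_max_left _ _, hnd, ?_⟩
      simp only [Table.fresh]
      omega
  · refine le_trans ?_ (Nat.mul_le_mul_right _ S.length_touched_le)
    rw [flushTables]
    induction S.touched with
    | nil => simp
    | cons m l ih =>
      rw [List.flatMap_cons, List.map_append, List.sum_append, List.length_cons, add_mul, one_mul]
      have h1 := length_readers_le hI m
      have h2 := size_le_nodes hI m
      have h3 : max 1 ((S.tab m).elems ++ S.newReaders m).length ≤ T.nodes + S.pend.length + 1 := by
        omega
      rw [add_comm]
      refine Nat.add_le_add ih ?_
      rw [List.map_append, List.sum_append]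
      split_ifs
      · simp only [List.map_cons, List.map_nil, List.sum_cons, List.sum_nil, Table.fresh]
        omega
      · simp only [List.map_cons, List.map_nil, List.sum_cons, List.sum_nil, Table.fresh]
        omega

variable {Ω : Type*} [MeasurableSpace Ω] {μ : Measure Ω} [IsProbabilityMeasure μ] {H : Ω → Hash}

/-- A rebuild is paid for by the insertions and deletions that made it necessary. There are never
more keys than buckets beforehand, so a table becomes too full only by more insertions than it had
buckets. The number of buckets exceeds the number of keys by at most one more than the number of
deletions, so a table too sparse has lost a constant fraction of its size. -/
theorem insertAll_bounded (hH : UniformHashing μ H) {T : Tree ι V} {S : State ι V} (hI : TabOK T S)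
    (hn : S.pend.Nodup) (hd : ∀ x ∈ S.pend, ∀ m, x.2 ∉ (S.tab m).elems) {M L : ℕ}
    (hM : T.nodes + S.pend.length + S.dels.length + 1 ≤ 2 ^ M) {m : Modifiable ι}
    (hm : m ∈ S.touched) :
    ((S.tab m).insertAll (S.newReaders m)).2.Bounded μ H
      (fun g => TabGood T L g ∧ ∀ t ∈ S.flushTables, ∀ b, load t.size t.elems b g ≤ L)
      (20 * (1 + (S.pend.map Prod.fst).count m + S.dels.count m)) (6 + 3 * M + 2 * L) := by
  have hnd := nodup_newReaders hI hn hd m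
  have h1 := length_readers_le hI m
  have h2 := size_le_nodes hI m
  have h3 := S.length_newReaders m
  have h4 := hI.length_le m
  have h5 := hI.dels m
  have h6 := hI.one_le m
  have hlog : ∀ n, n ≤ T.nodes + S.pend.length + 1 → Nat.clog 2 n ≤ M := fun n hn =>
    (Nat.clog_le_iff_le_pow (by norm_num)).2 (by omega)
  rw [← h3]
  have hes : ((S.tab m).elems ++ S.newReaders m).length =
    (S.tab m).elems.length + (S.newReaders m).length := List.length_append
  have hmem : ∀ t, t ∈ (if ((S.tab m).elems ++ S.newReaders m).length ≤ 2 * (S.tab m).size then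
      [(⟨(S.tab m).size, (S.tab m).elems ++ S.newReaders m⟩ : Table)] else []) ++
      [Table.fresh ((S.tab m).elems ++ S.newReaders m)] → t ∈ S.flushTables := fun t ht =>
    List.mem_flatMap.2 ⟨m, hm, ht⟩
  rw [Table.insertAll]
  set es := (S.tab m).elems ++ S.newReaders m with hesd
  split_ifs with hc
  · have hp : ∀ q ∈ S.newReaders m, (Cost.probe (S.tab m).size es q).Bounded μ H
        (fun g => TabGood T L g ∧ ∀ t ∈ S.flushTables, ∀ b, load t.size t.elems b g ≤ L) 4 (1 + L) :=
      fun q _ => hH.probe_bounded h6 hnd hc.1 q fun g hg b =>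
        hg.2 ⟨(S.tab m).size, es⟩ (hmem _ (by rw [if_pos hc.1]; simp)) b
    refine ((Cost.Bounded.tick 1).add (Cost.Bounded.parFor_map hp)).mono ?_ ?_
    · simp only [List.map_const', List.sum_replicate, smul_eq_mul]
      omega
    · have := hlog (S.newReaders m).length (by omega)
      omega
  · have hp : ∀ q ∈ es, (Cost.probe (max 1 es.length) es q).Bounded μ H
        (fun g => TabGood T L g ∧ ∀ t ∈ S.flushTables, ∀ b, load t.size t.elems b g ≤ L) 4 (1 + L) :=
      fun q _ => hH.probe_bounded (le_max_left _ _) hnd (by omega) q fun g hg b =>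
        hg.2 (Table.fresh es) (hmem _ (by simp)) b
    have hscan := hH.scan_bounded (B := (S.tab m).size) (xs := (S.tab m).elems.map fun q => (q, 0))
      (L := L) (M := 0) (G := fun g => TabGood T L g ∧ ∀ t ∈ S.flushTables, ∀ b,
        load t.size t.elems b g ≤ L)
      (fun g hg b => by
        rw [List.map_map]
        simpa [Function.comp_def] using hI.load_le hg.1 m b)
      (by simp)
    have hrep : ∀ x ∈ List.range (max 1 es.length), (Cost.tick 1).Bounded μ H
        (fun g => TabGood T L g ∧ ∀ t ∈ S.flushTables, ∀ b, load t.size t.elems b g ≤ L) 1 1 :=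
      fun _ _ => Cost.Bounded.tick 1
    have hrep' := Cost.Bounded.parFor_map hrep
    rw [List.map_const', List.length_range] at hrep'
    refine ((((Cost.Bounded.tick 1).add hscan).add hrep').add (Cost.Bounded.parFor_map hp)).mono ?_ ?_
    · simp only [List.map_const', List.sum_replicate, smul_eq_mul, List.map_map, Function.comp_def,
        List.length_range]
      rw [not_and_or, not_le, not_le] at hc
      omega
    · have := hlog (S.tab m).size (by omega)
      have := hlog (max 1 es.length) (by omega)
      have := hlog es.length (by omega)
      omega

/-- Summed over the touched modifiables, the counts of insertions and deletions give their total
numbers, and the touched modifiables are at most as many: 20 + 20 for the tables and 1 for the loop.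
-/
theorem flush_bounded (hH : UniformHashing μ H) {T : Tree ι V} {S : State ι V} (hI : TabOK T S)
    (hn : S.pend.Nodup) (hd : ∀ x ∈ S.pend, ∀ m, x.2 ∉ (S.tab m).elems) {M L : ℕ}
    (hM : T.nodes + S.pend.length + S.dels.length + 1 ≤ 2 ^ M) :
    S.flush.2.Bounded μ H
      (fun g => TabGood T L g ∧ ∀ t ∈ S.flushTables, ∀ b, load t.size t.elems b g ≤ L)
      (1 + 41 * (S.pend.length + S.dels.length)) (7 + 4 * M + 2 * L) := by
  have h1 := S.length_touched_le
  have h2 : Nat.clog 2 S.touched.length ≤ M := (Nat.clog_le_iff_le_pow (by norm_num)).2 (by omega)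
  have hnd : S.touched.Nodup := List.nodup_dedup _
  have h3 := sum_count_le hnd (S.pend.map Prod.fst)
  have h4 := sum_count_le hnd S.dels
  refine (Cost.Bounded.parFor_map fun m hm => insertAll_bounded (L := L) hH hI hn hd hM hm).mono ?_
    (by omega)
  rw [List.sum_map_mul_left, List.sum_map_add, List.sum_map_add]
  rw [List.length_map] at h3
  simp only [List.map_const', List.sum_replicate, smul_eq_mul]
  omega

end State

end

section

variable {ι V : Type*} [DecidableEq ι]

/-! ### Two runs of a program -/

namespace Eval

variable {E : Set (Modifiable ι)} {σ : Modifiable ι → Option V} {p : Path} {i : ℕ} {A : Prog ι V}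
  {b : Body ι V} {τ : List (Modifiable ι × V)}

theorem writes_of_store (h : Eval E σ p i A b τ) {m : Modifiable ι} {v : V} (hm : σ m = some v) :
    writes σ τ m = some v := by
  rw [writes_of_notMem, hm]
  intro v' hv'
  simp [h.store_eq_none hv'] at hm

theorem writes_of_write (h : Eval E σ p i A b τ) {m : Modifiable ι} {v : V} (hm : (m, v) ∈ τ) :
    writes σ τ m = some v := writes_of_mem h.keys_nodup hm

theorem span_pos [DecidableEq V] (h : Eval E σ p i A b τ) {b' : Body ι V} (hb : 0 < b.spine b') :
    0 < b.span := by
  cases h with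
  | done => simp [Body.spine, Tree.spine] at hb
  | step _ => simp only [Body.tick, Body.span]; omega
  | alloc _ => simp only [Body.tick, Body.span]; omega
  | write _ _ _ => simp only [Body.tick, Body.span]; omega
  | read _ _ _ _ => rw [Body.read_span]; omega
  | par _ _ _ _ => rw [Body.par_span]; omega

end Eval

theorem outer_static (p : Path) (i : ℕ) :
    Outer (Set.range (Modifiable.static : ι → Modifiable ι)) p i := by
  rintro q j ⟨k, hk⟩
  simp at hk

theorem inputStore_eq_some {I : ι → Option V} {m : Modifiable ι} {v : V}
    (h : inputStore I m = some v) : ∃ i, m = .static i ∧ I i = some v := by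
  cases m with
  | static i => exact ⟨i, rfl, h⟩
  | dyn q j => simp [inputStore] at h

theorem static_injective : Function.Injective (Modifiable.static : ι → Modifiable ι) :=
  fun _ _ h => Modifiable.static.inj h

namespace Tree

theorem mem_mods_of_reads {t : Tree ι V} {m : Modifiable ι} (h : t.Reads m) : m ∈ t.mods := by
  induction t with
  | nil => exact absurd h (by simp [Reads])
  | node lab s a l r ihl ihr =>
    simp only [mods, List.mem_append]
    rcases h with h | h | h
    · simp [h]
    · simp [ihl h]
    · simp [ihr h]

theorem height_pos_of_spine [DecidableEq V] {t t' : Tree ι V} (h : 0 < t.spine t') : 0 < t.height := by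
  cases t with
  | nil => simp [spine] at h
  | node => rw [height]; omega

end Tree

namespace Runs

variable {A : Prog ι V} {I I' : ι → Option V} {τ τ' : List (Modifiable ι × V)} {T T' : Tree ι V}
  {K : ℕ}

theorem reads (h : Runs A I τ T) {i : ι} {v : V} (hi : I i = some v) : T.Reads (.static i) :=
  h.2 i (by simp [hi])

theorem ncard_le (h : Runs A I τ T) (hK : T.ArityLe K) : {i | I i ≠ none}.ncard ≤ K * T.nodes := by
  rw [← Set.ncard_image_of_injective _ static_injective]
  refine le_trans ?_ (T.mods_length_le hK)
  refine le_trans (Set.ncard_le_ncard (t := (T.mods.toFinset : Set (Modifiable ι))) ?_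
    (Finset.finite_toSet _)) ?_
  · rintro _ ⟨i, hi, rfl⟩
    simpa using T.mem_mods_of_reads (h.2 i hi)
  · rw [Set.ncard_coe_finset]
    exact List.toFinset_card_le _

variable [DecidableEq V]

theorem readers_sBelow (h : Runs A I τ T) :
    ∀ x j, ∀ q ∈ T.readers (.dyn x j) [], q ∈ SBelow x := by
  obtain ⟨⟨b, hb, rfl⟩, -⟩ := h
  intro x j q hq
  rw [Body.readers_S] at hq
  exact hb.reader_below (outer_static _ _) hq

theorem compare (h : Runs A I τ T) (h' : Runs A I' τ' T') :
    (∀ m, writes (inputStore I) τ m ≠ writes (inputStore I') τ' m →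
      (T.readers m []).length ≤ (T.affectedMods T').count m) ∧
    (∃ X : List (Modifiable ι × V), X.length ≤ T.dist T' ∧ ∀ x ∈ τ, x ∈ X ∨ x ∈ τ') ∧
    T.affectedNodes T' ≤ 4 * T.dist T' + 2 * T.spine T' ∧ (T.spine T' = 0 → T.dist T' = 0) := by
  obtain ⟨⟨b, hb, rfl⟩, -⟩ := h
  obtain ⟨⟨b', hb', rfl⟩, -⟩ := h'
  obtain ⟨h1, h2, h3, h4⟩ := hb.compare hb' (fun m v => hb.writes_of_store)
    (fun m v => hb.writes_of_write) (fun m v => hb'.writes_of_store) (fun m v => hb'.writes_of_write)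
  rw [Body.affectedMods_S, Body.dist_S, Body.affectedNodes_S, Body.spine_S]
  rw [Body.dist] at h2 h3 h4
  refine ⟨fun m hm => ?_, h2, by omega, fun h => h4 (by omega)⟩
  rw [Body.readers_S]
  exact h1 m hm

/-- Inputs that are changed or added are read by affected reads, or written by only one run. -/
theorem changed_input (h : Runs A I τ T) (h' : Runs A I' τ' T') :
    ∃ X : List (Modifiable ι × V), X.length ≤ T.dist T' ∧
      ∀ i v, I' i = some v → I i ≠ some v → .static i ∈ T'.affectedMods T ∨ (.static i, v) ∈ X := by
  obtain ⟨-, ⟨X, h1, h2⟩, -⟩ := h.compare h'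
  obtain ⟨h3, -⟩ := h'.compare h
  refine ⟨X, h1, fun i v hi hi' => ?_⟩
  have hr := T'.readers_ne_nil [] (h'.reads hi)
  obtain ⟨⟨b, hb, -⟩, -⟩ := h
  obtain ⟨⟨b', hb', -⟩, -⟩ := h'
  have hF' : writes (inputStore I') τ' (.static i) = some v := hb'.writes_of_store hi
  by_cases hF : writes (inputStore I) τ (.static i) = some v
  -- The old run wrote this value itself. In the new run the modifiable is an input and cannot be
  -- written, so the write is not shared.
  · right
    have hx : (Modifiable.static i, v) ∈ τ := (writes_eq_some hF).resolve_left hi'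
    refine (h2 _ hx).resolve_right fun h4 => ?_
    have h5 := hb'.store_eq_none h4
    simp [inputStore, hi] at h5
  · left
    have h4 := h3 (.static i) (by rw [hF']; exact fun h => hF h.symm)
    have h5 := List.length_pos_iff.2 hr
    exact List.count_pos_iff.1 (by omega)

/-- Without an affected read, the distance and the affected subtrees vanish and `changed_input`
leaves no room for a changed input. It is applied in both directions, since an input may also be
dropped. This is the place where the inputs are required to be read. -/
theorem spine_pos (h : Runs A I τ T) (h' : Runs A I' τ' T') (hI : I ≠ I') (hK : T.ArityLe K)
    (hK' : T'.ArityLe K) : 0 < T.spine T' := by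
  by_contra h0
  obtain ⟨-, -, h1, h2⟩ := h.compare h'
  have hd := h2 (by omega)
  have hn : T.affectedNodes T' = 0 := by omega
  have hm : T.affectedMods T' = [] :=
    List.length_eq_zero_iff.1 (by have := Tree.affectedMods_length_le (t' := T') hK; simp_all)
  have hm' : T'.affectedMods T = [] :=
    List.length_eq_zero_iff.1 (by
      have := Tree.affectedMods_length_le (t' := T) hK'
      rw [Tree.affectedNodes_comm, hn] at this
      simp_all)
  obtain ⟨X, hX, hX'⟩ := h.changed_input h'
  obtain ⟨Y, hY, hY'⟩ := h'.changed_input h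
  rw [Tree.dist_comm, hd, Nat.le_zero, List.length_eq_zero_iff] at hY
  rw [hd, Nat.le_zero, List.length_eq_zero_iff] at hX
  subst hX hY
  rw [hm'] at hX'
  rw [hm] at hY'
  refine hI (funext fun i => Option.ext fun v => ⟨fun h => ?_, fun h => ?_⟩)
  · by_contra hne
    simpa using hY' i v h hne
  · by_contra hne
    simpa using hX' i v h hne

end Runs

/-! ### The changed inputs: their number, their readers, and the cost of writing them -/

section Update

variable {A : Prog ι V} {I I' : ι → Option V} {τ τ' : List (Modifiable ι × V)} {T T' : Tree ι V}
  {K : ℕ} {U : List (ι × V)}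

theorem IsUpdate.nodup_keys (hU : IsUpdate I I' U) :
    (U.map fun x => (Modifiable.static x.1 : Modifiable ι)).Nodup := by
  refine hU.1.map_on ?_
  rintro ⟨i, v⟩ hx ⟨j, w⟩ hy h
  obtain rfl := static_injective h
  have h1 := ((hU.2 _ _).1 hx).1.symm.trans ((hU.2 _ _).1 hy).1
  simpa using h1

theorem IsUpdate.length_le_nodes (hU : IsUpdate I I' U) (h' : Runs A I' τ' T') (hK' : T'.ArityLe K) :
    U.length ≤ K * T'.nodes := by
  have h1 : (U.map fun x => (Modifiable.static x.1 : Modifiable ι)) ⊆ T'.mods := by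
    intro m hm
    obtain ⟨⟨i, v⟩, hx, rfl⟩ := List.mem_map.1 hm
    exact Tree.mem_mods_of_reads (h'.reads ((hU.2 i v).1 hx).1)
  have := (List.subperm_of_subset hU.nodup_keys h1).length_le
  rw [List.length_map] at this
  exact this.trans (T'.mods_length_le hK')

variable [DecidableEq V]

/-- The loop over the update must be charged to the distance: each changed or added input is read by
an affected read of the new run, or was written by the old run inside an affected read. -/
theorem IsUpdate.length_le (hU : IsUpdate I I' U) (h : Runs A I τ T) (h' : Runs A I' τ' T')
    (hK' : T'.ArityLe K) : U.length ≤ T.dist T' + K * T.affectedNodes T' := by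
  obtain ⟨X, h1, h2⟩ := h.changed_input h'
  have h3 : (U.map fun x => (Modifiable.static x.1 : Modifiable ι)) ⊆
      T'.affectedMods T ++ X.map Prod.fst := by
    intro m hm
    obtain ⟨⟨i, v⟩, hx, rfl⟩ := List.mem_map.1 hm
    rw [List.mem_append]
    refine (h2 i v ((hU.2 i v).1 hx).1 ((hU.2 i v).1 hx).2).imp_right fun h => ?_
    exact List.mem_map.2 ⟨_, h, rfl⟩
  have h4 := (List.subperm_of_subset hU.nodup_keys h3).length_le
  have h5 := Tree.affectedMods_length_le (t' := T) hK'
  rw [Tree.affectedNodes_comm] at h5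
  rw [List.length_map, List.length_append, List.length_map] at h4
  omega

/-- Every changed modifiable is written once in total, as an input or by the run, so its readers are
counted once. All of them lie in affected subtrees of T, where they number at most K per node. -/
theorem IsUpdate.changeCost_le (hU : IsUpdate I I' U) (h : Runs A I τ T) (h' : Runs A I' τ' T')
    (hK : T.ArityLe K) :
    changeCost T (writes (inputStore I) τ) (U.map fun x => (.static x.1, x.2)) +
      changeCost T (writes (inputStore I) τ) τ' ≤ K * T.affectedNodes T' := by
  obtain ⟨h1, -⟩ := h.compare h'
  obtain ⟨⟨b', hb', -⟩, -⟩ := h'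
  refine le_trans ?_ (Tree.affectedMods_length_le (t' := T') hK)
  rw [← changeCost_append]
  set Z := (U.map fun x => ((.static x.1 : Modifiable ι), x.2)) ++ τ' with hZ
  have hF' : ∀ x ∈ Z, writes (inputStore I') τ' x.1 = some x.2 := by
    intro x hx
    rcases List.mem_append.1 hx with hx | hx
    · obtain ⟨⟨i, v⟩, hx', rfl⟩ := List.mem_map.1 hx
      exact hb'.writes_of_store ((hU.2 i v).1 hx').1
    · exact hb'.writes_of_write hx
  have hnd : (Z.map Prod.fst).Nodup := by
    rw [hZ, List.map_append, List.nodup_append']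
    refine ⟨by simpa [Function.comp_def] using hU.nodup_keys, hb'.keys_nodup, ?_⟩
    intro m hm hm'
    simp only [List.map_map, List.mem_map] at hm hm'
    obtain ⟨⟨i, v⟩, hx, rfl⟩ := hm
    obtain ⟨⟨m', v'⟩, hx', hm'⟩ := hm'
    simp only [Function.comp_apply] at hm'
    subst hm'
    have h2 := hb'.store_eq_none hx'
    simp [inputStore, ((hU.2 i v).1 hx).1] at h2
  refine le_trans ?_ (sum_count_le hnd _)
  rw [changeCost, List.map_map]
  refine List.sum_le_sum fun x hx => ?_
  split_ifs with hF
  · exact Nat.zero_le _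
  · exact h1 x.1 (by rw [hF' x hx]; exact hF)

variable {F : Modifiable ι → Option V} {S : State ι V} {Ω : Type*} [MeasurableSpace Ω] {μ : Measure Ω}
  [IsProbabilityMeasure μ] {H : Ω → Hash}

theorem afterRun_inv (I : ι → Option V) (τ : List (Modifiable ι × V)) (T : Tree ι V) :
    Inv T (writes (inputStore I) τ) ∅ ∅ (afterRun I τ T) where
  tab := ⟨fun m => List.Sublist.refl _, fun m => .inl rfl, fun m => by
    simp only [afterRun, Table.fresh]; omega⟩
  mark x := by simp [afterRun]
  flag q := by simp [afterRun]

theorem applyUpdate_spec (hH : UniformHashing μ H) (L : ℕ) (hI : Inv T F ∅ ∅ S)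
    (hU : (U.map fun x => (Modifiable.static x.1 : Modifiable ι)).Nodup)
    (hval : ∀ x ∈ U, S.val (.static x.1) = F (.static x.1)) :
    Inv T F ∅ ∅ (applyUpdate S U).1 ∧
    (∀ x ∈ U, (applyUpdate S U).1.val (.static x.1) = some x.2) ∧
    (∀ m, (∀ x ∈ U, .static x.1 ≠ m) → (applyUpdate S U).1.val m = S.val m) ∧
    (applyUpdate S U).1.tab = S.tab ∧ (applyUpdate S U).1.pend = S.pend ∧
    (applyUpdate S U).1.dels = S.dels ∧ (applyUpdate S U).2.length = U.length ∧
    ∃ ws, List.Forall₂ (fun c w => Cost.Bounded μ H (TabGood T L) c w (2 * T.height + L + 3))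
        (applyUpdate S U).2 ws ∧
      ws.sum + S.marked.card ≤ 4 * U.length + 5 * changeCost T F (U.map fun x => (.static x.1, x.2)) +
        (applyUpdate S U).1.marked.card := by
  induction U generalizing S with
  | nil => exact ⟨hI, by simp, fun _ _ => rfl, rfl, rfl, rfl, rfl, [], .nil, by simp [applyUpdate]⟩
  | cons x U ih =>
    obtain ⟨i, v⟩ := x
    rw [List.map_cons, List.nodup_cons] at hU
    have hne : ∀ x ∈ U, (Modifiable.static x.1 : Modifiable ι) ≠ .static i := fun x hx h =>
      hU.1 (List.mem_map.2 ⟨x, hx, h⟩)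
    obtain ⟨a1, a2, a3, a4, a5, w, a6, a7⟩ := State.write_spec hH L hI (fun _ _ _ h => h) v
      (.inl (hval (i, v) List.mem_cons_self)) (by simp)
    obtain ⟨b1, b2, b3, b4, b5, b6, b7, ws, b8, b9⟩ := ih a1 hU.2 (fun x hx => by
      rw [a2, Function.update_of_ne (hne x hx)]
      exact hval x (List.mem_cons_of_mem _ hx))
    rw [applyUpdate]
    refine ⟨b1, fun x hx => ?_, fun m hm => ?_, b4.trans a3, b5.trans a4, b6.trans a5, by simp [b7],
      w :: ws, .cons a6 b8, ?_⟩
    · rcases List.mem_cons.1 hx with rfl | hx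
      · refine (b3 _ hne).trans ?_
        rw [a2, Function.update_self]
      · exact b2 x hx
    · refine (b3 m fun x hx => hm x (List.mem_cons_of_mem _ hx)).trans ?_
      rw [a2, Function.update_of_ne (hm (i, v) List.mem_cons_self).symm]
    · rw [List.map_cons, changeCost_cons]
      simp only [List.sum_cons, List.length_cons] at a7 b9 ⊢
      omega

end Update

end

/-! ### Assembling change propagation -/

section

variable {ι V : Type*} [DecidableEq ι] [DecidableEq V] [Inhabited V]

section Main

variable {A : Prog ι V} {I I' : ι → Option V} {τ τ' : List (Modifiable ι × V)} {T T' : Tree ι V}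
  {K : ℕ} {U : List (ι × V)} {Ω : Type*} [MeasurableSpace Ω] {μ : Measure Ω}
  [IsProbabilityMeasure μ] {H : Ω → Hash}

/-- The state before the reader sets are updated. -/
def traversed (T : Tree ι V) (S : State ι V) (U : List (ι × V)) : State ι V :=
  (T.visit [] (applyUpdate S U).1).2.1

/-- The specification of the root, with nothing visited and an empty path. Writing the inputs has
brought the state into agreement with the new input store, while every other modifiable still has
its old final value. -/
theorem traversal_spec (hH : UniformHashing μ H) (L : ℕ) (h : Runs A I τ T) (h' : Runs A I' τ' T')
    (hK : T.ArityLe K) (hK' : T'.ArityLe K) (hU : IsUpdate I I' U) :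
    PropPost T (writes (inputStore I) τ) ∅ ∅ (Own [] 0) (Below []) (inputStore I') τ'
      (K * T.affectedNodes T') (applyUpdate (afterRun I τ T) U).1 (traversed T (afterRun I τ T) U) ∧
    CostSpec μ H T (writes (inputStore I) τ) K L (T.gap T')
      (1 + spanRate T K L * (T.span + T'.span)) τ' (applyUpdate (afterRun I τ T) U).1
      (traversed T (afterRun I τ T) U) (T.visit [] (applyUpdate (afterRun I τ T) U).1).2.2 := by
  have hT := h.readers_sBelow
  obtain ⟨⟨b, hb, rfl⟩, -⟩ := h
  obtain ⟨⟨b', hb', rfl⟩, -⟩ := h'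
  obtain ⟨a1, a2, a3, a4, a5, a6, -⟩ := applyUpdate_spec hH 0 (afterRun_inv I τ (b.node .S))
    hU.nodup_keys fun x _ => rfl
  have hown : ∀ m ∈ Own [] 0, inputStore I' m = none := by
    rintro _ ⟨q, j, rfl, -⟩
    rfl
  have hnode := seq_node_spec (body_spec (L := L) hH hT hb hb' (outer_static _ _) hown
    (fun m v => hb.writes_of_store) (fun m v => hb.writes_of_write) hK.2 hK'.2)
  have hfix : ∀ m, (∀ v, inputStore I' m ≠ some v) →
      (applyUpdate (afterRun I τ (b.node .S)) U).1.val m = writes (inputStore I) τ m := by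
    intro m hm
    refine a3 m ?_
    rintro ⟨i, v⟩ hx rfl
    exact hm v ((hU.2 i v).1 hx).1
  obtain ⟨-, h2, h3, -⟩ := hnode ∅ ∅ (applyUpdate (afterRun I τ (b.node .S)) U).1 (by simp [SuffixClosed])
    { inv := a1
      val := by
        intro m _ v hm
        obtain ⟨i, rfl, hi⟩ := inputStore_eq_some hm
        by_cases hi' : I i = some v
        · refine (a3 _ ?_).trans (hb.writes_of_store hi')
          rintro ⟨j, w⟩ hx hj
          obtain rfl := static_injective hj
          obtain ⟨h1, h2⟩ := (hU.2 _ _).1 hx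
          exact h2 (hi'.trans (hi.symm.trans h1))
        · exact a2 (i, v) ((hU.2 i v).2 ⟨hi, hi'⟩)
      new := by
        intro m v hm _
        refine hfix m fun v' hv' => ?_
        simp [hb'.store_eq_none hm] at hv'
      own := by
        intro m hm
        refine hfix m fun v' hv' => ?_
        simp [hown m hm] at hv'
      readers := by
        intro q _ m
        rw [a4]
        rfl
      fresh := by simp
      safe := by simp
      out := by simp } (.inl (by simp))
  exact ⟨h2, h3⟩

/-- After the root everything is visited and the path is empty, so no flag and no mark can remain:
the potential is back at zero. The tables used afterwards depend on this state only, not on the hash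
functions. -/
theorem traversed_spec (h : Runs A I τ T) (h' : Runs A I' τ' T')
    (hK : T.ArityLe K) (hK' : T'.ArityLe K) (hU : IsUpdate I I' U) (hH : UniformHashing μ H) :
    TabOK T (traversed T (afterRun I τ T) U) ∧ (traversed T (afterRun I τ T) U).pend.Nodup ∧
    (∀ x ∈ (traversed T (afterRun I τ T) U).pend,
      ∀ m, x.2 ∉ ((traversed T (afterRun I τ T) U).tab m).elems) ∧
    (traversed T (afterRun I τ T) U).pend.length + (traversed T (afterRun I τ T) U).dels.length ≤
      K * T.affectedNodes T' ∧
    (traversed T (afterRun I τ T) U).marked = ∅ := by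
  obtain ⟨-, -, -, -, a5, a6, -⟩ := applyUpdate_spec hH 0 (afterRun_inv I τ T) hU.nodup_keys fun x _ => rfl
  obtain ⟨h1, -⟩ := traversal_spec hH 0 h h' hK hK' hU
  obtain ⟨new, p1, p2, p3⟩ := h1.pend
  have h2 := h1.count
  rw [a5] at p1 h2
  rw [a6] at h2
  simp only [afterRun, List.append_nil, List.length_nil] at p1 h2
  refine ⟨h1.inv.tab, p1 ▸ p2, fun x hx => (p3 x (p1 ▸ hx)).2, by simpa [afterRun] using h2, ?_⟩
  rw [Finset.eq_empty_iff_forall_notMem]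
  intro x hx
  rcases (h1.inv.mark x).1 hx with h3 | ⟨q, hq, -⟩
  · exact h3
  · exact ((h1.inv.flag q).1 hq).1 (.inr (List.nil_suffix))

/-- The sum of four costs: writing the inputs, the test of the root, the traversal and the batch.
The spine is nonempty, which absorbs the additive constants into the factor 300. -/
theorem changePropagation_bounded (hH : UniformHashing μ H) (L : ℕ) (h : Runs A I τ T)
    (h' : Runs A I' τ' T') (hK : T.ArityLe K) (hK' : T'.ArityLe K) (hI : I ≠ I')
    (hU : IsUpdate I I' U) {M : ℕ} (hM : (K + 1) * (T.nodes + T'.nodes) + 1 ≤ 2 ^ M) :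
    (changePropagation T (afterRun I τ T) U).2.2.Bounded μ H
      (fun g => TabGood T L g ∧ ∀ t ∈ (traversed T (afterRun I τ T) U).flushTables,
        ∀ b, load t.size t.elems b g ≤ L)
      (300 * (K + 1) * (T.dist T' + T.spine T'))
      (13 + 5 * M + 2 * T.height + 3 * L + spanRate T K L * (T.span + T'.span)) := by
  obtain ⟨s1, s2, s3, s4, s5⟩ := traversed_spec h h' hK hK' hU hH
  obtain ⟨-, -, -, -, -, -, a7, ws, a8, a9⟩ := applyUpdate_spec hH L (afterRun_inv I τ T) hU.nodup_keys
    fun x _ => rfl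
  obtain ⟨-, w, b1, b2⟩ := traversal_spec hH L h h' hK hK' hU
  have hN := T.affectedNodes_le T'
  have hKN := Nat.mul_le_mul_left K hN
  have hf := State.flush_bounded (L := L) (M := M) hH s1 s2 s3 (by nlinarith)
  have hUn := hU.length_le_nodes h' hK'
  have hUl := hU.length_le h h' hK'
  have hcc := hU.changeCost_le h h' hK
  have hlog : Nat.clog 2 U.length ≤ M := (Nat.clog_le_iff_le_pow (by norm_num)).2 (by nlinarith)
  obtain ⟨-, -, c1, -⟩ := h.compare h'
  have hsp := h.spine_pos h' hI hK hK'
  rw [s5, Finset.card_empty] at b2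
  have ha9 : (afterRun I τ T).marked.card = 0 := rfl
  rw [ha9] at a9
  have hpar := Cost.Bounded.parFor a8
  rw [a7] at hpar
  have hpar' := hpar.mono_good (G' := fun g => TabGood T L g ∧
    ∀ t ∈ (traversed T (afterRun I τ T) U).flushTables, ∀ b, load t.size t.elems b g ≤ L) fun g hg => hg.1
  have hb1' := b1.mono_good (G' := fun g => TabGood T L g ∧
    ∀ t ∈ (traversed T (afterRun I τ T) U).flushTables, ∀ b, load t.size t.elems b g ≤ L) fun g hg => hg.1
  refine (((hpar'.add (Cost.Bounded.tick 1)).add hb1').add hf).mono ?_ ?_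
  · have hgap : T.gap T' = T.dist T' + T.affectedNodes T' + T.spine T' := rfl
    rw [hgap] at b2
    have hKa : K * T.affectedNodes T' ≤ 4 * (K * T.dist T') + 2 * (K * T.spine T') := by
      nlinarith [Nat.mul_le_mul_left K c1]
    have h4 : (4 * K + 6) * (T.dist T' + T.affectedNodes T' + T.spine T') =
      4 * (K * T.dist T') + 4 * (K * T.affectedNodes T') + 4 * (K * T.spine T') + 6 * T.dist T' +
        6 * T.affectedNodes T' + 6 * T.spine T' := by ring
    have h5 : 300 * (K + 1) * (T.dist T' + T.spine T') = 300 * (K * T.dist T') +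
      300 * (K * T.spine T') + 300 * T.dist T' + 300 * T.spine T' := by ring
    rw [h4] at b2
    rw [h5]
    generalize K * T.dist T' = x at *
    generalize K * T.spine T' = y at *
    generalize K * T.affectedNodes T' = z at *
    omega
  · omega

end Main

end

section

/-! ### Expectation and probability -/

namespace Cost.Bounded

variable {Ω : Type*} [MeasurableSpace Ω] {μ : Measure Ω} {H : Ω → Hash} {G : Hash → Prop} {c : Cost}
  {w s : ℕ}

theorem integrable (h : c.Bounded μ H G w s) : Integrable (fun ω => (c.work (H ω) : ℝ)) μ := by
  have hm : Measurable fun ω => (c.work (H ω) : ℝ) :=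
    (measurable_from_nat (f := fun n : ℕ => (n : ℝ))).comp h.meas
  refine ⟨hm.aestronglyMeasurable, ?_⟩
  rw [hasFiniteIntegral_iff_ofReal (ae_of_all _ fun ω => Nat.cast_nonneg _)]
  simp only [ENNReal.ofReal_natCast]
  exact h.work.trans_lt (ENNReal.natCast_lt_top w)

theorem integral_le (h : c.Bounded μ H G w s) : ∫ ω, (c.work (H ω) : ℝ) ∂μ ≤ w := by
  have hw := h.work
  rw [integral_eq_lintegral_of_nonneg_ae (ae_of_all _ fun ω => Nat.cast_nonneg _)
    h.integrable.aestronglyMeasurable]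
  simp only [ENNReal.ofReal_natCast]
  exact ENNReal.toReal_le_of_le_ofReal (Nat.cast_nonneg _) (by rwa [ENNReal.ofReal_natCast])

end Cost.Bounded

/-- The choice of the chain length L: with Γ·N² buckets in the union bound, L has to exceed
log(Γ·N²) + 4 by c·log N. -/
theorem tail_le {Γ N c L : ℝ} (hΓ : 0 < Γ) (hN : 0 < N)
    (hL : (c + 2) * Real.log N + Real.log Γ + 4 ≤ L) :
    Γ * N ^ 2 * Real.exp (4 - L) ≤ 1 / N ^ c := by
  have h1 : Real.exp (4 - L) ≤ Real.exp (-((c + 2) * Real.log N + Real.log Γ)) :=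
    Real.exp_le_exp.2 (by linarith)
  have h2 : Real.exp (-((c + 2) * Real.log N + Real.log Γ)) = 1 / (N ^ c * N ^ 2 * Γ) := by
    rw [Real.exp_neg, Real.exp_add, Real.exp_log hΓ, one_div, mul_comm (c + 2), ← Real.rpow_def_of_pos hN,
      Real.rpow_add hN]
    norm_num
  have h3 : 0 < N ^ c := Real.rpow_pos_of_pos hN c
  calc Γ * N ^ 2 * Real.exp (4 - L) ≤ Γ * N ^ 2 * (1 / (N ^ c * N ^ 2 * Γ)) :=
        mul_le_mul_of_nonneg_left (h1.trans_eq h2) (by positivity)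
    _ = 1 / N ^ c := by field_simp

/-! ### The family of hash tables and the constants -/

section Main

variable {ι V : Type*} [DecidableEq ι] [DecidableEq V] [Inhabited V]
  {A : Prog ι V} {I I' : ι → Option V} {τ τ' : List (Modifiable ι × V)} {T T' : Tree ι V}
  {K : ℕ} {U : List (ι × V)} {Ω : Type*} [MeasurableSpace Ω] {μ : Measure Ω}
  [IsProbabilityMeasure μ] {H : Ω → Hash}

/-- The hash tables that are used by change propagation. -/
def usedTables (T : Tree ι V) (S : State ι V) : List Table :=
  (T.mods.map fun m => Table.fresh (T.readers m [])) ++ S.flushTables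

/-- Modifiables that are not read have empty tables, so finitely many tables suffice for a bound on
all modifiables. -/
theorem tabGood_of_usedTables {S : State ι V} {L : ℕ} {g : Hash}
    (h : ∀ t ∈ usedTables T S, ∀ b, load t.size t.elems b g ≤ L) : TabGood T L g := by
  intro m b
  by_cases hm : m ∈ T.mods
  · exact h _ (List.mem_append_left _ (List.mem_map.2 ⟨m, hm, rfl⟩)) b
  · have h0 : T.readers m [] = [] := by
      rw [List.eq_nil_iff_forall_not_mem]
      exact fun q hq => hm (Tree.mem_mods_of_reader hq)
    simp [h0, load]

theorem usedTables_spec (h : Runs A I τ T) (h' : Runs A I' τ' T') (hK : T.ArityLe K)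
    (hK' : T'.ArityLe K) (hU : IsUpdate I I' U) (hH : UniformHashing μ H) (hn : 0 < T.nodes) :
    (∀ t ∈ usedTables T (traversed T (afterRun I τ T) U),
      1 ≤ t.size ∧ t.elems.Nodup ∧ t.elems.length ≤ 2 * t.size) ∧
    ((usedTables T (traversed T (afterRun I τ T) U)).map Table.size).sum ≤
      7 * (K + 1) ^ 2 * (T.nodes + T'.nodes) ^ 2 := by
  obtain ⟨s1, s2, s3, s4, -⟩ := traversed_spec h h' hK hK' hU hH
  obtain ⟨f1, f2⟩ := State.flushTables_spec s1 s2 s3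
  have hN := Nat.mul_le_mul_left K (T.affectedNodes_le T')
  set S := traversed T (afterRun I τ T) U
  constructor
  · intro t ht
    rcases List.mem_append.1 ht with ht | ht
    · obtain ⟨m, -, rfl⟩ := List.mem_map.1 ht
      exact ⟨le_max_left _ _, T.readers_nodup m [], by simp only [Table.fresh]; omega⟩
    · exact f1 t ht
  · rw [usedTables, List.map_append, List.sum_append, List.map_map]
    have h1 : (T.mods.map (Table.size ∘ fun m => Table.fresh (T.readers m []))).sum ≤
        T.mods.length * (T.nodes + 1) := by
      rw [← smul_eq_mul, ← List.length_map (f := Table.size ∘ fun m => Table.fresh (T.readers m []))]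
      refine List.sum_le_card_nsmul _ _ fun x hx => ?_
      obtain ⟨m, -, rfl⟩ := List.mem_map.1 hx
      have := T.readers_length_le m []
      simp only [Function.comp_apply, Table.fresh]
      omega
    have h2 := Nat.mul_le_mul_right (T.nodes + 1) (T.mods_length_le hK)
    set N := T.nodes + T'.nodes
    have hN' : S.pend.length + S.dels.length ≤ K * N := s4.trans hN
    have h3 : (S.pend.length + S.dels.length) * (2 * (T.nodes + S.pend.length + 1)) ≤
        K * N * (2 * (N + K * N + N)) := Nat.mul_le_mul hN' (by omega)
    have h4 : K * T.nodes * (T.nodes + 1) ≤ K * N * (2 * N) :=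
      Nat.mul_le_mul (Nat.mul_le_mul_left K (by omega)) (by omega)
    have h5 : K * N * (2 * N) + K * N * (2 * (N + K * N + N)) ≤ 7 * (K + 1) ^ 2 * N ^ 2 := by
      have : 7 * (K + 1) ^ 2 * N ^ 2 =
        K * N * (2 * N) + K * N * (2 * (N + K * N + N)) + (5 * K ^ 2 + 8 * K + 7) * N ^ 2 := by ring
      omega
    omega

/-- The trees have fewer than 2^h nodes each, and inputs are at most K per node because they are
read. -/
theorem log_nodes_le {n h : ℕ} (hn : 0 < n) (hh : 0 < h) (h1 : n ≤ (K + 1) * (2 ^ h + 2 ^ h)) :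
    Real.log n ≤ (K + 2) * h := by
  have h2 : n ≤ 2 ^ (K + 1 + h) := by
    have := Nat.mul_le_mul_right (2 ^ h + 2 ^ h) (Nat.lt_two_pow_self (n := K))
    refine h1.trans (this.trans_eq ?_)
    rw [pow_add, pow_add]; ring
  have h3 : Real.log n ≤ Real.log ((2 : ℝ) ^ (K + 1 + h)) :=
    Real.log_le_log (by exact_mod_cast hn) (by exact_mod_cast h2)
  rw [Real.log_pow] at h3
  have h4 : Real.log 2 ≤ 1 := by
    have := Real.log_le_sub_one_of_pos (x := 2) (by norm_num)
    linarith
  have h5 : (1 : ℝ) ≤ h := by exact_mod_cast hh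
  have h6 : ((K + 1 + h : ℕ) : ℝ) * Real.log 2 ≤ (K + 1 + h : ℕ) :=
    mul_le_of_le_one_right (Nat.cast_nonneg _) h4
  push_cast at h3 h6
  have h7 : (0 : ℝ) ≤ K := Nat.cast_nonneg _
  nlinarith

/-- The factor by which the chains in the hash tables may exceed the height of the trees. -/
noncomputable def chainFactor (K : ℕ) : ℝ := 3 * (K + 2) + Real.log (7 * (K + 1) ^ 2) + 5

/-- The factor in the bounds on work and span. -/
noncomputable def costFactor (K : ℕ) : ℝ := 300 * (K + 1) + (51 + 13 * K + (5 + 4 * K) * chainFactor K)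

theorem log_factor_nonneg (K : ℕ) : 0 ≤ Real.log (7 * (K + 1) ^ 2) := by
  refine Real.log_nonneg ?_
  have : (0 : ℝ) ≤ K := Nat.cast_nonneg _
  nlinarith

/-- Since c, s and h are at least 1, each summand is at most a constant times c·s·h. The chain
length L is itself of order c·h and is multiplied by s only, never by another h. -/
theorem span_arith {s h h₁ s₁ s₂ L M : ℕ} {c : ℝ} (hs : 0 < s) (hh : 0 < h) (hh₁ : h₁ ≤ h) (hs₁ : s₁ ≤ s)
    (hs₂ : s₂ ≤ s) (hM : M = h + 1 + K) (hc : 1 ≤ c) (hL : (L : ℝ) ≤ chainFactor K * (c * h))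
    (hT : T.height = h₁) :
    ((13 + 5 * M + 2 * h₁ + 3 * L + spanRate T K L * (s₁ + s₂) : ℕ) : ℝ) ≤
      costFactor K * (c * ((s : ℝ) * (h : ℝ))) := by
  have h1 : 13 + 5 * M + 2 * h₁ + 3 * L + spanRate T K L * (s₁ + s₂) ≤
      13 + 5 * (h + 1 + K) + 2 * h + 3 * L + (2 * h + (2 * K + 1) * L + (4 * K + 11)) * (2 * s) := by
    have : spanRate T K L * (s₁ + s₂) ≤ (2 * h + (2 * K + 1) * L + (4 * K + 11)) * (2 * s) := by
      refine Nat.mul_le_mul ?_ (by omega)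
      rw [spanRate, hT]
      nlinarith
    omega
  refine (Nat.cast_le.2 h1).trans ?_
  push_cast
  have hs' : (1 : ℝ) ≤ s := by exact_mod_cast hs
  have hh' : (1 : ℝ) ≤ h := by exact_mod_cast hh
  have hK : (0 : ℝ) ≤ K := Nat.cast_nonneg _
  have hX : 0 ≤ chainFactor K := by
    have := log_factor_nonneg K
    rw [chainFactor]; positivity
  set P := c * ((s : ℝ) * h) with hP
  have hsh : (s : ℝ) * h ≤ P := le_mul_of_one_le_left (by positivity) hc
  have hs1 : (s : ℝ) ≤ P := (le_mul_of_one_le_right (by positivity) hh').trans hsh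
  have hh1 : (h : ℝ) ≤ P := (le_mul_of_one_le_left (by positivity) hs').trans hsh
  have hP1 : 1 ≤ P := hs'.trans hs1
  have hsL : (L : ℝ) * s ≤ chainFactor K * P := by
    have := mul_le_mul_of_nonneg_right hL (zero_le_one.trans hs')
    calc (L : ℝ) * s ≤ _ := this
      _ = chainFactor K * P := by rw [hP]; ring
  have hL1 : (L : ℝ) ≤ chainFactor K * P :=
    (le_mul_of_one_le_right (Nat.cast_nonneg _) hs').trans hsL
  have hKP : (K : ℝ) ≤ K * P := le_mul_of_one_le_right hK hP1
  have hKs : (K : ℝ) * s ≤ K * P := mul_le_mul_of_nonneg_left hs1 hK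
  have hKL : (K : ℝ) * (L * s) ≤ K * (chainFactor K * P) := mul_le_mul_of_nonneg_left hsL hK
  have hKP0 : 0 ≤ (K : ℝ) * P := by positivity
  have e1 : (13 + 5 * ((h : ℝ) + 1 + K) + 2 * h + 3 * L + (2 * h + (2 * K + 1) * L + (4 * K + 11)) * (2 * s))
    = 18 + 7 * h + 5 * K + 3 * L + 4 * (s * h) + 4 * (K * (L * s)) + 2 * (L * s) + 8 * (K * s) + 22 * s := by
    ring
  have e2 : costFactor K * P = 300 * (K * P) + 300 * P + (51 * P + 13 * (K * P) +
      5 * (chainFactor K * P) + 4 * (K * (chainFactor K * P))) := by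
    rw [costFactor]; ring
  rw [e1, e2]
  linarith

end Main

end

end SelfAdjusting

/-! ### The theorem -/

theorem theorem1 (K : ℕ) :
    ∃ C : ℝ, 0 < C ∧
      ∀ (ι : Type*) (V : Type*) [DecidableEq ι] [DecidableEq V] [Inhabited V]
        (A : SelfAdjusting.Prog ι V) (I I' : ι → Option V)
        (τ τ' : List (SelfAdjusting.Modifiable ι × V)) (T T' : SelfAdjusting.Tree ι V)
        (U : List (ι × V)),
        SelfAdjusting.Runs A I τ T → SelfAdjusting.Runs A I' τ' T' →
        T.ArityLe K → T'.ArityLe K →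
        I ≠ I' → SelfAdjusting.IsUpdate I I' U →
        ∀ (Ω : Type*) [MeasurableSpace Ω] (μ : MeasureTheory.Measure Ω)
          [MeasureTheory.IsProbabilityMeasure μ] (H : Ω → SelfAdjusting.Hash),
          SelfAdjusting.UniformHashing μ H →
          ∀ (cost : SelfAdjusting.Cost) (W R s h n : ℕ),
            cost = (SelfAdjusting.changePropagation T (SelfAdjusting.afterRun I τ T) U).2.2 →
            W = SelfAdjusting.Tree.dist T T' →
            R = SelfAdjusting.Tree.numAffected T T' →
            s = max T.span T'.span →
            h = max T.height T'.height →
            n = T.nodes + T'.nodes + {i | I i ≠ none}.ncard + {i | I' i ≠ none}.ncard →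
            (MeasureTheory.Integrable (fun ω => (cost.work (H ω) : ℝ)) μ ∧
              ∫ ω, (cost.work (H ω) : ℝ) ∂μ ≤ C * ((W : ℝ) + (R : ℝ) * (h : ℝ))) ∧
            ∀ c : ℝ, 1 ≤ c →
              1 - 1 / (n : ℝ) ^ c ≤
                μ.real {ω | (cost.span (H ω) : ℝ) ≤ C * (c * ((s : ℝ) * (h : ℝ)))} := by
  open SelfAdjusting in
  refine ⟨costFactor K, ?_, ?_⟩
  · have h1 := log_factor_nonneg K
    have h2 : (0 : ℝ) ≤ K := Nat.cast_nonneg _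
    have h3 : 0 ≤ chainFactor K := by rw [chainFactor]; positivity
    rw [costFactor]
    positivity
  intro ι V _ _ _ A I I' τ τ' T T' U h h' hK hK' hI hU Ω _ μ _ H hH cost W R s ht n hcost hW hR hs hht hn
  have hsp := h.spine_pos h' hI hK hK'
  have hRh : T.spine T' ≤ R * ht := by
    rw [hR, hht]
    exact (Tree.spine_le T T').trans (Nat.mul_le_mul_left _ (le_max_left _ _))
  have hnodes : T.nodes + 1 ≤ 2 ^ ht :=
    T.nodes_lt_two_pow.trans_le (Nat.pow_le_pow_right (by norm_num) (hht ▸ le_max_left _ _))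
  have hnodes' : T'.nodes + 1 ≤ 2 ^ ht :=
    T'.nodes_lt_two_pow.trans_le (Nat.pow_le_pow_right (by norm_num) (hht ▸ le_max_right _ _))
  have hht0 : 0 < ht := (Tree.height_pos_of_spine hsp).trans_le (hht ▸ le_max_left _ _)
  have hT0 : 0 < T.nodes := by
    obtain ⟨⟨b, -, rfl⟩, -⟩ := h
    rw [Body.node_nodes]
    omega
  have hs0 : 0 < s := by
    refine lt_of_lt_of_le ?_ (hs ▸ le_max_left _ _)
    obtain ⟨⟨b, hb, rfl⟩, -⟩ := h
    obtain ⟨⟨b', hb', rfl⟩, -⟩ := h'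
    rw [Body.spine_S] at hsp
    exact hb.span_pos (b' := b') (by omega)
  have hpow : (K + 1) * (T.nodes + T'.nodes) + 1 ≤ 2 ^ (ht + 1 + K) := by
    have h1 : (K + 1) * (T.nodes + T'.nodes + 1) ≤ 2 ^ K * (2 ^ ht + 2 ^ ht) :=
      Nat.mul_le_mul (Nat.lt_two_pow_self (n := K)) (by omega)
    have h2 : 2 ^ (ht + 1 + K) = 2 ^ K * (2 ^ ht + 2 ^ ht) := by rw [pow_add, pow_add]; ring
    rw [h2]
    refine le_trans ?_ h1
    rw [mul_add_one]
    omega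
  have hb := fun L => changePropagation_bounded hH L h h' hK hK' hI hU hpow
  rw [← hcost] at hb
  -- The bound on the work does not involve the chain length, so L = 0 serves as well as any other
  -- value.
  refine ⟨⟨(hb 0).integrable, (hb 0).integral_le.trans ?_⟩, fun c hc => ?_⟩
  · have h1 : ((300 * (K + 1) * (T.dist T' + T.spine T') : ℕ) : ℝ) ≤
        300 * (K + 1) * ((W : ℝ) + R * ht) := by
      have : 300 * (K + 1) * (T.dist T' + T.spine T') ≤ 300 * (K + 1) * (W + R * ht) :=
        Nat.mul_le_mul_left _ (Nat.add_le_add hW.ge hRh)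
      exact_mod_cast this
    refine h1.trans (mul_le_mul_of_nonneg_right ?_ (by positivity))
    have h1 := log_factor_nonneg K
    have h2 : (0 : ℝ) ≤ K := Nat.cast_nonneg _
    have h3 : 0 ≤ chainFactor K := by rw [chainFactor]; positivity
    rw [costFactor]
    have : (0 : ℝ) ≤ 51 + 13 * K + (5 + 4 * K) * chainFactor K := by positivity
    linarith
  · have hnN : T.nodes + T'.nodes ≤ n := by omega
    have hn0 : 0 < n := by omega
    have hnle : n ≤ (K + 1) * (2 ^ ht + 2 ^ ht) := by
      have h1 := h.ncard_le hK
      have h2 := h'.ncard_le hK'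
      have h3 : n ≤ (K + 1) * (T.nodes + T'.nodes) := by rw [hn]; nlinarith
      exact h3.trans (Nat.mul_le_mul_left _ (by omega))
    have hlog := log_nodes_le hn0 hht0 hnle
    have hΓ := log_factor_nonneg K
    have hln : 0 ≤ Real.log n := Real.log_natCast_nonneg n
    have hK0 : (0 : ℝ) ≤ K := Nat.cast_nonneg _
    have hh1 : (1 : ℝ) ≤ ht := by exact_mod_cast hht0
    -- This is the length required by `tail_le` for Γ = 7(K + 1)² and N = n. Rounding it up raises
    -- the 4 to the 5 in `chainFactor`.
    set l : ℝ := (c + 2) * Real.log n + Real.log (7 * (K + 1) ^ 2) + 4 with hl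
    have hl0 : 0 ≤ l := by positivity
    have hL : (⌈l⌉₊ : ℝ) ≤ chainFactor K * (c * ht) := by
      have h1 := (Nat.ceil_lt_add_one hl0).le
      have h2 : (c + 2) * Real.log n ≤ 3 * c * ((K + 2) * ht) :=
        mul_le_mul (by linarith) hlog hln (by linarith)
      have h3 : 1 ≤ c * ht := one_le_mul_of_one_le_of_one_le hc hh1
      have h4 : Real.log (7 * (K + 1) ^ 2) + 5 ≤ (Real.log (7 * (K + 1) ^ 2) + 5) * (c * ht) :=
        le_mul_of_one_le_right (by linarith) h3
      rw [chainFactor]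
      nlinarith
    obtain ⟨t1, t2⟩ := usedTables_spec h h' hK hK' hU hH hT0
    have htail := tail_le (Γ := 7 * ((K : ℝ) + 1) ^ 2) (N := n) (c := c) (L := (⌈l⌉₊ : ℝ))
      (by positivity) (by exact_mod_cast hn0) (Nat.le_ceil l)
    have hsum : (((usedTables T (traversed T (afterRun I τ T) U)).map Table.size).sum : ℝ) ≤
        7 * ((K : ℝ) + 1) ^ 2 * (n : ℝ) ^ 2 := by
      have h1 := t2.trans (Nat.mul_le_mul_left _ (Nat.pow_le_pow_left hnN 2))
      exact_mod_cast h1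
    have hprob := hH.forall_load_le _ t1 ⌈l⌉₊
    have hmul := mul_le_mul_of_nonneg_right hsum (Real.exp_nonneg (4 - (⌈l⌉₊ : ℝ)))
    -- The event that all chains are short has the required probability, and on it the span bound
    -- holds surely.
    refine le_trans (by linarith) (hprob.trans (MeasureTheory.measureReal_mono ?_))
    intro ω hω
    have hgood := (hb ⌈l⌉₊).span (H ω) ⟨tabGood_of_usedTables hω, fun t ht =>
      hω t (List.mem_append_right _ ht)⟩
    exact (Nat.cast_le.2 hgood).trans (span_arith hs0 hht0 (hht ▸ le_max_left _ _)
      (hs ▸ le_max_left _ _) (hs ▸ le_max_right _ _) rfl hc hL rfl)
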